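/- **Notation.** For $0<m<1$ let $\mathbb K(m)=\int_0^1\frac{ds}{\sqrt{(1-s^2)(1-ms^2)}}$, $\mathbb E(m)=\int_0^1\sqrt{\frac{1-ms^2}{1-s^2}}\,ds$ and $$\rho(m)=\frac{\mathbb E(m)}{\mathbb K(m)\sqrt{m(1-m)}}-\sqrt{\frac{1-m}{m}} .$$ Powers are principal branches, $\sqrt{-w}$ is cut along $w\ge 0$, and $z^*$ is the complex conjugate. **Data.** Let $G:\mathbb R\to\mathbb R$ be a Schwartz function that is even, increasing on $x>0$, and satisfies $-2<G(0)<0$. Suppose that the phase integral $\Psi(iv)=\frac14\int\sqrt{G(s)^2-16v^2}\,ds$, $0<v<-\frac14G(0)$ (integration over the set where $G(s)^2\ge16v^2$), is strictly decreasing in $v$ and continues analytically to a domain $D$ containing the segment $[0,-\frac i4G(0)]$, with $\Psi(-\frac i4G(0))=0$, $-i\Psi'(-\frac i4G(0))>0$, $\Psi(0)=-\frac14\int G$, $-i\Psi'(0)>0$, and $\Psi(\lambda)-\Psi(0)-\lambda\Psi'(0)$ even near $\lambda=0$. Put $E(w)=\frac i4\left(\sqrt{-w}+\frac1{\sqrt{-w}}\right)$,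 $\theta_0(w)=\Psi(E(w))$, and let $\mu\in(0,\pi)$ be given by $\sin(\mu/2)=-\frac12G(0)$. **Contours.** All contours are symmetric under $w\mapsto w^*$; we describe the upper halves, which are $C^1$ arcs. $P_\infty$ is the arc of the unit circle from $e^{i\mu}$ to $1$. $\beta$ is a simple arc from a point $\alpha$ in the upper half-plane to $1$. $\ell$ is a simple arc from $e^{i\mu}$ to $1$ such that $L=P_\infty\cup\ell$, with both arcs oriented towards $1$, encloses $\beta$, and $E$ maps the closed region bounded by $P_\infty\cup\ell$ (apart from the point $1$) into $D$. $L_\beta$ is a simple loop based at $1$ inside $L$ that encircles $\beta$ once clockwise. At $1$ the tangent directions of these arcs are distinct and ordered compatibly with these inclusions. $R(w)$ is analytic off $\beta\cup\beta^*$ with $R(w)^2=(w-\alpha)(w-\alpha^*)$ and $R(w)=w+O(1)$ as $w\to\infty$. For real $x,t$ set $$M=\frac2\pi\int_L\frac{\theta_0'(\xi)\sqrt{-\xi}}{R(\xi)}d\xi+x+t+\frac{x-t}{\sqrt{\alpha\alpha^*}},\qquad I=\frac14\oint_{L_\beta}R(w)H_0(w)\,dw,$$ $$H_0(w)=-\frac1{4\sqrt{-w}}\left[\frac{x-t}{w\sqrt{\alpha\alpha^*}}-\frac2\pi\int_L\frac{\theta_0'(\xi)\sqrt{-\xi}}{R(\xi)(\xi-w)}d\xi\right]$$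 (for $w$ inside $L$ in the last formula). **Gradient catastrophe.** Call $(x,t,\beta)$ *admissible* if $M=I=0$; the tangent to $\beta$ at $1$ makes an angle in $(0,\frac\pi2)$ with the ray $w>1$; and there is a function $\varphi$, analytic in the upper half-plane off $P_\infty\cup\beta$ where $E(w)\in D$, with $\varphi'=RH_0$ inside $L$ (and $\varphi'=RH_0-i\theta_0'$ outside $L$, where $H_0$ is given by the same integral formula), whose real part tends to $0$ at $\beta$, and such that for all small $\delta>0$ some arc $\gamma$ from $1-\delta$ to $\alpha$ satisfies $\mathrm{Re}\,\varphi<0$ on it and forms with $\beta$ and the segment $[1-\delta,1]$ a clockwise loop around $P_\infty$. The *modulated librational wave region* is the set of $(x,t)$ for which some $\beta$ is admissible with $H_0$ bounded away from zero on $\beta$. The point $(0,t_{\rm gc})$ is a *simple gradient catastrophe point* with arc $\beta_{\rm gc}$ if it lies on the boundary of that region, $(0,t_{\rm gc},\beta_{\rm gc})$ is admissible, $H_0(\alpha_{\rm gc})=0\ne H_0'(\alpha_{\rm gc})$, and $H_0(w)/(w-\alpha_{\rm gc})$ is bounded away from zero on $\beta_{\rm gc}$. Suppose this holds for some $t_{\rm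 gc}>0$, with $\alpha_{\rm gc}=e^{i\theta}$, $\mu<\theta<\pi$. **The function $s$.** For $(x,t)$ near $(0,t_{\rm gc})$ and arcs $\beta=\beta(x,t)$ from $\alpha=\alpha(x,t)$ to $1$, varying continuously (with their tangents) and equal to $\beta_{\rm gc}$ at $(0,t_{\rm gc})$, let $A=\frac12\oint_{L_\beta}\frac{\sqrt{-w}}{R(w)}dw$, $B=\frac12\oint_{L_\beta}\frac{dw}{R(w)\sqrt{-w}}$, let $(n,n^*)$ solve $8n+8n^*=-M$, $(A+\alpha^*B)n+(A+\alpha B)n^*=-I$, and set $$H(w)=-\frac2{\sqrt{-w}}\left(\frac n{w-\alpha}+\frac{n^*}{w-\alpha^*}\right)+H_0(w).$$ With $w=\alpha+q^2$ let $f(q)=\frac12\tilde\varphi(w)$, where $\tilde\varphi(\alpha)=0$ and $\tilde\varphi'(w)=-(w-\alpha)^{1/2}(w-\alpha^*)^{1/2}H(w)$, $(w-\alpha)^{1/2}=q$; that is, $f(q)=-\int_0^q(\alpha+z^2-\alpha^*)^{1/2}\,z^2H(\alpha+z^2)\,dz$. Suppose that, near $(0,t_{\rm gc})$, $\alpha(x,t)$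 and $s(x,t)$ are complex-valued real-analytic functions with $\alpha(0,t_{\rm gc})=\alpha_{\rm gc}$, $s(0,t_{\rm gc})=0$, and $W(w;x,t)$ is a conformal map near $w=\alpha(x,t)$ with $W(\alpha+q^2;x,t)=Q(q;x,t)^2$, $Q$ odd and univalent in $q$ on a fixed disc $|q|<r$ and jointly continuous, such that $$\tfrac12\tilde\varphi=\tfrac45W^{5/2}+sW^{1/2},\qquad\text{i.e.}\qquad f(q)=\tfrac45Q(q)^5+s\,Q(q),$$ the branch at $(0,t_{\rm gc})$ being the one with $\arg Q_{\rm gc}'(0)=\frac\pi4-\frac\theta2$ (so $\arg W_{\rm gc}'(\alpha_{\rm gc})=\frac\pi2-\theta$), where $W_{\rm gc}(w)=W(w;0,t_{\rm gc})$ and $Q_{\rm gc}(q)=Q(q;0,t_{\rm gc})$. **Lemma.** Let $m_{\rm gc}=\sin^2(\theta/2)$. Then $\rho(m_{\rm gc})>0$ and $$\frac{\partial s}{\partial x}(0,t_{\rm gc})=ia,\qquad\frac{\partial s}{\partial t}(0,t_{\rm gc})=b,$$ where $$a=-\frac{(m_{\rm gc}(1-m_{\rm gc}))^{1/4}}{2|W_{\rm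 gc}'(\alpha_{\rm gc})|^{1/2}}<0,\qquad b=\frac{(m_{\rm gc}(1-m_{\rm gc}))^{1/4}}{2|W_{\rm gc}'(\alpha_{\rm gc})|^{1/2}}\,\rho(m_{\rm gc})=-a\,\rho(m_{\rm gc})>0 .$$ -/

import Mathlib

open Complex Set Filter Topology MeasureTheory
open scoped ComplexConjugate SchwartzMap

noncomputable section

namespace SineGordon

/-! ### Complete elliptic integrals and the function `ρ` -/

/-- Complete elliptic integral of the first kind, with parameter `m`. -/
def ellipticK (m : ℝ) : ℝ :=
  ∫ s in (0 : ℝ)..1, 1 / Real.sqrt ((1 - s ^ 2) * (1 - m * s ^ 2))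

/-- Complete elliptic integral of the second kind, with parameter `m`. -/
def ellipticE (m : ℝ) : ℝ :=
  ∫ s in (0 : ℝ)..1, Real.sqrt ((1 - m * s ^ 2) / (1 - s ^ 2))

/-- `ρ(m) = E(m) / (K(m) √(m(1-m))) - √((1-m)/m)`. -/
def rho (m : ℝ) : ℝ :=
  ellipticE m / (ellipticK m * Real.sqrt (m * (1 - m))) - Real.sqrt ((1 - m) / m)

/-! ### The impulse profile and its phase integral -/

/-- A Schwartz-class, even impulse profile, increasing for `x > 0`, and globally below the
threshold for rotation: `-2 < G(0) < 0`. -/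
structure IsImpulseProfile (G : 𝓢(ℝ, ℝ)) : Prop where
  even : ∀ x, G (-x) = G x
  mono : MonotoneOn G (Ioi 0)
  lower : -2 < G 0
  neg : G 0 < 0

/-- `Ψ` is an analytic continuation, to the domain `D`, of the phase integral
`Ψ(iv) = (1/4) ∫ √(G(s)² - 16 v²) ds`, `0 < v < -G(0)/4`, the integral being over the interval
where the radicand is nonnegative (`Real.sqrt` vanishes elsewhere); and `Ψ` has the properties
required of the phase integral. -/
structure IsPhaseIntegral (G : 𝓢(ℝ, ℝ)) (Ψ : ℂ → ℂ) (D : Set ℂ) : Prop where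
  isOpen : IsOpen D
  isPreconnected : IsPreconnected D
  segment_mem : ∀ v ∈ Icc (0 : ℝ) (-(G 0) / 4), (v : ℂ) * I ∈ D
  analytic : AnalyticOnNhd ℂ Ψ D
  eq_integral : ∀ v ∈ Ioo (0 : ℝ) (-(G 0) / 4),
    Ψ (v * I) = (((1 / 4) * ∫ s : ℝ, Real.sqrt (G s ^ 2 - 16 * v ^ 2) : ℝ) : ℂ)
  strictAnti : StrictAntiOn (fun v : ℝ => (Ψ (v * I)).re) (Ioo 0 (-(G 0) / 4))
  top_value : Ψ (((-(G 0) / 4 : ℝ) : ℂ) * I) = 0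
  top_deriv : ∃ r : ℝ, 0 < r ∧ -I * deriv Ψ (((-(G 0) / 4 : ℝ) : ℂ) * I) = r
  zero_value : Ψ 0 = ((-(1 / 4) * ∫ s : ℝ, G s : ℝ) : ℂ)
  zero_deriv : ∃ r : ℝ, 0 < r ∧ -I * deriv Ψ 0 = r
  even_germ : ∀ᶠ z in 𝓝 (0 : ℂ),
    Ψ (-z) - Ψ 0 - (-z) * deriv Ψ 0 = Ψ z - Ψ 0 - z * deriv Ψ 0

/-- The angle `μ ∈ (0, π)` with `E(e^{iμ}) = -(i/4) G(0)`, i.e. `sin(μ/2) = -G(0)/2`. -/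
def endAngle (G : 𝓢(ℝ, ℝ)) : ℝ := 2 * Real.arcsin (-(G 0) / 2)

/-- The principal square root `√(-w)`, cut along `w ≥ 0`. -/
def sqrtNeg (w : ℂ) : ℂ := (-w) ^ (1 / 2 : ℂ)

/-- `E(w) = (i/4) (√(-w) + 1/√(-w))`. -/
def specE (w : ℂ) : ℂ := I / 4 * (sqrtNeg w + 1 / sqrtNeg w)

/-- `θ₀(w) = Ψ(E(w))`. -/
def theta0 (Ψ : ℂ → ℂ) (w : ℂ) : ℂ := Ψ (specE w)

/-! ### Contours

All contours are given by their parts in the upper half-plane; each is completed by its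
reflection in the real axis, traversed so that the reflection of a parametrization is a
parametrization.  Hence, for a Schwarz-symmetric integrand (`f(w*) = f(w)*`), the integral over a
contour and its reflection is twice the real part of the integral over the upper part. -/

/-- Contour integral over a `C¹` parametrized curve `γ : [0,1] → ℂ`. -/
def cint (γ : ℝ → ℂ) (f : ℂ → ℂ) : ℂ :=
  ∫ u in (0 : ℝ)..1, f (γ u) * deriv γ u

/-- The point set of a parametrized curve. -/
def trace (γ : ℝ → ℂ) : Set ℂ := γ '' Icc 0 1

/-- A regular simple `C¹` arc from `a` to `b` whose interior lies in the open upper half-plane. -/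
structure IsArc (γ : ℝ → ℂ) (a b : ℂ) : Prop where
  contDiff : ContDiff ℝ 1 γ
  start : γ 0 = a
  finish : γ 1 = b
  inj : InjOn γ (Icc 0 1)
  regular : ∀ u ∈ Icc (0 : ℝ) 1, deriv γ u ≠ 0
  upper : ∀ u ∈ Ioo (0 : ℝ) 1, 0 < (γ u).im

/-- The upper half of the arc `P_∞` of the unit circle, oriented from `e^{iμ}` to `1`. -/
def Pinf (μ : ℝ) (u : ℝ) : ℂ := cexp (I * (μ * (1 - u) : ℝ))

/-- Integral over the upper part of the contour `L`, made of the two arcs `P_∞` (inner) and `ℓ`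
(outer), both oriented from `e^{iμ}` to `1`. -/
def cintL (μ : ℝ) (ℓ : ℝ → ℂ) (f : ℂ → ℂ) : ℂ := cint (Pinf μ) f + cint ℓ f

/-- `2πi` times the winding number about `w` of the closed curve `ℓ` followed by the reverse of
`P_∞`; it is `-2πi` exactly at the points enclosed by `L` in the upper half-plane. -/
def loopL (μ : ℝ) (ℓ : ℝ → ℂ) (w : ℂ) : ℂ :=
  cint ℓ (fun z => 1 / (z - w)) - cint (Pinf μ) (fun z => 1 / (z - w))

/-- The geometry of the contours: `β` is an arc in the upper half-plane ending at `1`; `P_∞` and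
`ℓ` form the contour `L` enclosing `β`, in the domain where `θ₀` is analytic; and `Λ` (the upper
half of `L_β`) is a simple loop based at `1` inside `L`, going once around `β` in the
clockwise sense.  The last four conditions order the tangent directions at `1`. -/
structure IsContourSystem (D : Set ℂ) (μ : ℝ) (ℓ Λ β : ℝ → ℂ) : Prop where
  arc_β : IsArc β (β 0) 1
  start_β : 0 < (β 0).im
  arc_ℓ : IsArc ℓ (cexp (I * μ)) 1
  contDiff_Λ : ContDiff ℝ 1 Λ
  start_Λ : Λ 0 = 1
  finish_Λ : Λ 1 = 1
  inj_Λ : InjOn Λ (Ico 0 1)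
  upper_Λ : ∀ u ∈ Ioo (0 : ℝ) 1, 0 < (Λ u).im
  inter_β_ℓ : trace β ∩ trace ℓ = {1}
  inter_β_P : trace β ∩ trace (Pinf μ) = {1}
  inter_β_Λ : trace β ∩ trace Λ = {1}
  inter_ℓ_P : trace ℓ ∩ trace (Pinf μ) = {cexp (I * μ), 1}
  inter_Λ_ℓ : trace Λ ∩ trace ℓ = {1}
  inter_Λ_P : trace Λ ∩ trace (Pinf μ) = {1}
  encloses_β : ∀ u ∈ Ico (0 : ℝ) 1, loopL μ ℓ (β u) = -(2 * Real.pi * I)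
  encloses_Λ : ∀ u ∈ Ioo (0 : ℝ) 1, loopL μ ℓ (Λ u) = -(2 * Real.pi * I)
  Λ_around_β : ∀ u ∈ Ico (0 : ℝ) 1, cint Λ (fun z => 1 / (z - β u)) = -(2 * Real.pi * I)
  domain : ∀ w : ℂ, 0 < w.im →
    (w ∈ trace ℓ ∨ w ∈ trace (Pinf μ) ∨ loopL μ ℓ w ≠ 0) → specE w ∈ D
  tangent_ℓ : 0 < arg (-deriv ℓ 1)
  tangent_ℓ_Λ : arg (-deriv ℓ 1) < arg (-deriv Λ 1)
  tangent_Λ_β : arg (-deriv Λ 1) < arg (-deriv β 1)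
  tangent_β_Λ : arg (-deriv β 1) < arg (deriv Λ 0)
  tangent_Λ : arg (deriv Λ 0) < Real.pi / 2

/-! ### The `g`-function conditions before the catastrophe -/

/-- The square root `R(w)`, `R(w)² = (w - α)(w - α*)` with `α = β(0)`, analytic off `β ∪ β*` and
`R(w) = w + O(1)` as `w → ∞`.  Since `∫_β dz/(z-w)` is a logarithm of `(1-w)/(α-w)`, this is given
by the following formula. -/
def sqrtR (β : ℝ → ℂ) (w : ℂ) : ℂ :=
  (w - 1) * cexp (-(1 / 2) *
    (cint β (fun z => 1 / (z - w)) + conj (cint β (fun z => 1 / (z - conj w)))))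

/-- `M = (2/π) ∫_L θ₀'(ξ) √(-ξ) / R(ξ) dξ + x + t + (x - t)/√(α α*)`; collapsing both arcs of `L`
onto an arc from `e^{iμ}` to `α` and the two sides of `β` (where `R` has opposite signs), the
integral over `L` is twice the integral over that arc and its reflection. -/
def funM (Ψ : ℂ → ℂ) (μ : ℝ) (ℓ β : ℝ → ℂ) (x t : ℝ) : ℝ :=
  2 / Real.pi *
      (2 * (cintL μ ℓ (fun ξ => deriv (theta0 Ψ) ξ * sqrtNeg ξ / sqrtR β ξ)).re)
    + x + t + (x - t) / ‖β 0‖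

/-- The Cauchy-type integral `∫ θ₀'(ξ) √(-ξ) / (R(ξ) (ξ - w)) dξ` over the upper part of `L`. -/
def cauchyL (Ψ : ℂ → ℂ) (μ : ℝ) (ℓ β : ℝ → ℂ) (w : ℂ) : ℂ :=
  cintL μ ℓ (fun ξ => deriv (theta0 Ψ) ξ * sqrtNeg ξ / (sqrtR β ξ * (ξ - w)))

/-- `H(w) = -1/(4√(-w)) [ (x-t)/(w √(α α*)) - (2/π) ∫_L θ₀'(ξ)√(-ξ)/(R(ξ)(ξ-w)) dξ ]`; the second
Cauchy integral is the contribution of the reflected part of `L`. -/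
def funH (Ψ : ℂ → ℂ) (μ : ℝ) (ℓ β : ℝ → ℂ) (x t : ℝ) (w : ℂ) : ℂ :=
  -(1 / (4 * sqrtNeg w)) *
    (((x - t : ℝ) : ℂ) / (w * (‖β 0‖ : ℂ))
      - 2 / Real.pi * (cauchyL Ψ μ ℓ β w + conj (cauchyL Ψ μ ℓ β (conj w))))

/-- `I = (1/2) ∫_β R₊ H dξ + (1/2) ∫_{β*} R₋ H dξ = (1/4) ∫_{L_β} R(w) H(w) dw`, where `L_β` is
`Λ` together with its reflection. -/
def funI (Ψ : ℂ → ℂ) (μ : ℝ) (ℓ Λ β : ℝ → ℂ) (x t : ℝ) : ℝ :=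
  1 / 4 * (2 * (cint Λ (fun w => sqrtR β w * funH Ψ μ ℓ β x t w)).re)

/-- The domain, in the upper half-plane, of the exponent function `φ`. -/
def phaseDomain (D : Set ℂ) (μ : ℝ) (β : ℝ → ℂ) : Set ℂ :=
  {w | 0 < w.im ∧ specE w ∈ D} \ (trace (Pinf μ) ∪ trace β)

/-- `φ` is the exponent function (up to an additive constant): it is analytic off the cuts `P_∞`
and `β`, and `φ' = R H` inside `L`.  When `w` leaves the region enclosed by `L`, the residue of
the integrand of `H` at `ξ = w` (and, across `P_∞`, also the jump of `φ'`) contributes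
`-i θ₀'(w)`. -/
structure IsPhase (Ψ : ℂ → ℂ) (D : Set ℂ) (μ : ℝ) (ℓ β : ℝ → ℂ) (x t : ℝ)
    (φ : ℂ → ℂ) : Prop where
  differentiableOn : DifferentiableOn ℂ φ (phaseDomain D μ β)
  deriv_inside : ∀ w ∈ phaseDomain D μ β, w ∉ trace ℓ → loopL μ ℓ w ≠ 0 →
    deriv φ w = sqrtR β w * funH Ψ μ ℓ β x t w
  deriv_outside : ∀ w ∈ phaseDomain D μ β, w ∉ trace ℓ → loopL μ ℓ w = 0 →
    deriv φ w = sqrtR β w * funH Ψ μ ℓ β x t w - I * deriv (theta0 Ψ) w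

/-- Existence of the arc `γ`: for all small `δ > 0` there is an arc from `1 - δ` to `α` on which
`Re φ < 0`, such that `γ` and `β` (closed by the segment from `1` to `1 - δ`) form a clockwise loop
enclosing the upper half of `P_∞`. -/
def HasChannel (D : Set ℂ) (μ : ℝ) (β : ℝ → ℂ) (φ : ℂ → ℂ) : Prop :=
  ∃ δ₀ > (0 : ℝ), ∀ δ ∈ Ioo 0 δ₀, ∃ γ : ℝ → ℂ, IsArc γ ((1 - δ : ℝ) : ℂ) (β 0) ∧
    (∀ u ∈ Ioo (0 : ℝ) 1, γ u ∈ phaseDomain D μ β ∧ (φ (γ u)).re < 0) ∧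
    ∀ η ∈ Ioc 0 μ,
      cint γ (fun z => 1 / (z - cexp (I * η))) + cint β (fun z => 1 / (z - cexp (I * η)))
        + cint (fun u => ((1 - δ * u : ℝ) : ℂ)) (fun z => 1 / (z - cexp (I * η)))
        = -(2 * Real.pi * I)

/-- The conditions common to points of the modulated librational wave region and to points of
gradient catastrophe: `M = I = 0`; the boundary values of `Re φ` vanish along `β`; the tangent of
`β` at `1` makes an angle in `(0, π/2)` with the ray `w > 1`; and the arc `γ` exists. -/
structure IsModulated (Ψ : ℂ → ℂ) (D : Set ℂ) (μ : ℝ) (ℓ Λ β : ℝ → ℂ) (x t : ℝ) : Prop where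
  contours : IsContourSystem D μ ℓ Λ β
  M_eq : funM Ψ μ ℓ β x t = 0
  I_eq : funI Ψ μ ℓ Λ β x t = 0
  tangent : arg (-deriv β 1) ∈ Ioo 0 (Real.pi / 2)
  phase : ∃ φ : ℂ → ℂ, IsPhase Ψ D μ ℓ β x t φ ∧
    (∀ u ∈ Ico (0 : ℝ) 1,
      Tendsto (fun w => (φ w).re) (𝓝[phaseDomain D μ β] (β u)) (𝓝 0)) ∧
    HasChannel D μ β φ

/-- The modulated librational wave region. -/
def modulatedRegion (Ψ : ℂ → ℂ) (D : Set ℂ) (μ : ℝ) : Set (ℝ × ℝ) :=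
  {p | ∃ ℓ Λ β : ℝ → ℂ, IsModulated Ψ D μ ℓ Λ β p.1 p.2 ∧
    ∃ c > (0 : ℝ), ∀ u ∈ Ico (0 : ℝ) 1, c ≤ ‖funH Ψ μ ℓ β p.1 p.2 (β u)‖}

/-- `(x, t)` is a point of simple gradient catastrophe, with arc `β` (and auxiliary contours
`ℓ`, `Λ`). -/
structure IsSimpleCatastrophe (Ψ : ℂ → ℂ) (D : Set ℂ) (μ : ℝ) (ℓ Λ β : ℝ → ℂ)
    (x t : ℝ) : Prop where
  boundary : (x, t) ∈ frontier (modulatedRegion Ψ D μ)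
  modulated : IsModulated Ψ D μ ℓ Λ β x t
  H_eq : funH Ψ μ ℓ β x t (β 0) = 0
  H_deriv : deriv (funH Ψ μ ℓ β x t) (β 0) ≠ 0
  H_bound : ∃ c > (0 : ℝ), ∀ u ∈ Ioo (0 : ℝ) 1,
    c ≤ ‖funH Ψ μ ℓ β x t (β u) / (β u - β 0)‖

/-! ### The modified `g`-function near the catastrophe -/

/-- `A = ∫_β √(-ξ)/R₊ dξ + ∫_{β*} √(-ξ)/R₋ dξ`, written as half of the integral over the loop `Λ`
around `β` and its reflection. -/
def coefA (Λ β : ℝ → ℂ) : ℝ :=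
  1 / 2 * (2 * (cint Λ (fun w => sqrtNeg w / sqrtR β w)).re)

/-- `B = ∫_β dξ/(R₊ √(-ξ)) + ∫_{β*} dξ/(R₋ √(-ξ))`, likewise. -/
def coefB (Λ β : ℝ → ℂ) : ℝ :=
  1 / 2 * (2 * (cint Λ (fun w => 1 / (sqrtR β w * sqrtNeg w))).re)

/-- The solution `(n, n*)` of the linear system `8n + 8n* = -M`,
`(A + α* B) n + (A + α B) n* = -I`, which makes the ansatz
`g' = (R/√(-w)) (n/(w-α) + n*/(w-α*)) + g₀'` satisfy the conditions imposed on `g`. -/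
def residues (Ψ : ℂ → ℂ) (μ : ℝ) (ℓ Λ β : ℝ → ℂ) (x t : ℝ) : Fin 2 → ℂ :=
  (!![8, 8; (coefA Λ β : ℂ) + conj (β 0) * coefB Λ β, (coefA Λ β : ℂ) + β 0 * coefB Λ β] :
      Matrix (Fin 2) (Fin 2) ℂ)⁻¹.mulVec
    ![-(funM Ψ μ ℓ β x t : ℂ), -(funI Ψ μ ℓ Λ β x t : ℂ)]

/-- `(w - α) H(w)` for the modified function
`H(w) = -(2/√(-w)) (n/(w-α) + n*/(w-α*)) + H₀(w)`, with the pole at `α` cancelled. -/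
def regularH (Ψ : ℂ → ℂ) (μ : ℝ) (ℓ Λ β : ℝ → ℂ) (x t : ℝ) (w : ℂ) : ℂ :=
  -(2 / sqrtNeg w) * (residues Ψ μ ℓ Λ β x t 0
      + residues Ψ μ ℓ Λ β x t 1 * (w - β 0) / (w - conj (β 0)))
    + (w - β 0) * funH Ψ μ ℓ β x t w

/-- The odd function `f(q) = (1/2) φ̃(w)`, `w = α + q²`, where `φ̃(α) = 0`, `φ̃' = R̃ H` and
`R̃(w) = -(w-α)^{1/2} (w-α*)^{1/2}`.  With `q = (w-α)^{1/2}` and `dw = 2q dq` one gets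
`f(q) = -∫₀^q (w-α*)^{1/2} (w-α) H(w) dq`, here along the segment from `0` to `q`. -/
def halfPhase (Ψ : ℂ → ℂ) (μ : ℝ) (ℓ Λ β : ℝ → ℂ) (x t : ℝ) (q : ℂ) : ℂ :=
  -∫ v in (0 : ℝ)..1,
    (β 0 + (v * q) ^ 2 - conj (β 0)) ^ (1 / 2 : ℂ)
      * regularH Ψ μ ℓ Λ β x t (β 0 + (v * q) ^ 2) * q

/-- The functions `α(x,t) = β(x,t)(0)`, `s(x,t)` and the conformal map `W(·; x, t)`, for `(x,t)` in
a neighbourhood `N` of `(0, t_gc)`: with `q² = w - α` and `W = Q²`, where `Q` is odd and univalent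
for `|q| < r`, the identity `(1/2) φ̃ = (4/5) W^{5/2} + s W^{1/2}` reads `f(q) = (4/5) Q⁵ + s Q`;
moreover `α = e^{iθ}` and `s = 0` at `(0, t_gc)`, and the branch of `Q = W^{1/2}` (one of the five
solutions at the catastrophe) is the one with `arg Q'(0) = π/4 - θ/2`, so that
`arg W'(α) = π/2 - θ` there. -/
structure IsConformalMap (Ψ : ℂ → ℂ) (D : Set ℂ) (μ : ℝ) (ℓ Λ : ℝ → ℂ) (θ tgc : ℝ)
    (N : Set (ℝ × ℝ)) (r : ℝ) (β : ℝ → ℝ → ℝ → ℂ) (s : ℝ → ℝ → ℂ)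
    (Q W : ℝ → ℝ → ℂ → ℂ) : Prop where
  nhds : N ∈ 𝓝 ((0 : ℝ), tgc)
  r_pos : 0 < r
  contours : ∀ p ∈ N, IsContourSystem D μ ℓ Λ (β p.1 p.2)
  β_cont : ContinuousOn (fun y : (ℝ × ℝ) × ℝ => deriv (β y.1.1 y.1.2) y.2) (N ×ˢ Icc 0 1)
  α_analytic : AnalyticAt ℝ (fun p : ℝ × ℝ => β p.1 p.2 0) (0, tgc)
  s_analytic : AnalyticAt ℝ (fun p : ℝ × ℝ => s p.1 p.2) (0, tgc)
  α_gc : β 0 tgc 0 = cexp (I * θ)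
  s_gc : s 0 tgc = 0
  mem_inside : ∀ p ∈ N, ∀ q ∈ Metric.ball (0 : ℂ) r, 0 < (β p.1 p.2 0 + q ^ 2).im ∧
    β p.1 p.2 0 + q ^ 2 ∉ trace ℓ ∪ trace (Pinf μ) ∧
    loopL μ ℓ (β p.1 p.2 0 + q ^ 2) = -(2 * Real.pi * I)
  Q_cont : ContinuousOn (fun y : (ℝ × ℝ) × ℂ => Q y.1.1 y.1.2 y.2) (N ×ˢ Metric.ball 0 r)
  Q_analytic : ∀ p ∈ N, AnalyticOnNhd ℂ (Q p.1 p.2) (Metric.ball 0 r)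
  Q_odd : ∀ p ∈ N, ∀ q ∈ Metric.ball (0 : ℂ) r, Q p.1 p.2 (-q) = -Q p.1 p.2 q
  Q_inj : ∀ p ∈ N, InjOn (Q p.1 p.2) (Metric.ball 0 r)
  W_eq : ∀ p ∈ N, ∀ q ∈ Metric.ball (0 : ℂ) r, W p.1 p.2 (β p.1 p.2 0 + q ^ 2) = Q p.1 p.2 q ^ 2
  identity : ∀ p ∈ N, ∀ q ∈ Metric.ball (0 : ℂ) r,
    halfPhase Ψ μ ℓ Λ (β p.1 p.2) p.1 p.2 q
      = 4 / 5 * Q p.1 p.2 q ^ 5 + s p.1 p.2 * Q p.1 p.2 q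
  branch : deriv (Q 0 tgc) 0
    = ‖deriv (Q 0 tgc) 0‖ * cexp (I * (Real.pi / 4 - θ / 2 : ℝ))

end SineGordon

end

noncomputable section
namespace SineGordon

/-! ### Logarithmic contour integrals and the square root `R` -/

/-! Comparing linear terms at `q = 0` in `f(q) = (4/5) Q⁵ + s Q` gives `s Q'(0) = f'(0) = 2n
(α-α*)^{1/2} / √(-α)` (`s_mul_deriv`): only the residue `n` of `H` at `α` reaches the linear term.
At the catastrophe `M = I = 0`, hence `n = 0`. So the derivative of `s` is the derivative of `n`
times the value of the remaining factor, and that factor need only be continuous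
(`hasDerivAt_mul_of_eq_zero`). By Cramer's rule `n = (-M (A + αB) + 8I) / (8B(α-α*))`, and the same
remark leaves only the derivatives of `M` and `I`.

The function `R` depends on the moving arc, locally, only through `α`, because `R² = (w-α)(w-α*)`.
Differentiating this identity and splitting by partial fractions shows that the motion of `α` enters
the derivatives of `M` and of `R H₀` only through `α' · (-4√(-α) H₀(α))` and its conjugate
(`hasDerivAt_funM`, `hasDerivAt_RH`). Since `H₀(α) = 0` at the catastrophe, only the explicit
dependence on `x, t` survives. With `|α| = 1` this gives `M' = 2x'` and `I' = -((x'-t')/8) Re ∫_Λ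
R/(w√(-w)) dw`.

The loop integrals that remain are evaluated on the double cover branched at `α`, uniformized by a
disc: the odd primitive on the disc turns the loop into twice an integral along the arc of the unit
circle from `1` to `α` (`loop_integral_eq`, `cint_loop`). With `w = z²` and `Im z = ks`, `k =
sin(θ/2)`, these become complete elliptic integrals. With `K` and `S = ∫ s²/√((1-s²)(1-k²s²)) ds`
one gets `B = 2K`, `A = -2K + 4k²S`, and `8k²(K-S)` for the integral in `I'`. Therefore `n' = -(x' +
i t' ρ)/8` with `ρ = k(K-S)/(k'K)`, positive because `S < K`.

Finally the branch of `Q` makes the phases of `(α-α*)^{1/2}`, `√(-α)` and `Q'(0)` combine to `i`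
(`phase_quotient`), and `W' = Q'²` at `α` converts the modulus. -/

lemma exp_cint_inv_sub {γ : ℝ → ℂ} (hγ : ContDiff ℝ 1 γ) {w : ℂ} (hw : w ∉ trace γ) :
    cexp (cint γ (fun z => 1 / (z - w))) = (γ 1 - w) / (γ 0 - w) := by
  have hne : ∀ u ∈ Icc (0 : ℝ) 1, γ u - w ≠ 0 := fun u hu h =>
    hw ⟨u, hu, sub_eq_zero.1 h⟩
  have hdc : Continuous (deriv γ) := hγ.continuous_deriv le_rfl
  set g : ℝ → ℂ := fun u => 1 / (γ u - w) * deriv γ u with hg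
  have hgc : ContinuousOn g (Icc 0 1) :=
    (continuousOn_const.div (hγ.continuous.continuousOn.sub continuousOn_const) hne).mul
      hdc.continuousOn
  -- The integrand may be singular off `[0,1]`. Extending it by its end values makes it continuous
  -- on the line, so its primitive is differentiable at both end points too.
  set e : ℝ → ℂ := IccExtend zero_le_one ((Icc (0 : ℝ) 1).domRestrict g) with he
  have hec : Continuous e := (continuousOn_iff_continuous_domRestrict.1 hgc).Icc_extend'
  have heg : ∀ u ∈ Icc (0 : ℝ) 1, e u = g u := fun u hu => by
    rw [he, IccExtend_of_mem _ _ hu]; rfl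
  set φ : ℝ → ℂ := fun u => ∫ x in (0 : ℝ)..u, e x with hφ
  have hφd : ∀ u, HasDerivAt φ (e u) u := fun u => hec.integral_hasStrictDerivAt 0 u |>.hasDerivAt
  have hγd : ∀ u, HasDerivAt γ (deriv γ u) u := fun u =>
    (hγ.differentiable one_ne_zero u).hasDerivAt
  -- No branch of the logarithm needs to be chosen: `(γ - w) e^{-φ}` has derivative zero along the
  -- curve, hence equal values at the ends.
  set F : ℝ → ℂ := fun u => (γ u - w) * cexp (-φ u) with hF
  have hFd : ∀ u ∈ Icc (0 : ℝ) 1, HasDerivAt F 0 u := by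
    intro u hu
    have := ((hγd u).sub_const w).mul ((hφd u).neg.cexp)
    refine this.congr_deriv ?_
    have hn := hne u hu
    rw [heg u hu]
    simp only [hg, Pi.neg_apply]
    field_simp
    ring
  have hconst := constant_of_has_deriv_right_zero (f := F) (a := 0) (b := 1)
    (fun u hu => (hFd u hu).continuousAt.continuousWithinAt)
    (fun u hu => (hFd u (Ico_subset_Icc_self hu)).hasDerivWithinAt) 1 (by simp)
  have hφ1 : φ 1 = cint γ (fun z => 1 / (z - w)) := by
    simp only [hφ, cint]
    apply intervalIntegral.integral_congr
    intro u hu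
    rw [uIcc_of_le zero_le_one] at hu
    exact heg u hu
  have hφ0 : φ 0 = 0 := by simp [hφ]
  simp only [hF, hφ0, hφ1, Complex.exp_zero, Complex.exp_neg, inv_one, mul_one] at hconst
  have h0 := hne 0 (by simp)
  rw [eq_div_iff h0, ← hconst]
  field_simp [Complex.exp_ne_zero]

lemma notMem_trace_of_im_neg {γ : ℝ → ℂ} {a : ℂ} (hγ : IsArc γ a 1) (ha : 0 < a.im) {w : ℂ}
    (hw : w.im < 0) : w ∉ trace γ := by
  rintro ⟨u, hu, rfl⟩
  rcases eq_or_lt_of_le hu.1 with h | h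
  · subst h; rw [hγ.start] at hw; exact lt_asymm hw ha
  rcases eq_or_lt_of_le hu.2 with h' | h'
  · subst h'; simp [hγ.finish] at hw
  · exact lt_asymm hw (hγ.upper u ⟨h, h'⟩)

lemma notMem_trace_of_im_zero {γ : ℝ → ℂ} {a : ℂ} (hγ : IsArc γ a 1) (ha : 0 < a.im) {w : ℂ}
    (hw : w.im = 0) (hw1 : w ≠ 1) : w ∉ trace γ := by
  rintro ⟨u, hu, rfl⟩
  rcases eq_or_lt_of_le hu.1 with h | h
  · subst h; rw [hγ.start] at hw; exact ha.ne' hw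
  rcases eq_or_lt_of_le hu.2 with h' | h'
  · subst h'; exact hw1 hγ.finish
  · exact (hγ.upper u ⟨h, h'⟩).ne' hw

/-- The two logarithmic integrals exponentiate to `(1-w)/(α-w)` and `(1-w)/(α*-w)`. Squaring turns
the factor `-1/2` into an inversion, and `(1-w)²` cancels against `(w-1)²`. -/
lemma sqrtR_sq {β : ℝ → ℂ} (hβ : IsArc β (β 0) 1) {w : ℂ} (hw1 : w ≠ 1)
    (hw : w ∉ trace β) (hw' : conj w ∉ trace β) :
    sqrtR β w ^ 2 = (w - β 0) * (w - conj (β 0)) := by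
  have h1 := exp_cint_inv_sub hβ.contDiff hw
  have h2 := exp_cint_inv_sub hβ.contDiff hw'
  have hα : β 0 - w ≠ 0 := fun h => hw ⟨0, by simp, sub_eq_zero.1 h⟩
  have hα' : β 0 - conj w ≠ 0 := fun h => hw' ⟨0, by simp, sub_eq_zero.1 h⟩
  have hα'' : conj (β 0) - w ≠ 0 := fun h => hα' (by
    have := congrArg conj h
    simpa using this)
  have h3 : cexp (conj (cint β (fun z => 1 / (z - conj w)))) = (1 - w) / (conj (β 0) - w) := by
    rw [Complex.exp_conj, h2, hβ.finish]
    simp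
  rw [hβ.finish] at h1
  have hw1' : 1 - w ≠ 0 := sub_ne_zero.2 hw1.symm
  rw [sqrtR, mul_pow, ← Complex.exp_nat_mul]
  have : ((2 : ℕ) : ℂ) * (-(1 / 2) *
      (cint β (fun z => 1 / (z - w)) + conj (cint β (fun z => 1 / (z - conj w)))))
      = -(cint β (fun z => 1 / (z - w)) + conj (cint β (fun z => 1 / (z - conj w)))) := by
    push_cast; ring
  rw [this, Complex.exp_neg, Complex.exp_add, h1, h3]
  field_simp
  ring

/-- A one-parameter family of arcs from a point of the upper half-plane to `1`, continuous
together with its tangents. -/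
structure IsArcFamily (b : ℝ → ℝ → ℂ) (U : Set ℝ) : Prop where
  isOpen : IsOpen U
  arc : ∀ h ∈ U, IsArc (b h) (b h 0) 1
  start : ∀ h ∈ U, 0 < (b h 0).im
  cont : ContinuousOn (fun y : ℝ × ℝ => deriv (b y.1) y.2) (U ×ˢ Icc 0 1)

lemma IsArcFamily.const {β : ℝ → ℂ} (hβ : IsArc β (β 0) 1) (hs : 0 < (β 0).im) :
    IsArcFamily (fun _ => β) univ where
  isOpen := isOpen_univ
  arc _ _ := hβ
  start _ _ := hs
  cont := ((hβ.contDiff.continuous_deriv le_rfl).comp continuous_snd).continuousOn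

lemma IsArcFamily.deriv_close {b : ℝ → ℝ → ℂ} {U : Set ℝ} (hb : IsArcFamily b U) {h₀ : ℝ}
    (h₀U : h₀ ∈ U) {ε : ℝ} (hε : 0 < ε) :
    ∀ᶠ h in 𝓝 h₀, ∀ u ∈ Icc (0 : ℝ) 1, ‖deriv (b h) u - deriv (b h₀) u‖ < ε := by
  obtain ⟨v, hv, hvp⟩ := (isCompact_Icc (a := (0 : ℝ)) (b := 1)).mem_uniformity_of_prod
    (f := fun h u => deriv (b h) u) hb.cont h₀U (Metric.dist_mem_uniformity hε)
  rw [hb.isOpen.nhdsWithin_eq h₀U] at hv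
  filter_upwards [hv] with h hh u hu
  rw [← dist_eq_norm]
  exact hvp h hh u hu

/-- All arcs end at `1`, so closeness of the tangents integrates back from that end to uniform
closeness of the arcs. -/
lemma IsArcFamily.close {b : ℝ → ℝ → ℂ} {U : Set ℝ} (hb : IsArcFamily b U) {h₀ : ℝ}
    (h₀U : h₀ ∈ U) {ε : ℝ} (hε : 0 < ε) :
    ∀ᶠ h in 𝓝 h₀, ∀ u ∈ Icc (0 : ℝ) 1, ‖b h u - b h₀ u‖ ≤ ε := by
  filter_upwards [hb.deriv_close h₀U hε, hb.isOpen.mem_nhds h₀U] with h hd hU u hu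
  have hdiff : ∀ x ∈ Icc (0 : ℝ) 1, HasDerivWithinAt (fun u => b h u - b h₀ u)
      (deriv (b h) x - deriv (b h₀) x) (Icc 0 1) x := fun x _ =>
    ((((hb.arc h hU).contDiff.differentiable one_ne_zero x).hasDerivAt).sub
      (((hb.arc h₀ h₀U).contDiff.differentiable one_ne_zero x).hasDerivAt)).hasDerivWithinAt
  have := (convex_Icc (0 : ℝ) 1).norm_image_sub_le_of_norm_hasDerivWithin_le hdiff
    (fun x hx => (hd x hx).le) (show (1 : ℝ) ∈ Icc (0 : ℝ) 1 by simp) hu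
  simp only [(hb.arc h hU).finish, (hb.arc h₀ h₀U).finish, sub_self, sub_zero] at this
  refine this.trans ?_
  have h1 : ‖u - 1‖ ≤ 1 := by
    rw [Real.norm_eq_abs, abs_le]; constructor <;> linarith [hu.1, hu.2]
  nlinarith

lemma isCompact_trace {γ : ℝ → ℂ} (hγ : Continuous γ) : IsCompact (trace γ) :=
  isCompact_Icc.image hγ

/-- Joint continuity in the parameter and in `w` is what makes `R` vary without a jump of sign; its
differentiability then follows from the formula for `R²`. -/
lemma IsArcFamily.continuousAt_cint {b : ℝ → ℝ → ℂ} {U : Set ℝ} (hb : IsArcFamily b U) {h₀ : ℝ}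
    (h₀U : h₀ ∈ U) {w₀ : ℂ} (hw₀ : w₀ ∉ trace (b h₀)) :
    ContinuousAt (fun y : ℝ × ℂ => cint (b y.1) (fun z => 1 / (z - y.2))) (h₀, w₀) := by
  have hc₀ : Continuous (b h₀) := (hb.arc h₀ h₀U).contDiff.continuous
  have hdc₀ : Continuous (deriv (b h₀)) := (hb.arc h₀ h₀U).contDiff.continuous_deriv le_rfl
  obtain ⟨d, hd, hdist⟩ : ∃ d > 0, ∀ u ∈ Icc (0 : ℝ) 1, d ≤ ‖b h₀ u - w₀‖ := by
    have hpos := ((isCompact_trace hc₀).isClosed.notMem_iff_infDist_pos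
      ⟨b h₀ 0, 0, by simp, rfl⟩).1 hw₀
    refine ⟨_, hpos, fun u hu => ?_⟩
    rw [← dist_eq_norm, dist_comm]
    exact Metric.infDist_le_dist_of_mem ⟨u, hu, rfl⟩
  obtain ⟨C, hC⟩ := (isCompact_Icc (a := (0 : ℝ)) (b := 1)).exists_bound_of_continuousOn
    hdc₀.continuousOn
  have ev1 : ∀ᶠ y : ℝ × ℂ in 𝓝 (h₀, w₀), ∀ u ∈ Icc (0 : ℝ) 1,
      ‖deriv (b y.1) u - deriv (b h₀) u‖ < 1 :=
    (continuous_fst.continuousAt (x := (h₀, w₀))).eventually (hb.deriv_close h₀U one_pos)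
  have ev2 : ∀ᶠ y : ℝ × ℂ in 𝓝 (h₀, w₀), ∀ u ∈ Icc (0 : ℝ) 1, ‖b y.1 u - b h₀ u‖ ≤ d / 4 :=
    (continuous_fst.continuousAt (x := (h₀, w₀))).eventually (hb.close h₀U (by positivity))
  have ev3 : ∀ᶠ y : ℝ × ℂ in 𝓝 (h₀, w₀), ‖y.2 - w₀‖ < d / 4 := by
    have := (continuous_snd.continuousAt (x := (h₀, w₀))).eventually
      (Metric.ball_mem_nhds w₀ (show 0 < d / 4 by positivity))
    filter_upwards [this] with y hy
    rwa [← dist_eq_norm]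
  have ev4 : ∀ᶠ y : ℝ × ℂ in 𝓝 (h₀, w₀), y.1 ∈ U :=
    (continuous_fst.continuousAt (x := (h₀, w₀))).eventually (hb.isOpen.mem_nhds h₀U)
  have ev5 : ∀ᶠ y : ℝ × ℂ in 𝓝 (h₀, w₀), ∀ u ∈ Icc (0 : ℝ) 1, d / 2 ≤ ‖b y.1 u - y.2‖ := by
    filter_upwards [ev2, ev3] with y h2 h3 u hu
    have := hdist u hu
    have e : b h₀ u - w₀ = (b y.1 u - y.2) - (b y.1 u - b h₀ u) + (y.2 - w₀) := by ring
    rw [e] at this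
    have := norm_add_le ((b y.1 u - y.2) - (b y.1 u - b h₀ u)) (y.2 - w₀)
    have := norm_sub_le (b y.1 u - y.2) (b y.1 u - b h₀ u)
    have := h2 u hu
    linarith
  have hsub : uIoc (0 : ℝ) 1 ⊆ Icc 0 1 := by
    rw [uIoc_of_le zero_le_one]; exact Ioc_subset_Icc_self
  refine intervalIntegral.tendsto_integral_filter_of_dominated_convergence
    -- Nearby arcs stay at distance at least `d/2` from nearby points, and their tangents have norm
    -- at most `C + 1`.
    (fun _ => 2 / d * (C + 1)) ?_ ?_ intervalIntegrable_const ?_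
  · filter_upwards [ev4, ev5] with y hU h5
    have hy := (hb.arc _ hU).contDiff
    refine (ContinuousOn.aestronglyMeasurable (s := Icc 0 1) ?_ measurableSet_Icc).mono_measure
      (Measure.restrict_mono hsub le_rfl)
    refine (continuousOn_const.div (hy.continuous.continuousOn.sub continuousOn_const) ?_).mul
      (hy.continuous_deriv le_rfl).continuousOn
    intro u hu h
    have := h5 u hu
    rw [show b y.1 u - y.2 = 0 from h, norm_zero] at this
    linarith
  · filter_upwards [ev1, ev5] with y h1 h5
    refine Eventually.of_forall fun u hu => ?_
    have hu' := hsub hu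
    have h5 := h5 u hu'
    have h1 := h1 u hu'
    rw [norm_mul, norm_div, norm_one]
    refine mul_le_mul ?_ ?_ (norm_nonneg _) (by positivity)
    · rw [div_le_div_iff₀ (by linarith) hd]; linarith
    · have := norm_add_le (deriv (b y.1) u - deriv (b h₀) u) (deriv (b h₀) u)
      rw [sub_add_cancel] at this
      linarith [hC u hu']
  · refine Eventually.of_forall fun u hu => ?_
    have hu' := hsub hu
    have t1 : Tendsto (fun y : ℝ × ℂ => b y.1 u) (𝓝 (h₀, w₀)) (𝓝 (b h₀ u)) := by
      rw [Metric.tendsto_nhds]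
      intro ε hε
      filter_upwards [(continuous_fst.continuousAt (x := (h₀, w₀))).eventually
        (hb.close h₀U (half_pos hε))] with y hy
      rw [dist_eq_norm]
      linarith [hy u hu']
    have t2 : Tendsto (fun y : ℝ × ℂ => deriv (b y.1) u) (𝓝 (h₀, w₀)) (𝓝 (deriv (b h₀) u)) := by
      rw [Metric.tendsto_nhds]
      intro ε hε
      filter_upwards [(continuous_fst.continuousAt (x := (h₀, w₀))).eventually
        (hb.deriv_close h₀U hε)] with y hy
      rw [dist_eq_norm]
      exact hy u hu'
    have t3 : Tendsto (fun y : ℝ × ℂ => y.2) (𝓝 (h₀, w₀)) (𝓝 w₀) := continuous_snd.continuousAt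
    refine (tendsto_const_nhds.div (t1.sub t3) ?_).mul t2
    intro h
    have := hdist u hu'
    rw [h, norm_zero] at this
    linarith

lemma IsArcFamily.continuousAt_sqrtR {b : ℝ → ℝ → ℂ} {U : Set ℝ} (hb : IsArcFamily b U) {h₀ : ℝ}
    (h₀U : h₀ ∈ U) {w₀ : ℂ} (hw₀ : w₀ ∉ trace (b h₀)) (hw₀' : conj w₀ ∉ trace (b h₀)) :
    ContinuousAt (fun y : ℝ × ℂ => sqrtR (b y.1) y.2) (h₀, w₀) := by
  have h1 := hb.continuousAt_cint h₀U hw₀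
  have h2 : ContinuousAt (fun y : ℝ × ℂ => cint (b y.1) (fun z => 1 / (z - conj y.2))) (h₀, w₀) :=
    ContinuousAt.comp (f := fun y : ℝ × ℂ => (y.1, conj y.2)) (x := (h₀, w₀))
      (hb.continuousAt_cint h₀U hw₀')
      (continuous_fst.prodMk (Complex.continuous_conj.comp continuous_snd)).continuousAt
  have h3 : ContinuousAt (fun y : ℝ × ℂ => conj (cint (b y.1) (fun z => 1 / (z - conj y.2))))
      (h₀, w₀) := Complex.continuous_conj.continuousAt.comp h2
  unfold sqrtR
  exact ((continuous_snd.continuousAt).sub continuousAt_const).mul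
    ((continuousAt_const.mul (h1.add h3)).cexp)

lemma continuousAt_sqrtR {β : ℝ → ℂ} (hβ : IsArc β (β 0) 1) (hs : 0 < (β 0).im) {w₀ : ℂ}
    (hw₀ : w₀ ∉ trace β) (hw₀' : conj w₀ ∉ trace β) : ContinuousAt (sqrtR β) w₀ :=
  ContinuousAt.comp (f := fun w : ℂ => ((0 : ℝ), w)) (x := w₀)
    ((IsArcFamily.const hβ hs).continuousAt_sqrtR (mem_univ 0) hw₀ hw₀')
    (continuous_const.prodMk continuous_id).continuousAt

lemma conj_notMem_trace {β : ℝ → ℂ} (hβ : IsArc β (β 0) 1) (hs : 0 < (β 0).im) {w : ℂ}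
    (hw : 0 < w.im) : conj w ∉ trace β :=
  notMem_trace_of_im_neg hβ hs (by simpa using hw)

/-- A continuous square root of a differentiable function is differentiable off the zeros. -/
lemma hasDerivAt_of_sq {f p : ℝ → ℂ} {p' : ℂ} {h : ℝ} (hf : ContinuousAt f h) (hne : f h ≠ 0)
    (hsq : ∀ᶠ y in 𝓝 h, f y ^ 2 = p y) (hp : HasDerivAt p p' h) :
    HasDerivAt f (p' / (2 * f h)) h := by
  rw [hasDerivAt_iff_tendsto_slope] at hp ⊢
  have hsum : Tendsto (fun y => f y + f h) (𝓝[≠] h) (𝓝 (2 * f h)) := by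
    have : Tendsto (fun y => f y + f h) (𝓝 h) (𝓝 (f h + f h)) := hf.tendsto.add_const _
    rw [← two_mul] at this
    exact this.mono_left nhdsWithin_le_nhds
  have h2 : (2 * f h) ≠ 0 := by simpa using hne
  refine (hp.div hsum h2).congr' ?_
  filter_upwards [nhdsWithin_le_nhds hsq, hsum.eventually_ne h2] with y hy hy2
  have h0 := hsq.self_of_nhds
  simp only [Pi.div_apply, slope_def_module, ← hy, ← h0, Complex.real_smul]
  field_simp
  ring

end SineGordon
end

noncomputable section
namespace SineGordon

/-! ### Integrals over the open unit interval -/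

lemma ae_mem_Ioo : ∀ᵐ t : ℝ, t ∈ uIoc (0 : ℝ) 1 → t ∈ Ioo (0 : ℝ) 1 := by
  filter_upwards [(countable_singleton (1 : ℝ)).ae_notMem volume] with t ht h
  rw [uIoc_of_le zero_le_one] at h
  exact ⟨h.1, lt_of_le_of_ne h.2 ht⟩

lemma aestronglyMeasurable_of_continuousOn_Ioo {f : ℝ → ℂ} (hf : ContinuousOn f (Ioo 0 1)) :
    AEStronglyMeasurable f (volume.restrict (uIoc (0 : ℝ) 1)) := by
  rw [uIoc_of_le zero_le_one, Measure.restrict_congr_set Ioo_ae_eq_Ioc.symm]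
  exact hf.aestronglyMeasurable measurableSet_Ioo

lemma intervalIntegrable_of_bounded {f : ℝ → ℂ} {C : ℝ}
    (hf : AEStronglyMeasurable f (volume.restrict (uIoc (0 : ℝ) 1)))
    (hC : ∀ u ∈ Ioo (0 : ℝ) 1, ‖f u‖ ≤ C) : IntervalIntegrable f volume 0 1 := by
  rw [intervalIntegrable_iff]
  have : IsFiniteMeasure (volume.restrict (uIoc (0 : ℝ) 1)) := ⟨by simp⟩
  refine Integrable.of_bound hf C ?_
  rw [ae_restrict_iff' measurableSet_uIoc]
  filter_upwards [ae_mem_Ioo] with u hu h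
  exact hC u (hu h)

lemma norm_integral_le_of_Ioo {f : ℝ → ℂ} {C : ℝ}
    (hC : ∀ u ∈ Ioo (0 : ℝ) 1, ‖f u‖ ≤ C) : ‖∫ u in (0 : ℝ)..1, f u‖ ≤ C := by
  have := intervalIntegral.norm_integral_le_of_norm_le_const_ae (a := 0) (b := 1) (C := C) (f := f)
    (by filter_upwards [ae_mem_Ioo] with u hu h using hC u (hu h))
  simpa using this

lemma integral_congr_Ioo {f g : ℝ → ℂ} (h : ∀ u ∈ Ioo (0 : ℝ) 1, f u = g u) :
    ∫ u in (0 : ℝ)..1, f u = ∫ u in (0 : ℝ)..1, g u := by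
  apply intervalIntegral.integral_congr_ae
  filter_upwards [ae_mem_Ioo] with u hu h' using h u (hu h')

/-! ### Differentiation of `R` with respect to a parameter -/

/-- A curve in the upper half-plane (except for its ends) disjoint from the arcs of a family. -/
structure IsAvoiding (b : ℝ → ℝ → ℂ) (U : Set ℝ) (γ : ℝ → ℂ) : Prop where
  cont : Continuous γ
  upper : ∀ u ∈ Ioo (0 : ℝ) 1, 0 < (γ u).im
  off : ∀ h ∈ U, ∀ u ∈ Ioo (0 : ℝ) 1, γ u ∉ trace (b h)
  ne_start : ∀ h ∈ U, ∀ u ∈ Icc (0 : ℝ) 1, γ u ≠ b h 0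

lemma im_nonneg_of_Ioo {γ : ℝ → ℂ} (hγ : Continuous γ) (h : ∀ u ∈ Ioo (0 : ℝ) 1, 0 < (γ u).im)
    {u : ℝ} (hu : u ∈ Icc (0 : ℝ) 1) : 0 ≤ (γ u).im := by
  have hcl : IsClosed {u : ℝ | 0 ≤ (γ u).im} :=
    isClosed_le continuous_const (Complex.continuous_im.comp hγ)
  have : closure (Ioo (0 : ℝ) 1) ⊆ {u : ℝ | 0 ≤ (γ u).im} :=
    hcl.closure_subset_iff.2 fun u hu => (h u hu).le
  rw [closure_Ioo zero_ne_one] at this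
  exact this hu

section Family

variable {b : ℝ → ℝ → ℂ} {U : Set ℝ} {α' : ℝ → ℂ}

/-- The point `α` is off the curve, and `α*` lies in the lower half-plane while the curve stays in
the closed upper one; compactness and continuity of `α` make both distances locally uniform. -/
lemma IsArcFamily.exists_dist_bound (hb : IsArcFamily b U)
    (hα : ∀ h ∈ U, HasDerivAt (fun h => b h 0) (α' h) h) {γ : ℝ → ℂ} (hγ : IsAvoiding b U γ)
    {h₀ : ℝ} (h₀U : h₀ ∈ U) :
    ∃ c > 0, ∀ᶠ h in 𝓝 h₀, ∀ u ∈ Icc (0 : ℝ) 1,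
      c ≤ ‖γ u - b h 0‖ ∧ c ≤ ‖γ u - conj (b h 0)‖ := by
  have hc := hγ.cont
  have hne : ∀ u ∈ Icc (0 : ℝ) 1, 0 < min ‖γ u - b h₀ 0‖ ‖γ u - conj (b h₀ 0)‖ := by
    intro u hu
    refine lt_min (norm_pos_iff.2 (sub_ne_zero.2 (hγ.ne_start h₀ h₀U u hu)))
      (norm_pos_iff.2 (sub_ne_zero.2 ?_))
    intro h
    have h1 := im_nonneg_of_Ioo hc hγ.upper hu
    have h2 := hb.start h₀ h₀U
    rw [h, Complex.conj_im] at h1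
    linarith
  obtain ⟨u₀, hu₀, hmin⟩ := (isCompact_Icc (a := (0 : ℝ)) (b := 1)).exists_isMinOn
    ⟨0, by simp⟩ (f := fun u => min ‖γ u - b h₀ 0‖ ‖γ u - conj (b h₀ 0)‖)
    (by fun_prop)
  set d := min ‖γ u₀ - b h₀ 0‖ ‖γ u₀ - conj (b h₀ 0)‖ with hd
  have hdpos : 0 < d := hne u₀ hu₀
  refine ⟨d / 2, by positivity, ?_⟩
  have hcont := (hα h₀ h₀U).continuousAt
  filter_upwards [hcont.eventually (Metric.ball_mem_nhds (b h₀ 0) (half_pos hdpos))] with h hh u hu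
  have hh' : ‖b h 0 - b h₀ 0‖ < d / 2 := by rw [← dist_eq_norm]; exact hh
  have hmu : d ≤ min ‖γ u - b h₀ 0‖ ‖γ u - conj (b h₀ 0)‖ := hmin hu
  have h1 := hmu.trans (min_le_left _ _)
  have h2 := hmu.trans (min_le_right _ _)
  constructor
  · have e := norm_add_le (γ u - b h 0) (b h 0 - b h₀ 0)
    rw [sub_add_sub_cancel] at e
    linarith
  · have e := norm_add_le (γ u - conj (b h 0)) (conj (b h 0) - conj (b h₀ 0))
    rw [sub_add_sub_cancel, ← map_sub, Complex.norm_conj] at e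
    linarith

lemma IsArcFamily.sqrtR_sq (hb : IsArcFamily b U) {h : ℝ} (hU : h ∈ U) {w : ℂ} (hw : 0 < w.im)
    (hwb : w ∉ trace (b h)) : sqrtR (b h) w ^ 2 = (w - b h 0) * (w - conj (b h 0)) :=
  SineGordon.sqrtR_sq (hb.arc h hU) (fun h => by simp [h] at hw) hwb
    (conj_notMem_trace (hb.arc h hU) (hb.start h hU) hw)

lemma sub_start_ne_zero {β : ℝ → ℂ} {w : ℂ} (hwb : w ∉ trace β) : w - β 0 ≠ 0 :=
  sub_ne_zero.2 fun h => hwb ⟨0, by simp, h.symm⟩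

lemma sub_conj_start_ne_zero {β : ℝ → ℂ} (hs : 0 < (β 0).im) {w : ℂ} (hw : 0 < w.im) :
    w - conj (β 0) ≠ 0 := by
  intro h
  have := congrArg Complex.im h
  simp at this
  linarith

lemma IsArcFamily.sqrtR_ne_zero (hb : IsArcFamily b U) {h : ℝ} (hU : h ∈ U) {w : ℂ} (hw : 0 < w.im)
    (hwb : w ∉ trace (b h)) : sqrtR (b h) w ≠ 0 := by
  intro h0
  have := hb.sqrtR_sq hU hw hwb
  rw [h0, zero_pow two_ne_zero] at this
  rcases mul_eq_zero.1 this.symm with h1 | h1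
  · exact sub_start_ne_zero hwb h1
  · exact sub_conj_start_ne_zero (hb.start h hU) hw h1

/-- At fixed `w`, `R` is a continuous square root of `(w-α)(w-α*)`, which involves the arc only
through its starting point. The formula is half the logarithmic derivative of this product. -/
lemma IsArcFamily.hasDerivAt_sqrtR (hb : IsArcFamily b U)
    (hα : ∀ h ∈ U, HasDerivAt (fun h => b h 0) (α' h) h) {h : ℝ} (hU : h ∈ U) {w : ℂ}
    (hw : 0 < w.im) (hwb : ∀ h ∈ U, w ∉ trace (b h)) :
    HasDerivAt (fun h => sqrtR (b h) w)
      (-(sqrtR (b h) w / 2) * (α' h / (w - b h 0) + conj (α' h) / (w - conj (b h 0)))) h := by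
  have hc : ContinuousAt (fun h => sqrtR (b h) w) h :=
    ContinuousAt.comp (f := fun h : ℝ => (h, w)) (x := h)
      (hb.continuousAt_sqrtR hU (hwb h hU)
        (conj_notMem_trace (hb.arc h hU) (hb.start h hU) hw))
      (continuous_id.prodMk continuous_const).continuousAt
  have hne := hb.sqrtR_ne_zero hU hw (hwb h hU)
  have hp : HasDerivAt (fun h => (w - b h 0) * (w - conj (b h 0)))
      (-(α' h) * (w - conj (b h 0)) + (w - b h 0) * -(conj (α' h))) h := by
    have h1 := (hα h hU).const_sub w
    have h2 := ((hα h hU).star).const_sub w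
    exact h1.mul h2
  have := hasDerivAt_of_sq hc hne
    (by filter_upwards [hb.isOpen.mem_nhds hU] with y hy using hb.sqrtR_sq hy hw (hwb y hy)) hp
  refine this.congr_deriv ?_
  have h1 := sub_start_ne_zero (hwb h hU)
  have h2 := sub_conj_start_ne_zero (hb.start h hU) hw
  have hsq := hb.sqrtR_sq hU hw (hwb h hU)
  field_simp
  rw [hsq]
  ring

lemma IsAvoiding.continuousOn_sqrtR (hb : IsArcFamily b U) {γ : ℝ → ℂ} (hγ : IsAvoiding b U γ)
    {h : ℝ} (hU : h ∈ U) : ContinuousOn (fun u => sqrtR (b h) (γ u)) (Ioo 0 1) := fun u hu =>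
  (ContinuousAt.comp (f := γ) (x := u)
    (continuousAt_sqrtR (hb.arc h hU) (hb.start h hU) (hγ.off h hU u hu)
      (conj_notMem_trace (hb.arc h hU) (hb.start h hU) (hγ.upper u hu)))
    hγ.cont.continuousAt).continuousWithinAt

/-- Since `|R|² = |w-α| |w-α*|`, only distances to the branch points matter. A curve that runs into
`β` at the common end `1` therefore still has a uniform lower bound for `|R|`. -/
lemma IsAvoiding.le_norm_sqrtR (hb : IsArcFamily b U) {γ : ℝ → ℂ} (hγ : IsAvoiding b U γ)
    {h : ℝ} (hU : h ∈ U) {c : ℝ} (hc : 0 < c) {u : ℝ} (hu : u ∈ Ioo (0 : ℝ) 1)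
    (h1 : c ≤ ‖γ u - b h 0‖) (h2 : c ≤ ‖γ u - conj (b h 0)‖) : c ≤ ‖sqrtR (b h) (γ u)‖ := by
  have hsq := congrArg norm (hb.sqrtR_sq hU (hγ.upper u hu) (hγ.off h hU u hu))
  rw [norm_pow, norm_mul] at hsq
  refine le_of_sq_le_sq ?_ (norm_nonneg _)
  rw [hsq, sq]
  exact mul_le_mul h1 h2 hc.le (norm_nonneg _)

/-- Differentiation under the integral sign for integrals of the form `∫ f / R`. -/
lemma IsArcFamily.hasDerivAt_integral (hb : IsArcFamily b U)
    (hα : ∀ h ∈ U, HasDerivAt (fun h => b h 0) (α' h) h) (hα' : ContinuousOn α' U)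
    {γ : ℝ → ℂ} (hγ : IsAvoiding b U γ) {f : ℝ → ℂ} {C : ℝ}
    (hf : AEStronglyMeasurable f (volume.restrict (uIoc (0 : ℝ) 1)))
    (hC : ∀ u ∈ Ioo (0 : ℝ) 1, ‖f u‖ ≤ C) {h₀ : ℝ} (h₀U : h₀ ∈ U) :
    HasDerivAt (fun h => ∫ u in (0 : ℝ)..1, f u / sqrtR (b h) (γ u))
      (∫ u in (0 : ℝ)..1, f u / sqrtR (b h₀) (γ u) *
        (1 / 2 * (α' h₀ / (γ u - b h₀ 0) + conj (α' h₀) / (γ u - conj (b h₀ 0))))) h₀ := by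
  obtain ⟨c, hc, hev⟩ := hb.exists_dist_bound hα hγ h₀U
  have hα'c : ContinuousAt α' h₀ := hα'.continuousAt (hb.isOpen.mem_nhds h₀U)
  have hev2 : ∀ᶠ h in 𝓝 h₀, ‖α' h‖ ≤ ‖α' h₀‖ + 1 := by
    have := hα'c.norm.eventually (gt_mem_nhds (lt_add_one ‖α' h₀‖))
    filter_upwards [this] with h hh using hh.le
  set A := ‖α' h₀‖ + 1 with hA
  have hC0 : 0 ≤ C := (norm_nonneg _).trans (hC (1 / 2) (by norm_num))
  have hmeas : ∀ h ∈ U, AEStronglyMeasurable (fun u => f u / sqrtR (b h) (γ u))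
      (volume.restrict (uIoc (0 : ℝ) 1)) := fun h hU =>
    hf.div₀ (aestronglyMeasurable_of_continuousOn_Ioo (hγ.continuousOn_sqrtR hb hU))
  have hbd : ∀ h ∈ U, (∀ u ∈ Icc (0 : ℝ) 1, c ≤ ‖γ u - b h 0‖ ∧ c ≤ ‖γ u - conj (b h 0)‖) →
      ∀ u ∈ Ioo (0 : ℝ) 1, ‖f u / sqrtR (b h) (γ u)‖ ≤ C / c := by
    intro h hU hd u hu
    obtain ⟨h1, h2⟩ := hd u (Ioo_subset_Icc_self hu)
    have := hγ.le_norm_sqrtR hb hU hc hu h1 h2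
    rw [norm_div]
    exact div_le_div₀ hC0 (hC u hu) hc this
  have key := intervalIntegral.hasDerivAt_integral_of_dominated_loc_of_deriv_le (𝕜 := ℝ)
    (μ := volume) (a := 0) (b := 1)
    (s := {h | (∀ u ∈ Icc (0 : ℝ) 1, c ≤ ‖γ u - b h 0‖ ∧ c ≤ ‖γ u - conj (b h 0)‖) ∧
      ‖α' h‖ ≤ A ∧ h ∈ U})
    (F := fun h u => f u / sqrtR (b h) (γ u))
    (F' := fun h u => f u / sqrtR (b h) (γ u) *
        (1 / 2 * (α' h / (γ u - b h 0) + conj (α' h) / (γ u - conj (b h 0)))))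
    (x₀ := h₀) (bound := fun _ => C / c * (1 / 2 * (A / c + A / c)))
    (by filter_upwards [hev, hev2, hb.isOpen.mem_nhds h₀U] with h h1 h2 h3 using ⟨h1, h2, h3⟩)
    (by filter_upwards [hb.isOpen.mem_nhds h₀U] with h hU using hmeas h hU)
    (intervalIntegrable_of_bounded (hmeas h₀ h₀U) (hbd h₀ h₀U hev.self_of_nhds))
    ?_ ?_ intervalIntegrable_const ?_
  · exact key.2
  · refine (hmeas h₀ h₀U).mul (aestronglyMeasurable_of_continuousOn_Ioo ?_)
    have hd := hev.self_of_nhds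
    have hcγ := hγ.cont
    have n1 : ∀ u ∈ Ioo (0 : ℝ) 1, γ u - b h₀ 0 ≠ 0 := fun u hu h => by
      have := (hd u (Ioo_subset_Icc_self hu)).1
      rw [h, norm_zero] at this; linarith
    have n2 : ∀ u ∈ Ioo (0 : ℝ) 1, γ u - conj (b h₀ 0) ≠ 0 := fun u hu h => by
      have := (hd u (Ioo_subset_Icc_self hu)).2
      rw [h, norm_zero] at this; linarith
    refine continuousOn_const.mul ((continuousOn_const.div ?_ n1).add
      (continuousOn_const.div ?_ n2)) <;> fun_prop
  · filter_upwards [ae_mem_Ioo] with u hu hu' h hh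
    obtain ⟨hd, hAh, hU⟩ := hh
    have hu := hu hu'
    have h0 := hbd h hU hd u hu
    obtain ⟨h1, h2⟩ := hd u (Ioo_subset_Icc_self hu)
    rw [norm_mul, norm_mul]
    refine mul_le_mul h0 (mul_le_mul (by norm_num) ((norm_add_le _ _).trans (add_le_add ?_ ?_))
      (norm_nonneg _) (by norm_num)) (by positivity) (by positivity)
    · rw [norm_div]; exact div_le_div₀ (by positivity) hAh hc h1
    · rw [norm_div, Complex.norm_conj]; exact div_le_div₀ (by positivity) hAh hc h2
  · filter_upwards [ae_mem_Ioo] with u hu hu' h hh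
    obtain ⟨hd, hAh, hU⟩ := hh
    have hu := hu hu'
    have hR := hb.hasDerivAt_sqrtR hα hU (hγ.upper u hu) (fun h hU => hγ.off h hU u hu)
    have hne := hb.sqrtR_ne_zero hU (hγ.upper u hu) (hγ.off h hU u hu)
    refine ((hasDerivAt_const h (f u)).fun_div hR hne).congr_deriv ?_
    field_simp
    ring

/-! ### Cauchy integrals with the weight `1/R` -/

/-- The integral `∫ g(u) / (R(γ(u)) (γ(u) - w)) du`. -/
def arcCauchy (γ g β : ℝ → ℂ) (w : ℂ) : ℂ :=
  ∫ u in (0 : ℝ)..1, g u / (sqrtR β (γ u) * (γ u - w))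

lemma IsAvoiding.norm_arcCauchy_start (hb : IsArcFamily b U)
    (hα : ∀ h ∈ U, HasDerivAt (fun h => b h 0) (α' h) h) {γ : ℝ → ℂ} (hγ : IsAvoiding b U γ)
    {g : ℝ → ℂ} {C : ℝ} (hC : ∀ u ∈ Ioo (0 : ℝ) 1, ‖g u‖ ≤ C) {h₀ : ℝ} (h₀U : h₀ ∈ U) :
    ∃ M, ∀ᶠ h in 𝓝 h₀, ‖arcCauchy γ g (b h) (b h 0)‖ ≤ M ∧
      ‖arcCauchy γ g (b h) (conj (b h 0))‖ ≤ M := by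
  obtain ⟨c, hc, hev⟩ := hb.exists_dist_bound hα hγ h₀U
  have hC0 : 0 ≤ C := (norm_nonneg _).trans (hC (1 / 2) (by norm_num))
  refine ⟨C / (c * c), ?_⟩
  filter_upwards [hev, hb.isOpen.mem_nhds h₀U] with h hd hU
  constructor
  all_goals
    refine norm_integral_le_of_Ioo fun u hu => ?_
    obtain ⟨h1, h2⟩ := hd u (Ioo_subset_Icc_self hu)
    rw [norm_div, norm_mul]
    refine div_le_div₀ hC0 (hC u hu) (by positivity) (mul_le_mul
      (hγ.le_norm_sqrtR hb hU hc hu h1 h2) (by assumption) hc.le (norm_nonneg _))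

lemma exists_dist_trace {γ : ℝ → ℂ} (hγ : Continuous γ) {w : ℂ} (hw : w ∉ trace γ) :
    ∃ d > 0, ∀ u ∈ Icc (0 : ℝ) 1, d ≤ ‖γ u - w‖ := by
  have hpos := ((isCompact_trace hγ).isClosed.notMem_iff_infDist_pos
    ⟨γ 0, 0, by simp, rfl⟩).1 hw
  refine ⟨_, hpos, fun u hu => ?_⟩
  rw [← dist_eq_norm, dist_comm]
  exact Metric.infDist_le_dist_of_mem ⟨u, hu, rfl⟩

lemma IsAvoiding.exists_bound_div (hb : IsArcFamily b U)
    (hα : ∀ h ∈ U, HasDerivAt (fun h => b h 0) (α' h) h) {γ : ℝ → ℂ} (hγ : IsAvoiding b U γ)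
    {g : ℝ → ℂ} {C : ℝ} (hC : ∀ u ∈ Ioo (0 : ℝ) 1, ‖g u‖ ≤ C) {h : ℝ} (hU : h ∈ U) :
    ∃ K, 0 ≤ K ∧ ∀ u ∈ Ioo (0 : ℝ) 1, ‖g u / sqrtR (b h) (γ u)‖ ≤ K := by
  obtain ⟨c, hc, hev⟩ := hb.exists_dist_bound hα hγ hU
  have hC0 : 0 ≤ C := (norm_nonneg _).trans (hC (1 / 2) (by norm_num))
  refine ⟨C / c, by positivity, fun u hu => ?_⟩
  obtain ⟨h1, h2⟩ := hev.self_of_nhds u (Ioo_subset_Icc_self hu)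
  rw [norm_div]
  exact div_le_div₀ hC0 (hC u hu) hc (hγ.le_norm_sqrtR hb hU hc hu h1 h2)

lemma IsAvoiding.intervalIntegrable_arcCauchy (hb : IsArcFamily b U)
    (hα : ∀ h ∈ U, HasDerivAt (fun h => b h 0) (α' h) h) {γ : ℝ → ℂ} (hγ : IsAvoiding b U γ)
    {g : ℝ → ℂ} {C : ℝ} (hg : AEStronglyMeasurable g (volume.restrict (uIoc (0 : ℝ) 1)))
    (hC : ∀ u ∈ Ioo (0 : ℝ) 1, ‖g u‖ ≤ C) {h : ℝ} (hU : h ∈ U) {w : ℂ} (hw : w ∉ trace γ) :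
    IntervalIntegrable (fun u => g u / (sqrtR (b h) (γ u) * (γ u - w))) volume 0 1 := by
  obtain ⟨K, hK0, hK⟩ := hγ.exists_bound_div hb hα hC hU
  obtain ⟨d, hd, hdist⟩ := exists_dist_trace hγ.cont hw
  have hcγ := hγ.cont
  refine intervalIntegrable_of_bounded (C := K / d) ?_ fun u hu => ?_
  · refine hg.div₀ ((aestronglyMeasurable_of_continuousOn_Ioo (hγ.continuousOn_sqrtR hb hU)).mul ?_)
    exact aestronglyMeasurable_of_continuousOn_Ioo (by fun_prop)
  · rw [← div_div, norm_div]
    exact div_le_div₀ hK0 (hK u hu) hd (hdist u (Ioo_subset_Icc_self hu))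

lemma IsAvoiding.continuousAt_arcCauchy (hb : IsArcFamily b U)
    (hα : ∀ h ∈ U, HasDerivAt (fun h => b h 0) (α' h) h) {γ : ℝ → ℂ} (hγ : IsAvoiding b U γ)
    {g : ℝ → ℂ} {C : ℝ} (hg : AEStronglyMeasurable g (volume.restrict (uIoc (0 : ℝ) 1)))
    (hC : ∀ u ∈ Ioo (0 : ℝ) 1, ‖g u‖ ≤ C) {h : ℝ} (hU : h ∈ U) {w : ℂ} (hw : w ∉ trace γ) :
    ContinuousAt (arcCauchy γ g (b h)) w := by
  obtain ⟨K, hK0, hK⟩ := hγ.exists_bound_div hb hα hC hU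
  obtain ⟨d, hd, hdist⟩ := exists_dist_trace hγ.cont hw
  have hcγ := hγ.cont
  refine intervalIntegral.continuousAt_of_dominated_interval (bound := fun _ => K / (d / 2)) ?_ ?_
    intervalIntegrable_const ?_
  · refine Eventually.of_forall fun x => hg.div₀ ((aestronglyMeasurable_of_continuousOn_Ioo
      (hγ.continuousOn_sqrtR hb hU)).mul ?_)
    exact aestronglyMeasurable_of_continuousOn_Ioo (by fun_prop)
  · filter_upwards [Metric.ball_mem_nhds w (half_pos hd)] with x hx
    filter_upwards [ae_mem_Ioo] with u hu hu'
    have hu := hu hu'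
    rw [← div_div, norm_div]
    refine div_le_div₀ hK0 (hK u hu) (half_pos hd) ?_
    have h1 := hdist u (Ioo_subset_Icc_self hu)
    have h2 := norm_add_le (γ u - x) (x - w)
    rw [sub_add_sub_cancel] at h2
    have h3 : ‖x - w‖ < d / 2 := by rw [← dist_eq_norm]; exact hx
    linarith
  · filter_upwards [ae_mem_Ioo] with u hu hu'
    have hu := hu hu'
    refine continuousAt_const.div (by fun_prop) ?_
    refine mul_ne_zero (hb.sqrtR_ne_zero hU (hγ.upper u hu) (hγ.off h hU u hu)) fun h0 => ?_
    have := hdist u (Ioo_subset_Icc_self hu)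
    rw [h0, norm_zero] at this
    linarith

lemma IsAvoiding.start_notMem_trace {γ : ℝ → ℂ} (hγ : IsAvoiding b U γ) {h : ℝ} (hU : h ∈ U) :
    b h 0 ∉ trace γ := by
  rintro ⟨u, hu, h1⟩
  exact hγ.ne_start h hU u hu h1

lemma IsAvoiding.notMem_trace_of_im_neg {γ : ℝ → ℂ} (hγ : IsAvoiding b U γ) {w : ℂ}
    (hw : w.im < 0) : w ∉ trace γ := by
  rintro ⟨u, hu, rfl⟩
  exact absurd (im_nonneg_of_Ioo hγ.cont hγ.upper hu) (not_le.2 hw)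

lemma IsAvoiding.conj_start_notMem_trace (hb : IsArcFamily b U) {γ : ℝ → ℂ}
    (hγ : IsAvoiding b U γ) {h : ℝ} (hU : h ∈ U) : conj (b h 0) ∉ trace γ :=
  hγ.notMem_trace_of_im_neg (by simpa using hb.start h hU)

/-- Differentiating `1/R` produces the kernels `1/(ξ-α)` and `1/(ξ-α*)`, so the derivative is read
off from values of the Cauchy integral at the branch points. -/
lemma IsAvoiding.hasDerivAt_integral_div (hb : IsArcFamily b U)
    (hα : ∀ h ∈ U, HasDerivAt (fun h => b h 0) (α' h) h) (hα' : ContinuousOn α' U)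
    {γ : ℝ → ℂ} (hγ : IsAvoiding b U γ)
    {g : ℝ → ℂ} {C : ℝ} (hg : AEStronglyMeasurable g (volume.restrict (uIoc (0 : ℝ) 1)))
    (hC : ∀ u ∈ Ioo (0 : ℝ) 1, ‖g u‖ ≤ C) {h : ℝ} (hU : h ∈ U) :
    HasDerivAt (fun h => ∫ u in (0 : ℝ)..1, g u / sqrtR (b h) (γ u))
      (1 / 2 * (α' h * arcCauchy γ g (b h) (b h 0)
        + conj (α' h) * arcCauchy γ g (b h) (conj (b h 0)))) h := by
  refine (hb.hasDerivAt_integral hα hα' hγ hg hC hU).congr_deriv ?_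
  have i1 := hγ.intervalIntegrable_arcCauchy hb hα hg hC hU (hγ.start_notMem_trace hU)
  have i2 := hγ.intervalIntegrable_arcCauchy hb hα hg hC hU (hγ.conj_start_notMem_trace hb hU)
  rw [arcCauchy, arcCauchy, ← intervalIntegral.integral_const_mul,
    ← intervalIntegral.integral_const_mul,
    ← intervalIntegral.integral_add (i1.const_mul _) (i2.const_mul _),
    ← intervalIntegral.integral_const_mul]
  refine integral_congr_Ioo fun u hu => ?_
  have h1 := sub_start_ne_zero (hγ.off h hU u hu)
  have h2 := sub_conj_start_ne_zero (hb.start h hU) (hγ.upper u hu)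
  have h3 := hb.sqrtR_ne_zero hU (hγ.upper u hu) (hγ.off h hU u hu)
  field_simp

lemma IsAvoiding.hasDerivAt_arcCauchy (hb : IsArcFamily b U)
    (hα : ∀ h ∈ U, HasDerivAt (fun h => b h 0) (α' h) h) (hα' : ContinuousOn α' U)
    {γ : ℝ → ℂ} (hγ : IsAvoiding b U γ)
    {g : ℝ → ℂ} {C : ℝ} (hg : AEStronglyMeasurable g (volume.restrict (uIoc (0 : ℝ) 1)))
    (hC : ∀ u ∈ Ioo (0 : ℝ) 1, ‖g u‖ ≤ C) {h : ℝ} (hU : h ∈ U) {w : ℂ} (hw : w ∉ trace γ)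
    (hw1 : w ≠ b h 0) (hw2 : w ≠ conj (b h 0)) :
    HasDerivAt (fun h => arcCauchy γ g (b h) w)
      (1 / 2 * (α' h / (w - b h 0) *
          (arcCauchy γ g (b h) w - arcCauchy γ g (b h) (b h 0))
        + conj (α' h) / (w - conj (b h 0)) *
          (arcCauchy γ g (b h) w - arcCauchy γ g (b h) (conj (b h 0))))) h := by
  obtain ⟨d, hd, hdist⟩ := exists_dist_trace hγ.cont hw
  have hcγ := hγ.cont
  have hC0 : 0 ≤ C := (norm_nonneg _).trans (hC (1 / 2) (by norm_num))
  have key := hb.hasDerivAt_integral hα hα' hγ (f := fun u => g u / (γ u - w)) (C := C / d)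
    (hg.div₀ (aestronglyMeasurable_of_continuousOn_Ioo (by fun_prop)))
    (fun u hu => by
      rw [norm_div]
      exact div_le_div₀ hC0 (hC u hu) hd (hdist u (Ioo_subset_Icc_self hu))) hU
  have e : (fun h => arcCauchy γ g (b h) w)
      = fun h => ∫ u in (0 : ℝ)..1, g u / (γ u - w) / sqrtR (b h) (γ u) := by
    funext h
    simp only [arcCauchy, div_div, mul_comm]
  rw [e]
  refine key.congr_deriv ?_
  have i0 := hγ.intervalIntegrable_arcCauchy hb hα hg hC hU hw
  have i1 := hγ.intervalIntegrable_arcCauchy hb hα hg hC hU (hγ.start_notMem_trace hU)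
  have i2 := hγ.intervalIntegrable_arcCauchy hb hα hg hC hU (hγ.conj_start_notMem_trace hb hU)
  rw [arcCauchy, arcCauchy, arcCauchy, ← intervalIntegral.integral_sub i0 i1,
    ← intervalIntegral.integral_sub i0 i2, ← intervalIntegral.integral_const_mul,
    ← intervalIntegral.integral_const_mul,
    ← intervalIntegral.integral_add ((i0.sub i1).const_mul _) ((i0.sub i2).const_mul _),
    ← intervalIntegral.integral_const_mul]
  refine integral_congr_Ioo fun u hu => ?_
  have h1 := sub_start_ne_zero (hγ.off h hU u hu)
  have h2 := sub_conj_start_ne_zero (hb.start h hU) (hγ.upper u hu)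
  have h3 := hb.sqrtR_ne_zero hU (hγ.upper u hu) (hγ.off h hU u hu)
  have h4 : γ u - w ≠ 0 := fun h0 => by
    have := hdist u (Ioo_subset_Icc_self hu)
    rw [h0, norm_zero] at this
    linarith
  have h5 := sub_ne_zero.2 hw1
  have h6 := sub_ne_zero.2 hw2
  -- Partial fractions separate the pole at `w` from the pole at the branch point, so the Cauchy
  -- integrals at these two points appear as a difference.
  have e1 : 1 / ((γ u - w) * (γ u - b h 0))
      = (1 / (γ u - w) - 1 / (γ u - b h 0)) / (w - b h 0) := by
    field_simp; ring
  have e2 : 1 / ((γ u - w) * (γ u - conj (b h 0)))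
      = (1 / (γ u - w) - 1 / (γ u - conj (b h 0))) / (w - conj (b h 0)) := by
    field_simp; ring
  calc _ = g u / sqrtR (b h) (γ u) * (1 / 2) * (α' h * (1 / ((γ u - w) * (γ u - b h 0)))
        + conj (α' h) * (1 / ((γ u - w) * (γ u - conj (b h 0))))) := by
        field_simp
    _ = _ := by
        rw [e1, e2]
        field_simp

end Family

end SineGordon
end

noncomputable section
namespace SineGordon

/-! ### The sign of `R` near the point `1` -/

lemma tendsto_arg_sub_right {γ : ℝ → ℂ} {d : ℂ} (hd : HasDerivAt γ d 1) (h1 : γ 1 = 1)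
    (hs : -d ∈ slitPlane) : Tendsto (fun u => arg (γ u - 1)) (𝓝[<] 1) (𝓝 (arg (-d))) := by
  have h := (hasDerivAt_iff_tendsto_slope.1 hd).mono_left
    (nhdsWithin_mono 1 (fun u (hu : u < 1) => hu.ne))
  have h2 := (continuousAt_arg hs).tendsto.comp h.neg
  refine h2.congr' ?_
  filter_upwards [self_mem_nhdsWithin] with u hu
  have hu' : (0 : ℝ) < (1 - u)⁻¹ := inv_pos.2 (sub_pos.2 hu)
  have e : -slope γ 1 u = ((1 - u)⁻¹ : ℝ) * (γ u - 1) := by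
    rw [slope_def_module, h1, Complex.real_smul, ← neg_mul, ← ofReal_neg, ← inv_neg, neg_sub]
  simp only [Function.comp_apply]
  rw [e, arg_real_mul _ hu']

lemma tendsto_arg_sub_left {γ : ℝ → ℂ} {d : ℂ} (hd : HasDerivAt γ d 0) (h1 : γ 0 = 1)
    (hs : d ∈ slitPlane) : Tendsto (fun u => arg (γ u - 1)) (𝓝[>] 0) (𝓝 (arg d)) := by
  have h := (hasDerivAt_iff_tendsto_slope.1 hd).mono_left
    (nhdsWithin_mono 0 (fun u (hu : 0 < u) => hu.ne'))
  have h2 := (continuousAt_arg hs).tendsto.comp h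
  refine h2.congr' ?_
  filter_upwards [self_mem_nhdsWithin] with u hu
  have hu' : (0 : ℝ) < u⁻¹ := inv_pos.2 hu
  have e : slope γ 0 u = (u⁻¹ : ℝ) * (γ u - 1) := by
    rw [slope_def_module, h1, Complex.real_smul, sub_zero]
  simp only [Function.comp_apply]
  rw [e, arg_real_mul _ hu']

/-- The point `1 + ρ e^{iφ}`. -/
def polarAtOne (p : ℝ × ℝ) : ℂ := 1 + p.1 * cexp (p.2 * I)

lemma continuous_polarAtOne : Continuous polarAtOne := by
  unfold polarAtOne; fun_prop

lemma norm_polarAtOne_sub {p : ℝ × ℝ} (hp : 0 ≤ p.1) : ‖polarAtOne p - 1‖ = p.1 := by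
  simp [polarAtOne, norm_exp_ofReal_mul_I, abs_of_nonneg hp]

lemma polarAtOne_norm_arg (w : ℂ) : polarAtOne (‖w - 1‖, arg (w - 1)) = w := by
  simp [polarAtOne, norm_mul_exp_arg_mul_I]

/-- Near its end `β` approaches `1` from a direction outside the closed range of angles, and the
rest of `β` is compact and misses `1`. The radius is the distance from `1` to that remaining part.
-/
lemma exists_sector_avoiding {β : ℝ → ℂ} (hβ : IsArc β (β 0) 1)
    (hsl : -deriv β 1 ∈ slitPlane) {φ₁ φ₂ : ℝ} (h0 : 0 ≤ φ₁) (hπ : φ₂ ≤ Real.pi)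
    (hτ : arg (-deriv β 1) ∉ Icc φ₁ φ₂) :
    ∃ δ > 0, ∀ p ∈ Ioo 0 δ ×ˢ Icc φ₁ φ₂, polarAtOne p ∉ trace β := by
  have hd := (hβ.contDiff.differentiable one_ne_zero 1).hasDerivAt
  have hev := (tendsto_arg_sub_right hd hβ.finish hsl).eventually (isClosed_Icc.compl_mem_nhds hτ)
  obtain ⟨η, hη, hηI⟩ := (mem_nhdsLT_iff_exists_Ioo_subset' (zero_lt_one (α := ℝ))).1
    (inter_mem hev (Ioo_mem_nhdsLT zero_lt_one))
  have hη' : η < 1 := hη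
  have hcpt : IsCompact (Icc 0 η) := isCompact_Icc
  have hβ1 : ∀ u ∈ Icc 0 η, 0 < ‖β u - 1‖ := by
    intro u hu
    refine norm_pos_iff.2 (sub_ne_zero.2 fun h => ?_)
    have := hβ.inj ⟨hu.1, by linarith [hu.2]⟩ (show (1 : ℝ) ∈ Icc (0 : ℝ) 1 by simp)
      (h.trans hβ.finish.symm)
    linarith [hu.2]
  have hcont : ContinuousOn (fun u => ‖β u - 1‖) (Icc 0 η) := by
    have := hβ.contDiff.continuous
    fun_prop
  obtain ⟨d, hd, hdb⟩ : ∃ d > 0, ∀ u ∈ Icc 0 η, d ≤ ‖β u - 1‖ := by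
    rcases (Icc 0 η).eq_empty_or_nonempty with he | hne
    · exact ⟨1, one_pos, by simp [he]⟩
    · obtain ⟨u₀, hu₀, hmin⟩ := hcpt.exists_isMinOn hne hcont
      exact ⟨_, hβ1 u₀ hu₀, fun u hu => hmin hu⟩
  refine ⟨d, hd, ?_⟩
  rintro ⟨ρ, φ⟩ ⟨hρ, hφ⟩ ⟨u, hu, hup⟩
  simp only at hρ hφ
  have hnorm : ‖β u - 1‖ = ρ := by rw [hup]; exact norm_polarAtOne_sub (p := (ρ, φ)) hρ.1.le
  rcases le_or_gt u η with h | h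
  · have := hdb u ⟨hu.1, h⟩
    linarith [hρ.2]
  rcases eq_or_lt_of_le hu.2 with h1 | h1
  · rw [h1, hβ.finish, sub_self, norm_zero] at hnorm
    linarith [hρ.1]
  · have := (hηI ⟨h, h1⟩).1
    apply this
    have e : β u - 1 = ρ * (Complex.cos φ + Complex.sin φ * I) := by
      rw [hup, polarAtOne, ← exp_mul_I]; simp
    have harg : arg (β u - 1) = φ := by
      rw [e]
      exact arg_mul_cos_add_sin_mul_I hρ.1
        ⟨by linarith [Real.pi_pos, hφ.1], hφ.2.trans hπ⟩
    show arg (β u - 1) ∈ Icc φ₁ φ₂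
    rw [harg]; exact hφ

lemma im_polarAtOne_nonneg {p : ℝ × ℝ} (hp : 0 ≤ p.1) (h0 : 0 ≤ p.2) (hπ : p.2 ≤ Real.pi) :
    0 ≤ (polarAtOne p).im := by
  have : (polarAtOne p).im = p.1 * Real.sin p.2 := by
    simp [polarAtOne, Complex.exp_ofReal_mul_I_im]
  rw [this]
  exact mul_nonneg hp (Real.sin_nonneg_of_nonneg_of_le_pi h0 hπ)

/-- On a sector at `1` that avoids `β` and reaches the real axis, the sign of `Re R` is that on
the axis. -/
lemma exists_sector_sign {β : ℝ → ℂ} (hβ : IsArc β (β 0) 1) (hs : 0 < (β 0).im)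
    (hsl : -deriv β 1 ∈ slitPlane) {φ₁ φ₂ : ℝ} (h0 : 0 ≤ φ₁) (hπ : φ₂ ≤ Real.pi)
    (hτ : arg (-deriv β 1) ∉ Icc φ₁ φ₂) {ε : ℝ} (hε : ε = 1 ∨ ε = -1) {φ₀ : ℝ}
    (hφ₀ : φ₀ ∈ Icc φ₁ φ₂) (hφε : cexp (φ₀ * I) = ε) :
    ∃ δ > 0, ∀ p ∈ Ioo 0 δ ×ˢ Icc φ₁ φ₂, 0 < ε * (sqrtR β (polarAtOne p)).re := by
  obtain ⟨δ₁, hδ₁, hav⟩ := exists_sector_avoiding hβ hsl h0 hπ hτ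
  have hα1 : (1 : ℂ) - β 0 ≠ 0 := by
    intro h
    have := congrArg Complex.im h
    simp at this
    linarith
  have hP1 : 0 < (((1 : ℂ) - β 0) * (1 - conj (β 0))).re := by
    have e : (1 : ℂ) - conj (β 0) = conj (1 - β 0) := by simp
    rw [e, Complex.mul_conj, ofReal_re]
    exact normSq_pos.2 hα1
  have hcP : Continuous fun w : ℂ => ((w - β 0) * (w - conj (β 0))).re := by fun_prop
  obtain ⟨δ₂, hδ₂, hP⟩ := Metric.eventually_nhds_iff.1 (hcP.continuousAt.eventually
    (lt_mem_nhds hP1))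
  refine ⟨min δ₁ δ₂, lt_min hδ₁ hδ₂, ?_⟩
  set S := Ioo (0 : ℝ) (min δ₁ δ₂) ×ˢ Icc φ₁ φ₂ with hS
  have hmem : ∀ p ∈ S, polarAtOne p ∉ trace β ∧ conj (polarAtOne p) ∉ trace β ∧
      polarAtOne p ≠ 1 ∧ dist (polarAtOne p) 1 < δ₂ := by
    rintro p ⟨hp1, hp2⟩
    have hρ : ‖polarAtOne p - 1‖ = p.1 := norm_polarAtOne_sub hp1.1.le
    have hne : polarAtOne p ≠ 1 := by
      intro h
      rw [h, sub_self, norm_zero] at hρ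
      exact hp1.1.ne hρ
    refine ⟨hav p ⟨⟨hp1.1, hp1.2.trans_le (min_le_left _ _)⟩, hp2⟩, ?_, hne, ?_⟩
    · have him := im_polarAtOne_nonneg hp1.1.le (h0.trans hp2.1) (hp2.2.trans hπ)
      rcases eq_or_lt_of_le him with h | h
      · refine notMem_trace_of_im_zero hβ hs (by simp [← h]) fun h' => hne ?_
        have := congrArg conj h'
        simpa using this
      · exact conj_notMem_trace hβ hs h
    · rw [dist_eq_norm, hρ]; exact hp1.2.trans_le (min_le_right _ _)
  have hcont : ContinuousOn (fun p => ε * (sqrtR β (polarAtOne p)).re) S := by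
    intro p hp
    obtain ⟨h1, h2, -, -⟩ := hmem p hp
    have := ContinuousAt.comp (f := polarAtOne) (x := p) (continuousAt_sqrtR hβ hs h1 h2)
      continuous_polarAtOne.continuousAt
    exact (continuousAt_const.mul (Complex.continuous_re.continuousAt.comp this)).continuousWithinAt
  -- Near `1` the square `R²` is close to `|1-α|² > 0` and has positive real part, whereas a purely
  -- imaginary `R` would have a nonpositive square.
  have hnz : ∀ p ∈ S, ε * (sqrtR β (polarAtOne p)).re ≠ 0 := by
    intro p hp h
    obtain ⟨h1, h2, h3, h4⟩ := hmem p hp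
    have hre : (sqrtR β (polarAtOne p)).re = 0 := by
      rcases hε with rfl | rfl <;> simpa using h
    have hsq := sqrtR_sq hβ h3 h1 h2
    have hpos := hP h4
    rw [← hsq, sq, Complex.mul_re, hre] at hpos
    nlinarith [mul_self_nonneg (sqrtR β (polarAtOne p)).im]
  have hconn : IsPreconnected S := isPreconnected_Ioo.prod isPreconnected_Icc
  set p₀ : ℝ × ℝ := (min δ₁ δ₂ / 2, φ₀) with hp₀
  have hmin : 0 < min δ₁ δ₂ := lt_min hδ₁ hδ₂
  have hp₀S : p₀ ∈ S := ⟨⟨by simp only [hp₀]; linarith, by simp only [hp₀]; linarith⟩, hφ₀⟩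
  -- On the real axis the two logarithmic integrals are conjugate, so the exponential factor is
  -- positive and `R` has the sign of `w - 1`, which here is `ε`. Connectedness then spreads this
  -- sign over the sector.
  have hp₀pos : 0 < ε * (sqrtR β (polarAtOne p₀)).re := by
    have e1 : polarAtOne p₀ = ((1 + min δ₁ δ₂ / 2 * ε : ℝ) : ℂ) := by
      simp only [polarAtOne, hp₀, hφε]; push_cast; ring
    rw [e1, sqrtR, conj_ofReal]
    set r : ℝ := 1 + min δ₁ δ₂ / 2 * ε
    have e2 : -(1 / 2 : ℂ) * (cint β (fun z => 1 / (z - (r : ℂ)))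
        + conj (cint β (fun z => 1 / (z - (r : ℂ)))))
        = ((-(cint β (fun z => 1 / (z - (r : ℂ)))).re : ℝ) : ℂ) := by
      rw [Complex.add_conj]; push_cast; ring
    have e3 : (r : ℂ) - 1 = ((min δ₁ δ₂ / 2 * ε : ℝ) : ℂ) := by simp [r]
    rw [e2, e3, ← ofReal_exp, ← ofReal_mul, ofReal_re]
    have : ε * ε = 1 := by rcases hε with rfl | rfl <;> norm_num
    have e4 : ∀ x y : ℝ, ε * (x * ε * y) = x * y := fun x y => by
      calc ε * (x * ε * y) = (ε * ε) * (x * y) := by ring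
        _ = _ := by rw [this, one_mul]
    rw [e4]
    positivity
  intro p hp
  by_contra hneg
  obtain ⟨q, hq, hq0⟩ := hconn.intermediate_value hp hp₀S hcont ⟨not_lt.1 hneg, hp₀pos.le⟩
  exact hnz q hq hq0

/-- The sign condition keeps `f` at distance at least `c` from the wrong root `-εc`, so `|f - εc| ≤
|f² - c²| / c`. -/
lemma tendsto_of_sq {l : Filter ℝ} {f : ℝ → ℂ} {c ε : ℝ} (hc : 0 < c) (hε : ε = 1 ∨ ε = -1)
    (hsq : Tendsto (fun u => f u ^ 2) l (𝓝 ((c : ℂ) ^ 2))) (hre : ∀ᶠ u in l, 0 < ε * (f u).re) :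
    Tendsto f l (𝓝 ((ε * c : ℝ) : ℂ)) := by
  have h1 : Tendsto (fun u => ‖f u ^ 2 - (c : ℂ) ^ 2‖ / c) l (𝓝 0) := by
    have := ((hsq.sub_const ((c : ℂ) ^ 2)).norm).div_const c
    simpa using this
  rw [tendsto_iff_norm_sub_tendsto_zero]
  refine squeeze_zero' (Eventually.of_forall fun _ => norm_nonneg _) ?_ h1
  filter_upwards [hre] with u hu
  have hεε : ε ^ 2 = 1 := by rcases hε with rfl | rfl <;> norm_num
  have e : f u ^ 2 - (c : ℂ) ^ 2 = (f u - (ε * c : ℝ)) * (f u + (ε * c : ℝ)) := by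
    have : ((ε * c : ℝ) : ℂ) ^ 2 = (c : ℂ) ^ 2 := by
      rw [← ofReal_pow, mul_pow, hεε, one_mul, ofReal_pow]
    linear_combination this
  rw [le_div_iff₀ hc, e, norm_mul]
  refine mul_le_mul_of_nonneg_left ?_ (norm_nonneg _)
  have h2 : |(f u + (ε * c : ℝ)).re| ≤ ‖f u + (ε * c : ℝ)‖ := abs_re_le_norm _
  rw [add_re, ofReal_re] at h2
  refine le_trans ?_ h2
  rcases hε with rfl | rfl
  · rw [one_mul] at hu; rw [abs_of_pos (by linarith)]; linarith
  · have : (f u).re < 0 := by linarith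
    rw [abs_of_neg (by linarith)]; linarith

lemma tendsto_sqrtR_of_sector {β : ℝ → ℂ} (hβ : IsArc β (β 0) 1) (hs : 0 < (β 0).im)
    (hsl : -deriv β 1 ∈ slitPlane) {φ₁ φ₂ : ℝ} (h0 : 0 ≤ φ₁) (hπ : φ₂ ≤ Real.pi)
    (hτ : arg (-deriv β 1) ∉ Icc φ₁ φ₂) {ε : ℝ} (hε : ε = 1 ∨ ε = -1) {φ₀ : ℝ}
    (hφ₀ : φ₀ ∈ Icc φ₁ φ₂) (hφε : cexp (φ₀ * I) = ε) {l : Filter ℝ} {γ : ℝ → ℂ}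
    (hl : Tendsto γ l (𝓝 1)) (hl1 : ∀ᶠ u in l, γ u ≠ 1)
    (harg : ∀ᶠ u in l, arg (γ u - 1) ∈ Icc φ₁ φ₂)
    (him : ∀ᶠ u in l, 0 < (γ u).im ∧ γ u ∉ trace β) :
    Tendsto (fun u => sqrtR β (γ u)) l (𝓝 ((ε * ‖1 - β 0‖ : ℝ) : ℂ)) := by
  obtain ⟨δ, hδ, hsgn⟩ := exists_sector_sign hβ hs hsl h0 hπ hτ hε hφ₀ hφε
  have hα1 : (1 : ℂ) - β 0 ≠ 0 := by
    intro h
    have := congrArg Complex.im h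
    simp at this
    linarith
  refine tendsto_of_sq (norm_pos_iff.2 hα1) hε ?_ ?_
  · have hP1 : ((1 : ℂ) - β 0) * (1 - conj (β 0)) = (‖1 - β 0‖ : ℂ) ^ 2 := by
      have e : (1 : ℂ) - conj (β 0) = conj (1 - β 0) := by simp
      rw [e, Complex.mul_conj']
    rw [← hP1]
    have hc : Continuous fun w : ℂ => (w - β 0) * (w - conj (β 0)) := by fun_prop
    refine ((hc.tendsto 1).comp hl).congr' ?_
    filter_upwards [hl1, him] with u h1 h2
    exact (sqrtR_sq hβ h1 h2.2 (conj_notMem_trace hβ hs h2.1)).symm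
  · filter_upwards [hl1, harg, hl.eventually (Metric.ball_mem_nhds 1 hδ)] with u h1 h2 h3
    have := hsgn (‖γ u - 1‖, arg (γ u - 1))
      ⟨⟨norm_pos_iff.2 (sub_ne_zero.2 h1), by rw [← dist_eq_norm]; exact h3⟩, h2⟩
    rwa [polarAtOne_norm_arg] at this

end SineGordon
end

noncomputable section
namespace SineGordon

/-! ### Uniformization of the double cover of the upper half-plane branched at `α` -/

/-- The branched cover of the upper half-plane by the unit disc, `κ² = (w - α)/(w - α*)`. -/
def discToHalfPlane (α κ : ℂ) : ℂ := (α - conj α * κ ^ 2) / (1 - κ ^ 2)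

lemma one_sub_sq_ne_zero {κ : ℂ} (hκ : ‖κ‖ < 1) : 1 - κ ^ 2 ≠ 0 := by
  intro h
  have h1 : κ ^ 2 = 1 := (sub_eq_zero.1 h).symm
  have := congrArg norm h1
  rw [norm_pow, norm_one] at this
  nlinarith [norm_nonneg κ]

lemma im_discToHalfPlane_pos {α κ : ℂ} (hα : 0 < α.im) (hκ : ‖κ‖ < 1) :
    0 < (discToHalfPlane α κ).im := by
  have hne := one_sub_sq_ne_zero hκ
  have hn : normSq (κ ^ 2) < 1 := by
    rw [normSq_eq_norm_sq, norm_pow]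
    have := norm_nonneg κ
    have h2 : ‖κ‖ ^ 2 < 1 := by nlinarith
    nlinarith [sq_nonneg ‖κ‖]
  have hpos : 0 < normSq (1 - κ ^ 2) := normSq_pos.2 hne
  unfold discToHalfPlane
  generalize κ ^ 2 = ζ at *
  have e : ((α - conj α * ζ) / (1 - ζ)).im = α.im * (1 - normSq ζ) / normSq (1 - ζ) := by
    rw [Complex.div_im]
    simp only [normSq_apply, sub_re, sub_im, mul_re, mul_im, conj_re, conj_im, one_re, one_im]
    ring
  rw [e]
  have : 0 < 1 - normSq ζ := by linarith
  positivity

lemma differentiableAt_discToHalfPlane {α κ : ℂ} (hκ : 1 - κ ^ 2 ≠ 0) :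
    DifferentiableAt ℂ (discToHalfPlane α) κ := by
  unfold discToHalfPlane
  fun_prop (disch := assumption)

lemma discToHalfPlane_of_sq {α κ w : ℂ} (hα : 0 < α.im) (hw : 0 < w.im)
    (h : κ ^ 2 = (w - α) / (w - conj α)) :
    discToHalfPlane α κ = w ∧ 1 - κ ^ 2 = (α - conj α) / (w - conj α) ∧ ‖κ‖ < 1 := by
  have h1 : w - conj α ≠ 0 := fun h => by
    have := congrArg Complex.im h
    simp at this
    linarith
  have h2 : α - conj α ≠ 0 := fun h => by
    have := congrArg Complex.im h
    simp at this
    linarith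
  have e1 : 1 - κ ^ 2 = (α - conj α) / (w - conj α) := by rw [h]; field_simp; ring
  refine ⟨?_, e1, ?_⟩
  · rw [discToHalfPlane, e1, h]
    field_simp
    ring
  · have h3 : ‖κ ^ 2‖ < 1 := by
      rw [h, norm_div, div_lt_one (norm_pos_iff.2 h1)]
      refine lt_of_pow_lt_pow_left₀ 2 (norm_nonneg _) ?_
      rw [← normSq_eq_norm_sq, ← normSq_eq_norm_sq, normSq_apply, normSq_apply]
      simp only [sub_re, sub_im, conj_re, conj_im]
      nlinarith [mul_pos hα hw]
    rw [norm_pow] at h3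
    exact (sq_lt_one_iff₀ (norm_nonneg _)).1 h3

/-- The chain rule for a primitive on the disc along a curve in the upper half-plane. -/
lemma hasDerivAt_primitive_comp {α : ℂ} (hα : 0 < α.im) {g F : ℂ → ℂ}
    (hF : ∀ κ ∈ Metric.ball (0 : ℂ) 1,
      HasDerivAt F (2 * g (discToHalfPlane α κ) / (1 - κ ^ 2)) κ)
    {γ r : ℝ → ℂ} {γ' : ℂ} {u : ℝ} (hγ : HasDerivAt γ γ' u) (him : 0 < (γ u).im)
    (hr : ContinuousAt r u) (hne : γ u ≠ α)
    (hsq : ∀ᶠ y in 𝓝 u, r y ^ 2 = (γ y - α) * (γ y - conj α)) :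
    HasDerivAt (fun y => F (r y / (γ y - conj α))) (g (γ u) / r u * γ') u := by
  have h1 : γ u - conj α ≠ 0 := fun h => by
    have := congrArg Complex.im h
    simp at this
    linarith
  have h2 : α - conj α ≠ 0 := fun h => by
    have := congrArg Complex.im h
    simp at this
    linarith
  have h3 : γ u - α ≠ 0 := sub_ne_zero.2 hne
  have hsqu := hsq.self_of_nhds
  have hr0 : r u ≠ 0 := fun h => by
    rw [h, zero_pow two_ne_zero] at hsqu
    exact mul_ne_zero h3 h1 hsqu.symm
  have hrd := hasDerivAt_of_sq hr hr0 hsq ((hγ.sub_const α).mul (hγ.sub_const (conj α)))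
  have hκ := hrd.fun_div (hγ.sub_const (conj α)) h1
  have hκsq : (r u / (γ u - conj α)) ^ 2 = (γ u - α) / (γ u - conj α) := by
    rw [div_pow, hsqu]; field_simp
  obtain ⟨e1, e2, e3⟩ := discToHalfPlane_of_sq hα him hκsq
  have hFd := hF (r u / (γ u - conj α)) (by simpa using e3)
  rw [e1, e2] at hFd
  refine (hFd.comp u hκ).congr_deriv ?_
  field_simp
  rw [hsqu]
  ring

/-- With `R = κ (w-α*)`, the form `g dw / R` pulls back to `2g dκ/(1-κ²)`. This has no singularity
at `κ = 0`: the cover removes the branch point, and a disc carries primitives. -/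
lemma exists_primitive_disc {α : ℂ} (hα : 0 < α.im) {g : ℂ → ℂ}
    (hg : DifferentiableOn ℂ g {w | 0 < w.im}) :
    ∃ F : ℂ → ℂ, F 0 = 0 ∧ ∀ κ ∈ Metric.ball (0 : ℂ) 1,
      HasDerivAt F (2 * g (discToHalfPlane α κ) / (1 - κ ^ 2)) κ := by
  have hd : DifferentiableOn ℂ (fun κ => 2 * g (discToHalfPlane α κ) / (1 - κ ^ 2))
      (Metric.ball 0 1) := by
    intro κ hκ
    have hκ' : ‖κ‖ < 1 := by simpa using hκ
    have hne := one_sub_sq_ne_zero hκ'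
    have hopen : IsOpen {w : ℂ | 0 < w.im} := isOpen_lt continuous_const Complex.continuous_im
    have h1 : DifferentiableAt ℂ g (discToHalfPlane α κ) :=
      hg.differentiableAt (hopen.mem_nhds (im_discToHalfPlane_pos hα hκ'))
    have h2 : DifferentiableAt ℂ (fun κ => g (discToHalfPlane α κ)) κ :=
      h1.comp κ (differentiableAt_discToHalfPlane hne)
    refine DifferentiableAt.differentiableWithinAt ?_
    exact (h2.const_mul 2).div (by fun_prop) hne
  exact hd.isExactOn_ball.with_val_at 0 0

/-- The map `κ ↦ -κ` exchanges the two sheets, that is, the two signs of `R`. This symmetry lets one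
boundary value determine the whole loop integral. -/
lemma primitive_odd {F f : ℂ → ℂ} (h0 : F 0 = 0) (hf : ∀ κ, f (-κ) = f κ)
    (hF : ∀ κ ∈ Metric.ball (0 : ℂ) 1, HasDerivAt F (f κ) κ) {κ : ℂ}
    (hκ : κ ∈ Metric.ball (0 : ℂ) 1) : F (-κ) = -F κ := by
  have hneg : ∀ κ ∈ Metric.ball (0 : ℂ) 1, -κ ∈ Metric.ball (0 : ℂ) 1 := fun κ h => by
    simpa using h
  have hd : ∀ κ ∈ Metric.ball (0 : ℂ) 1,
      HasDerivWithinAt (fun κ => F κ + F (-κ)) 0 (Metric.ball 0 1) κ := by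
    intro κ hκ
    have h1 := hF κ hκ
    have h2 := (hF (-κ) (hneg κ hκ)).comp κ (hasDerivAt_neg κ)
    refine ((h1.add h2).congr_deriv ?_).hasDerivWithinAt
    rw [hf]; ring
  have := (convex_ball (0 : ℂ) 1).norm_image_sub_le_of_norm_hasDerivWithin_le (C := 0) hd
    (fun _ _ => by simp) (Metric.mem_ball_self one_pos) hκ
  simp only [h0, neg_zero, add_zero, sub_zero, zero_mul, norm_le_zero_iff] at this
  linear_combination this

/-- A function on the disc with derivative bounded near a boundary point has a limit there. -/
lemma exists_tendsto_primitive {F f : ℂ → ℂ} {κ₁ : ℂ} (hκ₁ : ‖κ₁‖ = 1)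
    (hF : ∀ κ ∈ Metric.ball (0 : ℂ) 1, HasDerivAt F (f κ) κ) {C : ℝ}
    (hC : ∀ᶠ κ in 𝓝[Metric.ball 0 1] κ₁, ‖f κ‖ ≤ C) :
    ∃ L, Tendsto F (𝓝[Metric.ball 0 1] κ₁) (𝓝 L) := by
  obtain ⟨ε, hε, hsub⟩ := Metric.mem_nhdsWithin_iff.1 hC
  set S := Metric.ball κ₁ ε ∩ Metric.ball (0 : ℂ) 1 with hS
  have hconv : Convex ℝ S := (convex_ball _ _).inter (convex_ball _ _)
  have hlip : LipschitzOnWith C.toNNReal F S :=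
    hconv.lipschitzOnWith_of_nnnorm_hasDerivWithin_le
      (fun κ hκ => (hF κ hκ.2).hasDerivWithinAt)
      (fun κ hκ => by
        rw [← NNReal.coe_le_coe, coe_nnnorm, Real.coe_toNNReal']
        exact (hsub hκ).trans (le_max_left _ _))
  have hne : (𝓝[Metric.ball 0 1] κ₁).NeBot := by
    rw [← mem_closure_iff_nhdsWithin_neBot, closure_ball _ one_ne_zero]
    simp [hκ₁]
  have hle : 𝓝[Metric.ball 0 1] κ₁ ≤ 𝓟 S := by
    rw [le_principal_iff]
    exact inter_mem (mem_nhdsWithin_of_mem_nhds (Metric.ball_mem_nhds κ₁ hε)) self_mem_nhdsWithin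
  have hcau : Cauchy (𝓝[Metric.ball 0 1] κ₁) := (cauchy_nhds (a := κ₁)).mono nhdsWithin_le_nhds
  have := hcau.map_of_le hlip.uniformContinuousOn hle
  exact CompleteSpace.complete this

/-- The loop integral `∫ g/R` around the branch point `α` in terms of an integral along any curve
from `1` to `α` with a continuous choice of square root. -/
lemma loop_integral_eq {α : ℂ} (hα : 0 < α.im) {g : ℂ → ℂ}
    (hg : DifferentiableOn ℂ g {w | 0 < w.im}) (hg1 : ContinuousWithinAt g {w | 0 < w.im} 1)
    {Λ Λ' R η η' r : ℝ → ℂ}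
    (hΛ : ∀ u ∈ Ioo (0 : ℝ) 1, HasDerivAt Λ (Λ' u) u ∧ 0 < (Λ u).im ∧ Λ u ≠ α)
    (hR : ContinuousOn R (Ioo 0 1))
    (hRsq : ∀ u ∈ Ioo (0 : ℝ) 1, R u ^ 2 = (Λ u - α) * (Λ u - conj α))
    (hΛ0 : Tendsto Λ (𝓝[>] 0) (𝓝 1)) (hΛ1 : Tendsto Λ (𝓝[<] 1) (𝓝 1))
    (hR0 : Tendsto R (𝓝[>] 0) (𝓝 ((-‖1 - α‖ : ℝ) : ℂ)))
    (hR1 : Tendsto R (𝓝[<] 1) (𝓝 ((‖1 - α‖ : ℝ) : ℂ)))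
    (hη : ∀ u ∈ Ioo (0 : ℝ) 1, HasDerivAt η (η' u) u ∧ 0 < (η u).im ∧ η u ≠ α)
    (hr : ContinuousOn r (Ioo 0 1))
    (hrsq : ∀ u ∈ Ioo (0 : ℝ) 1, r u ^ 2 = (η u - α) * (η u - conj α))
    (hη0 : Tendsto η (𝓝[>] 0) (𝓝 1)) (hη1 : Tendsto η (𝓝[<] 1) (𝓝 α))
    (hr0 : Tendsto r (𝓝[>] 0) (𝓝 ((‖1 - α‖ : ℝ) : ℂ))) (hr1 : Tendsto r (𝓝[<] 1) (𝓝 0))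
    (hint : IntervalIntegrable (fun u => g (Λ u) / R u * Λ' u) volume 0 1)
    (hint' : IntervalIntegrable (fun u => g (η u) / r u * η' u) volume 0 1) :
    ∫ u in (0 : ℝ)..1, g (Λ u) / R u * Λ' u = -2 * ∫ u in (0 : ℝ)..1, g (η u) / r u * η' u := by
  obtain ⟨F, hF0, hF⟩ := exists_primitive_disc hα hg
  have hα1 : (1 : ℂ) - conj α ≠ 0 := fun h => by
    have := congrArg Complex.im h
    simp at this
    linarith
  have hα2 : α - conj α ≠ 0 := fun h => by
    have := congrArg Complex.im h
    simp at this
    linarith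
  -- This is the point over `w = 1` on the sheet where `R = |1-α|`; the point over `1` on the other
  -- sheet is `-κ₁`.
  set κ₁ : ℂ := ((‖1 - α‖ : ℝ) : ℂ) / (1 - conj α) with hκ₁
  have hconj : (1 : ℂ) - conj α = conj (1 - α) := by simp
  have hκn : ‖κ₁‖ = 1 := by
    rw [hκ₁, norm_div, hconj, Complex.norm_conj, norm_real, norm_norm, div_self]
    exact norm_ne_zero_iff.2 fun h => hα1 (by rw [hconj, h, map_zero])
  have hκsq : κ₁ ^ 2 = (1 - α) / (1 - conj α) := by
    rw [hκ₁, div_pow, ← Complex.mul_conj', ← hconj]; field_simp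
  have hne1 : 1 - κ₁ ^ 2 ≠ 0 := by
    rw [hκsq]
    have : 1 - (1 - α) / (1 - conj α) = (α - conj α) / (1 - conj α) := by field_simp; ring
    rw [this]
    exact div_ne_zero hα2 hα1
  have hd1 : discToHalfPlane α κ₁ = 1 := by
    rw [discToHalfPlane, div_eq_one_iff_eq hne1, hκsq]
    field_simp
    ring
  -- the limit of the primitive at the boundary point
  have hbd : ∃ C, ∀ᶠ κ in 𝓝[Metric.ball 0 1] κ₁,
      ‖2 * g (discToHalfPlane α κ) / (1 - κ ^ 2)‖ ≤ C := by
    have t1 : Tendsto (discToHalfPlane α) (𝓝[Metric.ball 0 1] κ₁) (𝓝[{w | 0 < w.im}] 1) := by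
      refine tendsto_nhdsWithin_iff.2 ⟨?_, ?_⟩
      · rw [← hd1]
        exact (differentiableAt_discToHalfPlane hne1).continuousAt.continuousWithinAt
      · filter_upwards [self_mem_nhdsWithin] with κ hκ
        exact im_discToHalfPlane_pos hα (by simpa using hκ)
    have t2 := hg1.tendsto.comp t1
    have t3 : Tendsto (fun κ : ℂ => 1 - κ ^ 2) (𝓝[Metric.ball 0 1] κ₁) (𝓝 (1 - κ₁ ^ 2)) := by
      have : Continuous fun κ : ℂ => 1 - κ ^ 2 := by fun_prop
      exact this.continuousAt.continuousWithinAt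
    have t4 := ((t2.const_mul 2).div t3 hne1).norm
    refine ⟨‖2 * g 1 / (1 - κ₁ ^ 2)‖ + 1,
      (t4.eventually (gt_mem_nhds (lt_add_one _))).mono fun κ hκ => ?_⟩
    exact hκ.le
  obtain ⟨C, hC⟩ := hbd
  obtain ⟨L, hL⟩ := exists_tendsto_primitive hκn hF hC
  have hmem : ∀ {γ ρ : ℝ → ℂ}, (∀ u ∈ Ioo (0 : ℝ) 1, 0 < (γ u).im) →
      (∀ u ∈ Ioo (0 : ℝ) 1, ρ u ^ 2 = (γ u - α) * (γ u - conj α)) →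
      ∀ u ∈ Ioo (0 : ℝ) 1, ρ u / (γ u - conj α) ∈ Metric.ball (0 : ℂ) 1 := by
    intro γ ρ him hsq u hu
    have h1 : γ u - conj α ≠ 0 := fun h => by
      have := congrArg Complex.im h
      have := him u hu
      simp at *
      linarith
    have := (discToHalfPlane_of_sq hα (him u hu) (κ := ρ u / (γ u - conj α))
      (by rw [div_pow, hsq u hu]; field_simp)).2.2
    simpa using this
  have ev0 : ∀ᶠ u : ℝ in 𝓝[>] 0, u ∈ Ioo (0 : ℝ) 1 := Ioo_mem_nhdsGT zero_lt_one
  have ev1 : ∀ᶠ u : ℝ in 𝓝[<] 1, u ∈ Ioo (0 : ℝ) 1 := Ioo_mem_nhdsLT zero_lt_one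
  have hderiv : ∀ {γ γ' ρ : ℝ → ℂ},
      (∀ u ∈ Ioo (0 : ℝ) 1, HasDerivAt γ (γ' u) u ∧ 0 < (γ u).im ∧ γ u ≠ α) →
      ContinuousOn ρ (Ioo 0 1) →
      (∀ u ∈ Ioo (0 : ℝ) 1, ρ u ^ 2 = (γ u - α) * (γ u - conj α)) →
      ∀ u ∈ Ioo (0 : ℝ) 1, HasDerivAt (fun y => F (ρ y / (γ y - conj α)))
        (g (γ u) / ρ u * γ' u) u := by
    intro γ γ' ρ h hρ hsq u hu
    exact hasDerivAt_primitive_comp hα hF (h u hu).1 (h u hu).2.1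
      (hρ.continuousAt (Ioo_mem_nhds hu.1 hu.2)) (h u hu).2.2
      (by filter_upwards [Ioo_mem_nhds hu.1 hu.2] with y hy using hsq y hy)
  have limL : ∀ {γ ρ : ℝ → ℂ} {l : Filter ℝ}, Tendsto γ l (𝓝 1) →
      Tendsto ρ l (𝓝 ((‖1 - α‖ : ℝ) : ℂ)) →
      (∀ᶠ u in l, ρ u / (γ u - conj α) ∈ Metric.ball (0 : ℂ) 1) →
      Tendsto (fun u => F (ρ u / (γ u - conj α))) l (𝓝 L) := by
    intro γ ρ l hγ hρ hm
    exact hL.comp (tendsto_nhdsWithin_iff.2 ⟨hρ.div (hγ.sub_const _) hα1, hm⟩)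
  have hΛm := hmem (fun u hu => (hΛ u hu).2.1) hRsq
  have hηm := hmem (fun u hu => (hη u hu).2.1) hrsq
  -- The lift of `Λ` starts at `-κ₁` and ends at `κ₁`, because `R` has opposite limits at the two
  -- ends; oddness gives the limit `-L` at the start.
  have I1 : ∫ u in (0 : ℝ)..1, g (Λ u) / R u * Λ' u = L - -L := by
    refine intervalIntegral.integral_eq_sub_of_hasDerivAt_of_tendsto zero_lt_one
      (hderiv hΛ hR hRsq) hint ?_ (limL hΛ1 hR1 (ev1.mono hΛm))
    have : Tendsto (fun u => F ((-R u) / (Λ u - conj α))) (𝓝[>] 0) (𝓝 L) := by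
      refine limL hΛ0 (by simpa using hR0.neg) (ev0.mono fun u hu => ?_)
      have := hΛm u hu
      rw [neg_div]
      simpa using this
    refine this.neg.congr' ?_
    filter_upwards [ev0] with u hu
    rw [neg_div, primitive_odd hF0 (fun κ => by simp [discToHalfPlane]) hF (hΛm u hu), neg_neg]
  -- The lift of `η` goes from `κ₁` to the branch point `κ = 0`, where the primitive vanishes.
  have I2 : ∫ u in (0 : ℝ)..1, g (η u) / r u * η' u = 0 - L := by
    refine intervalIntegral.integral_eq_sub_of_hasDerivAt_of_tendsto zero_lt_one
      (hderiv hη hr hrsq) hint' (limL hη0 hr0 (ev0.mono hηm)) ?_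
    have h1 : Tendsto (fun u => r u / (η u - conj α)) (𝓝[<] 1) (𝓝 0) := by
      have := hr1.div (hη1.sub_const (conj α)) hα2
      rw [zero_div] at this
      exact this
    have h2 := (hF 0 (Metric.mem_ball_self one_pos)).continuousAt.tendsto.comp h1
    rwa [hF0] at h2
  rw [I1, I2]
  ring

end SineGordon
end

noncomputable section
namespace SineGordon

/-! ### The square root `√(-w)` in the upper half-plane -/

/-- The continuation `-i√w` of `√(-w)` from the upper half-plane across the positive axis. -/
def sqrtNegUpper (w : ℂ) : ℂ := -I * w ^ (1 / 2 : ℂ)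

lemma slitPlane_of_im_pos {w : ℂ} (hw : 0 < w.im) : w ∈ slitPlane :=
  mem_slitPlane_iff.2 (Or.inr hw.ne')

lemma sqrtNeg_eq {w : ℂ} (hw : 0 < w.im) : sqrtNeg w = sqrtNegUpper w := by
  have h0 : w ≠ 0 := fun h => by simp [h] at hw
  have hlog : Complex.log (-w) = Complex.log w - Real.pi * I := by
    apply Complex.ext
    · simp [Complex.log_re]
    · simp [Complex.log_im, arg_neg_eq_arg_sub_pi_of_im_pos hw]
  rw [sqrtNeg, sqrtNegUpper, cpow_def_of_ne_zero (neg_ne_zero.2 h0), cpow_def_of_ne_zero h0, hlog]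
  have : (Complex.log w - Real.pi * I) * (1 / 2) = -(Real.pi / 2 * I) + Complex.log w * (1 / 2) := by
    ring
  rw [this, Complex.exp_add]
  congr 1
  rw [Complex.exp_neg, exp_pi_div_two_mul_I, inv_I]

lemma sqrtNegUpper_sq {w : ℂ} : sqrtNegUpper w ^ 2 = -w := by
  have h : (w ^ (1 / 2 : ℂ)) ^ 2 = w := by
    rw [one_div]
    exact_mod_cast cpow_nat_inv_pow w two_ne_zero
  rw [sqrtNegUpper, mul_pow, h]
  simp

lemma sqrtNegUpper_ne_zero {w : ℂ} (hw : w ≠ 0) : sqrtNegUpper w ≠ 0 := fun h => hw (by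
  have := sqrtNegUpper_sq (w := w)
  rw [h] at this
  simpa using this.symm)

lemma differentiableAt_sqrtNegUpper {w : ℂ} (hw : w ∈ slitPlane) :
    DifferentiableAt ℂ sqrtNegUpper w :=
  (differentiableAt_id.cpow_const hw).const_mul _

lemma sqrtNegUpper_mul_self {z : ℂ} (hz : 0 < z.re) : sqrtNegUpper (z ^ 2) = -I * z := by
  rw [sqrtNegUpper, one_div, sq_cpow_two_inv hz]

/-! ### Integrals over the loop `Λ` -/

lemma isAvoiding_of_inter {b : ℝ → ℝ → ℂ} {U : Set ℝ} (hs : ∀ h ∈ U, 0 < (b h 0).im)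
    {γ : ℝ → ℂ} (hγ : Continuous γ) (hup : ∀ u ∈ Ioo (0 : ℝ) 1, 0 < (γ u).im)
    (hint : ∀ h ∈ U, trace (b h) ∩ trace γ = {1}) : IsAvoiding b U γ where
  cont := hγ
  upper := hup
  off h hU u hu hmem := by
    have : γ u ∈ trace (b h) ∩ trace γ := ⟨hmem, u, Ioo_subset_Icc_self hu, rfl⟩
    rw [hint h hU, mem_singleton_iff] at this
    have := hup u hu
    simp_all
  ne_start h hU u hu heq := by
    have : γ u ∈ trace (b h) ∩ trace γ := ⟨⟨0, by simp, heq.symm⟩, u, hu, rfl⟩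
    rw [hint h hU, mem_singleton_iff, heq] at this
    have := hs h hU
    simp_all

/-- The closed upper half-plane near `1`: the open upper half-plane together with `1`. -/
def upperOne : Set ℂ := insert 1 {w | 0 < w.im}

lemma upperOne_slitPlane {w : ℂ} (hw : w ∈ upperOne) : w ∈ slitPlane := by
  rcases hw with rfl | hw
  · exact one_mem_slitPlane
  · exact slitPlane_of_im_pos hw

/-! ### Parametrization of the unit circle and loop integrals around a branch point on it -/

/-- The square root `e^{iη/2}` of the point of the unit circle with `sin(η/2) = k s`. -/
def circleRoot (k s : ℝ) : ℂ := (Real.sqrt (1 - k ^ 2 * s ^ 2) : ℂ) + I * (k * s : ℝ)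

/-- The weight `1/√((1-s²)(1-k²s²))`. -/
def ellipticWeight (m s : ℝ) : ℝ := 1 / Real.sqrt ((1 - s ^ 2) * (1 - m * s ^ 2))

lemma radicand_pos {k s : ℝ} (hk : k ∈ Ioo (0 : ℝ) 1) (hs : s ∈ Icc (0 : ℝ) 1) :
    0 < 1 - k ^ 2 * s ^ 2 := by
  have h1 : k ^ 2 < 1 := by nlinarith [hk.1, hk.2]
  have h2 : s ^ 2 ≤ 1 := by nlinarith [hs.1, hs.2]
  nlinarith [sq_nonneg k, sq_nonneg s]

lemma circleRoot_re (k s : ℝ) : (circleRoot k s).re = Real.sqrt (1 - k ^ 2 * s ^ 2) := by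
  simp [circleRoot, -ofReal_mul]

lemma circleRoot_im (k s : ℝ) : (circleRoot k s).im = k * s := by
  simp [circleRoot, -ofReal_mul]

lemma circleRoot_sq_re {k s : ℝ} (hk : k ∈ Ioo (0 : ℝ) 1) (hs : s ∈ Icc (0 : ℝ) 1) :
    (circleRoot k s ^ 2).re = 1 - 2 * k ^ 2 * s ^ 2 := by
  rw [sq, mul_re, circleRoot_re, circleRoot_im, Real.mul_self_sqrt (radicand_pos hk hs).le]
  ring

lemma circleRoot_mul_conj {k s : ℝ} (hk : k ∈ Ioo (0 : ℝ) 1) (hs : s ∈ Icc (0 : ℝ) 1) :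
    circleRoot k s * conj (circleRoot k s) = 1 := by
  rw [Complex.mul_conj, normSq_apply, circleRoot_re, circleRoot_im,
    Real.mul_self_sqrt (radicand_pos hk hs).le]
  push_cast; ring

lemma continuous_circleRoot (k : ℝ) : Continuous (circleRoot k) := by
  unfold circleRoot; fun_prop

lemma hasDerivAt_circleRoot {k s : ℝ} (hk : k ∈ Ioo (0 : ℝ) 1) (hs : s ∈ Icc (0 : ℝ) 1) :
    HasDerivAt (circleRoot k) (I * k * circleRoot k s / Real.sqrt (1 - k ^ 2 * s ^ 2)) s := by
  have hpos := radicand_pos hk hs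
  have h1 : HasDerivAt (fun s : ℝ => 1 - k ^ 2 * s ^ 2) (-(k ^ 2 * (2 * s))) s := by
    have := ((hasDerivAt_pow 2 s).const_mul (k ^ 2)).const_sub 1
    simpa using this
  have h2 := (h1.sqrt hpos.ne').ofReal_comp
  have h3 : HasDerivAt (fun s : ℝ => I * ((k * s : ℝ) : ℂ)) (I * (k * 1 : ℝ)) s :=
    (((hasDerivAt_id s).const_mul k).ofReal_comp).const_mul I
  refine (h2.add h3).congr_deriv ?_
  have hne : (Real.sqrt (1 - k ^ 2 * s ^ 2) : ℂ) ≠ 0 :=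
    ofReal_ne_zero.2 (Real.sqrt_pos.2 hpos).ne'
  rw [circleRoot]
  push_cast
  field_simp
  ring_nf
  simp only [I_sq]
  ring

/-- On the unit circle `(w-α)(w-α*) = w (w + w* - α - α*)`, and with `w = z²` the real parts `1 -
2k²s²` and `1 - 2k²` differ by `2k²(1-s²)`. This is the source of the factor `1 - s²` in the
elliptic radicand. -/
lemma one_sub_circle {k s : ℝ} (hk : k ∈ Ioo (0 : ℝ) 1) (hs : s ∈ Icc (0 : ℝ) 1) :
    (circleRoot k s ^ 2 - circleRoot k 1 ^ 2) * (circleRoot k s ^ 2 - conj (circleRoot k 1 ^ 2))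
      = 4 * k ^ 2 * (1 - s ^ 2) * circleRoot k s ^ 2 := by
  have h1 := circleRoot_mul_conj hk hs
  have h2 := circleRoot_mul_conj hk (show (1 : ℝ) ∈ Icc (0 : ℝ) 1 by simp)
  have e1 : circleRoot k s ^ 2 + conj (circleRoot k s) ^ 2 = 2 * (1 - 2 * k ^ 2 * s ^ 2 : ℝ) := by
    rw [← circleRoot_sq_re hk hs, ← map_pow, Complex.add_conj]; push_cast; ring
  have e2 : circleRoot k 1 ^ 2 + conj (circleRoot k 1) ^ 2 = 2 * (1 - 2 * k ^ 2 : ℝ) := by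
    have := circleRoot_sq_re hk (show (1 : ℝ) ∈ Icc (0 : ℝ) 1 by simp)
    rw [one_pow, mul_one] at this
    rw [← this, ← map_pow, Complex.add_conj]; push_cast; ring
  rw [map_pow]
  push_cast at e1 e2
  set z := circleRoot k s
  set z' := conj z
  set a := circleRoot k 1
  set a' := conj a
  have e3 : (z ^ 2 - a ^ 2) * (z ^ 2 - a' ^ 2)
      = z ^ 2 * (z ^ 2 + z' ^ 2 - (a ^ 2 + a' ^ 2)) + ((a * a') ^ 2 - (z * z') ^ 2) := by ring
  rw [e3, h1, h2, e1, e2]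
  ring

lemma intervalIntegrable_congr_Ioo {f g : ℝ → ℂ} (h : ∀ u ∈ Ioo (0 : ℝ) 1, f u = g u)
    (hf : IntervalIntegrable f volume 0 1) : IntervalIntegrable g volume 0 1 := by
  rw [intervalIntegrable_iff] at hf ⊢
  refine hf.congr ?_
  rw [EventuallyEq, ae_restrict_iff' measurableSet_uIoc]
  filter_upwards [ae_mem_Ioo] with u hu hu' using h u (hu hu')

lemma intervalIntegrable_inv_sqrt : IntervalIntegrable (fun s : ℝ => s ^ (-(1 / 2) : ℝ)) volume 0 1 :=
  intervalIntegral.intervalIntegrable_rpow' (by norm_num)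

lemma intervalIntegrable_inv_sqrt_one_sub :
    IntervalIntegrable (fun s : ℝ => (1 - s) ^ (-(1 / 2) : ℝ)) volume 0 1 := by
  have := (intervalIntegrable_inv_sqrt.comp_sub_left 1).symm
  simpa using this

lemma intervalIntegrable_ellipticWeight {m : ℝ} (hm0 : 0 ≤ m) (hm : m < 1) :
    IntervalIntegrable (ellipticWeight m) volume 0 1 := by
  refine IntervalIntegrable.mono_fun' (intervalIntegrable_inv_sqrt_one_sub.const_mul
    ((1 - m) ^ (-(1 / 2) : ℝ))) ?_ ?_
  · have : Measurable (ellipticWeight m) := by unfold ellipticWeight; fun_prop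
    exact this.aestronglyMeasurable
  · rw [EventuallyLE, ae_restrict_iff' measurableSet_uIoc]
    filter_upwards [ae_mem_Ioo] with s hs hs'
    obtain ⟨h0, h1⟩ := hs hs'
    have hm' : 0 < 1 - m := by linarith
    have hs1 : 0 < 1 - s := by linarith
    have e1 : 1 - s ≤ 1 - s ^ 2 := by nlinarith
    have e2 : 1 - m ≤ 1 - m * s ^ 2 := by nlinarith [mul_nonneg hm0 (show 0 ≤ 1 - s ^ 2 by nlinarith)]
    have e3 : (1 - m) * (1 - s) ≤ (1 - s ^ 2) * (1 - m * s ^ 2) := by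
      rw [mul_comm]; exact mul_le_mul e1 e2 hm'.le (by linarith)
    rw [← Real.mul_rpow hm'.le hs1.le, Real.rpow_neg (by positivity), ← Real.sqrt_eq_rpow,
      ellipticWeight, one_div, Real.norm_eq_abs, abs_of_nonneg (by positivity)]
    exact inv_anti₀ (Real.sqrt_pos.2 (by positivity)) (Real.sqrt_le_sqrt e3)

lemma circleRoot_sq_mem {k s : ℝ} (hk : k ∈ Ioo (0 : ℝ) 1) (hs : s ∈ Ioc (0 : ℝ) 1) :
    0 < (circleRoot k s ^ 2).im := by
  rw [sq, mul_im, circleRoot_re, circleRoot_im]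
  have h1 := Real.sqrt_pos.2 (radicand_pos hk ⟨hs.1.le, hs.2⟩)
  have h2 := mul_pos hk.1 hs.1
  positivity

lemma circleRoot_zero (k : ℝ) : circleRoot k 0 = 1 := by simp [circleRoot]

lemma circleRoot_ne_zero {k s : ℝ} (hk : k ∈ Ioo (0 : ℝ) 1) (hs : s ∈ Icc (0 : ℝ) 1) :
    circleRoot k s ≠ 0 := fun h => by
  have := circleRoot_mul_conj hk hs
  simp [h] at this

lemma norm_one_sub_circleRoot {k : ℝ} (hk : k ∈ Ioo (0 : ℝ) 1) :
    ‖1 - circleRoot k 1 ^ 2‖ = 2 * k := by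
  have h := one_sub_circle hk (show (0 : ℝ) ∈ Icc (0 : ℝ) 1 by simp)
  have e : (1 : ℂ) - conj (circleRoot k 1 ^ 2) = conj (1 - circleRoot k 1 ^ 2) := by simp
  rw [circleRoot_zero, one_pow, e, Complex.mul_conj'] at h
  have h2 : ‖1 - circleRoot k 1 ^ 2‖ ^ 2 = (2 * k) ^ 2 := by
    apply ofReal_injective
    push_cast
    rw [h]; push_cast; ring
  exact (sq_eq_sq₀ (norm_nonneg _) (by linarith [hk.1])).1 h2

/-- The data of a contour system used to evaluate loop integrals around `β`. -/
lemma IsContourSystem.isAvoiding_Λ {D : Set ℂ} {μ : ℝ} {ℓ Λ β : ℝ → ℂ}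
    (hC : IsContourSystem D μ ℓ Λ β) : IsAvoiding (fun _ => β) univ Λ :=
  isAvoiding_of_inter (fun _ _ => hC.start_β) hC.contDiff_Λ.continuous hC.upper_Λ
    (fun _ _ => hC.inter_β_Λ)

lemma IsContourSystem.arg_β {D : Set ℂ} {μ : ℝ} {ℓ Λ β : ℝ → ℂ}
    (hC : IsContourSystem D μ ℓ Λ β) : arg (-deriv β 1) ∈ Ioo 0 (Real.pi / 2) :=
  ⟨hC.tangent_ℓ.trans (hC.tangent_ℓ_Λ.trans hC.tangent_Λ_β),
    hC.tangent_β_Λ.trans hC.tangent_Λ⟩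

lemma slitPlane_of_arg {z : ℂ} (hz : arg z ∈ Ioo 0 (Real.pi / 2)) : z ∈ slitPlane := by
  rw [mem_slitPlane_iff_arg]
  refine ⟨fun h => ?_, fun h => ?_⟩
  · rw [h] at hz; linarith [hz.2, Real.pi_pos]
  · simp [h] at hz

/-- The signs come from the order of the tangents at `1`. The start of `Λ` lies in a sector between
`β` and the ray `w < 1`, where `R < 0` near `1`; its end lies between the ray `w > 1`, where `R >
0`, and `β`. -/
lemma IsContourSystem.tendsto_sqrtR {D : Set ℂ} {μ : ℝ} {ℓ Λ β : ℝ → ℂ}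
    (hC : IsContourSystem D μ ℓ Λ β) :
    Tendsto (fun u => sqrtR β (Λ u)) (𝓝[>] 0) (𝓝 ((-‖1 - β 0‖ : ℝ) : ℂ)) ∧
    Tendsto (fun u => sqrtR β (Λ u)) (𝓝[<] 1) (𝓝 ((‖1 - β 0‖ : ℝ) : ℂ)) := by
  have hd0 := (hC.contDiff_Λ.differentiable one_ne_zero 0).hasDerivAt
  have hd1 := (hC.contDiff_Λ.differentiable one_ne_zero 1).hasDerivAt
  have hβ := hC.arg_β
  have hav := hC.isAvoiding_Λ
  have ev0 : ∀ᶠ u : ℝ in 𝓝[>] 0, u ∈ Ioo (0 : ℝ) 1 := Ioo_mem_nhdsGT zero_lt_one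
  have ev1 : ∀ᶠ u : ℝ in 𝓝[<] 1, u ∈ Ioo (0 : ℝ) 1 := Ioo_mem_nhdsLT zero_lt_one
  have him : ∀ u ∈ Ioo (0 : ℝ) 1, 0 < (Λ u).im ∧ Λ u ∉ trace β := fun u hu =>
    ⟨hC.upper_Λ u hu, hav.off 0 (mem_univ _) u hu⟩
  have hne1 : ∀ u ∈ Ioo (0 : ℝ) 1, Λ u ≠ 1 := fun u hu h => by
    have := hC.upper_Λ u hu
    simp [h] at this
  have c0 : Tendsto Λ (𝓝[>] 0) (𝓝 1) := by
    have := hC.contDiff_Λ.continuous.tendsto 0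
    rw [hC.start_Λ] at this
    exact this.mono_left nhdsWithin_le_nhds
  have c1 : Tendsto Λ (𝓝[<] 1) (𝓝 1) := by
    have := hC.contDiff_Λ.continuous.tendsto 1
    rw [hC.finish_Λ] at this
    exact this.mono_left nhdsWithin_le_nhds
  have a1 : arg (-deriv Λ 1) ∈ Ioo 0 (Real.pi / 2) :=
    ⟨hC.tangent_ℓ.trans hC.tangent_ℓ_Λ, hC.tangent_Λ_β.trans hβ.2⟩
  have a0 : arg (deriv Λ 0) ∈ Ioo 0 (Real.pi / 2) := ⟨hβ.1.trans hC.tangent_β_Λ, hC.tangent_Λ⟩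
  have t0 := tendsto_arg_sub_left hd0 hC.start_Λ (slitPlane_of_arg a0)
  have t1 := tendsto_arg_sub_right hd1 hC.finish_Λ (slitPlane_of_arg a1)
  constructor
  · obtain ⟨σ, hσ1, hσ2⟩ := exists_between hC.tangent_β_Λ
    have := tendsto_sqrtR_of_sector hC.arc_β hC.start_β (slitPlane_of_arg hβ) (φ₁ := σ)
      (φ₂ := Real.pi) (by linarith [hβ.1]) le_rfl (fun h => by linarith [h.1]) (ε := -1)
      (Or.inr rfl) (φ₀ := Real.pi) ⟨by linarith [a0.2, Real.pi_pos], le_rfl⟩ (by simp) c0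
      (ev0.mono hne1) ?_ (ev0.mono him)
    · simpa using this
    · filter_upwards [t0.eventually (lt_mem_nhds hσ2)] with u hu
      exact ⟨hu.le, arg_le_pi _⟩
  · obtain ⟨σ, hσ1, hσ2⟩ := exists_between hC.tangent_Λ_β
    have := tendsto_sqrtR_of_sector hC.arc_β hC.start_β (slitPlane_of_arg hβ) (φ₁ := 0)
      (φ₂ := σ) le_rfl (by linarith [hβ.2, Real.pi_pos]) (fun h => by linarith [h.2]) (ε := 1)
      (Or.inl rfl) (φ₀ := 0) ⟨le_rfl, by linarith [a1.1]⟩ (by simp) c1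
      (ev1.mono hne1) ?_ (ev1.mono him)
    · simpa using this
    · filter_upwards [t1.eventually (gt_mem_nhds hσ1), t1.eventually (lt_mem_nhds a1.1)] with u hu hu'
      exact ⟨hu'.le, hu.le⟩

/-- Integrals `∫ g/R` over the loop `Λ`, when the branch point lies on the unit circle. -/
lemma cint_loop {D : Set ℂ} {μ : ℝ} {ℓ Λ β : ℝ → ℂ} (hC : IsContourSystem D μ ℓ Λ β) {k : ℝ}
    (hk : k ∈ Ioo (0 : ℝ) 1) (hβ0 : β 0 = circleRoot k 1 ^ 2) {g : ℂ → ℂ}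
    (hg : DifferentiableOn ℂ g {w | 0 < w.im}) (hgc : ContinuousOn g upperOne) :
    cint Λ (fun w => g w / sqrtR β w) = -2 * ∫ s in (0 : ℝ)..1,
      g (circleRoot k s ^ 2) * (I * circleRoot k s) * ellipticWeight (k ^ 2) s := by
  have hav := hC.isAvoiding_Λ
  have hfam := IsArcFamily.const hC.arc_β hC.start_β
  have hα : ∀ h ∈ (univ : Set ℝ), HasDerivAt (fun _ : ℝ => β 0) ((fun _ => (0 : ℂ)) h) h :=
    fun h _ => hasDerivAt_const h _
  have hcΛ := hC.contDiff_Λ.continuous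
  have hcΛ' : Continuous (deriv Λ) := hC.contDiff_Λ.continuous_deriv le_rfl
  have hΛmem : ∀ u ∈ Icc (0 : ℝ) 1, Λ u ∈ upperOne := by
    intro u hu
    rcases eq_or_lt_of_le hu.1 with h | h
    · left; rw [← h, hC.start_Λ]
    rcases eq_or_lt_of_le hu.2 with h' | h'
    · left; rw [h', hC.finish_Λ]
    · right; exact hC.upper_Λ u ⟨h, h'⟩
  have hgΛ : ContinuousOn (fun u => g (Λ u) * deriv Λ u) (Icc 0 1) :=
    (hgc.comp hcΛ.continuousOn hΛmem).mul hcΛ'.continuousOn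
  obtain ⟨C, hCb⟩ := isCompact_Icc.exists_bound_of_continuousOn hgΛ
  obtain ⟨K, hK0, hK⟩ := hav.exists_bound_div hfam hα (g := fun u => g (Λ u) * deriv Λ u) (C := C)
    (fun u hu => hCb u (Ioo_subset_Icc_self hu)) (mem_univ (0 : ℝ))
  have hRc := hav.continuousOn_sqrtR hfam (mem_univ (0 : ℝ))
  have hRne : ∀ u ∈ Ioo (0 : ℝ) 1, sqrtR β (Λ u) ≠ 0 := fun u hu =>
    hfam.sqrtR_ne_zero (mem_univ 0) (hC.upper_Λ u hu) (hav.off 0 (mem_univ _) u hu)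
  have hint : IntervalIntegrable (fun u => g (Λ u) / sqrtR β (Λ u) * deriv Λ u) volume 0 1 := by
    refine intervalIntegrable_of_bounded (C := K) (aestronglyMeasurable_of_continuousOn_Ioo ?_) ?_
    · exact (((hgc.comp hcΛ.continuousOn hΛmem).mono Ioo_subset_Icc_self).div hRc hRne).mul
        hcΛ'.continuousOn
    · intro u hu
      have := hK u hu
      rwa [mul_div_right_comm] at this
  set z := circleRoot k with hz
  have hmem : ∀ s ∈ Icc (0 : ℝ) 1, z s ^ 2 ∈ upperOne := by
    intro s hs
    rcases eq_or_lt_of_le hs.1 with h | h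
    · left; rw [← h, hz, circleRoot_zero, one_pow]
    · right; exact circleRoot_sq_mem hk ⟨h, hs.2⟩
  have hzc : Continuous z := continuous_circleRoot k
  have hsqrt : ∀ s ∈ Ioo (0 : ℝ) 1, 0 < Real.sqrt (1 - s ^ 2) := fun s hs =>
    Real.sqrt_pos.2 (by nlinarith [hs.1, hs.2])
  have hη : ∀ s ∈ Ioo (0 : ℝ) 1, HasDerivAt (fun s => z s ^ 2)
      (2 * z s * (I * k * z s / Real.sqrt (1 - k ^ 2 * s ^ 2))) s := fun s hs => by
    have := (hasDerivAt_circleRoot hk (Ioo_subset_Icc_self hs)).fun_pow 2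
    simpa using this
  -- Along `w = z²` the chosen root is `2k√(1-s²) z`, and `dw = 2z · ikz/√(1-k²s²) ds`. Their
  -- quotient is `iz` times the elliptic weight.
  have hcongr : ∀ s ∈ Ioo (0 : ℝ) 1, g (z s ^ 2) * (I * z s) * ellipticWeight (k ^ 2) s =
      g (z s ^ 2) / (2 * k * Real.sqrt (1 - s ^ 2) * z s) *
        (2 * z s * (I * k * z s / Real.sqrt (1 - k ^ 2 * s ^ 2))) := by
    intro s hs
    have h1 : (Real.sqrt (1 - s ^ 2) : ℂ) ≠ 0 := ofReal_ne_zero.2 (hsqrt s hs).ne'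
    have h2 : (Real.sqrt (1 - k ^ 2 * s ^ 2) : ℂ) ≠ 0 := ofReal_ne_zero.2
      (Real.sqrt_pos.2 (radicand_pos hk (Ioo_subset_Icc_self hs))).ne'
    have h3 : z s ≠ 0 := circleRoot_ne_zero hk (Ioo_subset_Icc_self hs)
    have h4 : (k : ℂ) ≠ 0 := ofReal_ne_zero.2 hk.1.ne'
    rw [ellipticWeight, Real.sqrt_mul (by nlinarith [hs.1, hs.2])]
    push_cast
    field_simp
  have hwI : IntervalIntegrable (fun s => g (z s ^ 2) * (I * z s) * (ellipticWeight (k ^ 2) s : ℂ))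
      volume 0 1 := by
    have h1 : IntervalIntegrable (fun s => (ellipticWeight (k ^ 2) s : ℂ)) volume 0 1 :=
      have := intervalIntegrable_ellipticWeight (sq_nonneg k) (show k ^ 2 < 1 by
        nlinarith [hk.1, hk.2])
      ⟨this.1.ofReal, this.2.ofReal⟩
    refine h1.continuousOn_mul ?_
    rw [uIcc_of_le zero_le_one]
    exact (hgc.comp (hzc.pow 2).continuousOn hmem).mul (by fun_prop)
  have hrsq : ∀ s ∈ Icc (0 : ℝ) 1, (2 * k * Real.sqrt (1 - s ^ 2) * z s : ℂ) ^ 2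
      = (z s ^ 2 - β 0) * (z s ^ 2 - conj (β 0)) := by
    intro s hs
    rw [hβ0, one_sub_circle hk hs, mul_pow, mul_pow, ← ofReal_pow (Real.sqrt _),
      Real.sq_sqrt (by nlinarith [hs.1, hs.2])]
    push_cast; ring
  have hrc : Continuous (fun s : ℝ => (2 * k * Real.sqrt (1 - s ^ 2) * z s : ℂ)) := by fun_prop
  have hηc : Continuous (fun s : ℝ => z s ^ 2) := by fun_prop
  obtain ⟨hR0, hR1⟩ := hC.tendsto_sqrtR
  have c0 : Tendsto Λ (𝓝[>] 0) (𝓝 1) := by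
    have := hcΛ.tendsto 0
    rw [hC.start_Λ] at this
    exact this.mono_left nhdsWithin_le_nhds
  have c1 : Tendsto Λ (𝓝[<] 1) (𝓝 1) := by
    have := hcΛ.tendsto 1
    rw [hC.finish_Λ] at this
    exact this.mono_left nhdsWithin_le_nhds
  have key := loop_integral_eq hC.start_β hg
    ((hgc 1 (mem_insert _ _)).mono (subset_insert _ _))
    (Λ := Λ) (Λ' := deriv Λ) (R := fun u => sqrtR β (Λ u)) (η := fun s => z s ^ 2)
    (η' := fun s => 2 * z s * (I * k * z s / Real.sqrt (1 - k ^ 2 * s ^ 2)))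
    (r := fun s => 2 * k * Real.sqrt (1 - s ^ 2) * z s)
    (fun u hu => ⟨(hC.contDiff_Λ.differentiable one_ne_zero u).hasDerivAt, hC.upper_Λ u hu,
      hav.ne_start 0 (mem_univ _) u (Ioo_subset_Icc_self hu)⟩)
    hRc (fun u hu => hfam.sqrtR_sq (mem_univ (0 : ℝ)) (hC.upper_Λ u hu)
      (hav.off 0 (mem_univ _) u hu)) c0 c1 hR0 hR1
    (fun s hs => ⟨hη s hs, circleRoot_sq_mem hk ⟨hs.1, hs.2.le⟩, fun h => by
      have h1 := hrsq s (Ioo_subset_Icc_self hs)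
      rw [h, sub_self, zero_mul] at h1
      have h3 : z s ≠ 0 := circleRoot_ne_zero hk (Ioo_subset_Icc_self hs)
      have h4 : (k : ℂ) ≠ 0 := ofReal_ne_zero.2 hk.1.ne'
      have h5 : (Real.sqrt (1 - s ^ 2) : ℂ) ≠ 0 := ofReal_ne_zero.2 (hsqrt s hs).ne'
      exact pow_ne_zero 2 (mul_ne_zero (mul_ne_zero (mul_ne_zero two_ne_zero h4) h5) h3) h1⟩)
    hrc.continuousOn (fun s hs => hrsq s (Ioo_subset_Icc_self hs)) ?_ ?_ ?_ ?_ hint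
    (intervalIntegrable_congr_Ioo hcongr hwI)
  · rw [cint, key]
    congr 1
    exact (integral_congr_Ioo hcongr).symm
  · have := hηc.tendsto 0
    simp only [hz, circleRoot_zero, one_pow] at this
    exact this.mono_left nhdsWithin_le_nhds
  · have := hηc.tendsto 1
    rw [← hz, ← hβ0] at *
    exact this.mono_left nhdsWithin_le_nhds
  · have := hrc.tendsto 0
    rw [hβ0, hz, norm_one_sub_circleRoot hk]
    simp only [hz, circleRoot_zero] at this
    norm_num at this
    push_cast
    exact this.mono_left nhdsWithin_le_nhds
  · have := hrc.tendsto 1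
    norm_num at this
    exact this.mono_left nhdsWithin_le_nhds

end SineGordon
end

noncomputable section
namespace SineGordon

/-! ### Evaluation in terms of complete elliptic integrals -/

/-- The integral `∫₀¹ s² ds / √((1-s²)(1-ms²))`. -/
def ellipticS (m : ℝ) : ℝ := ∫ s in (0 : ℝ)..1, s ^ 2 * ellipticWeight m s

lemma ellipticWeight_pos {k s : ℝ} (hk : k ∈ Ioo (0 : ℝ) 1) (hs : s ∈ Ioo (0 : ℝ) 1) :
    0 < ellipticWeight (k ^ 2) s := by
  have h1 := radicand_pos hk (Ioo_subset_Icc_self hs)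
  have h2 : 0 < 1 - s ^ 2 := by nlinarith [hs.1, hs.2]
  unfold ellipticWeight
  positivity

lemma intervalIntegrable_mul_weight {k : ℝ} (hk : k ∈ Ioo (0 : ℝ) 1) {f : ℝ → ℝ}
    (hf : Continuous f) : IntervalIntegrable (fun s => f s * ellipticWeight (k ^ 2) s) volume 0 1 :=
  (intervalIntegrable_ellipticWeight (sq_nonneg k)
    (by nlinarith [hk.1, hk.2])).continuousOn_mul hf.continuousOn

lemma ellipticK_eq (m : ℝ) : ellipticK m = ∫ s in (0 : ℝ)..1, ellipticWeight m s := rfl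

lemma integral_quadratic_mul_weight {k : ℝ} (hk : k ∈ Ioo (0 : ℝ) 1) (a b : ℝ) :
    ∫ s in (0 : ℝ)..1, (a + b * s ^ 2) * ellipticWeight (k ^ 2) s
      = a * ellipticK (k ^ 2) + b * ellipticS (k ^ 2) := by
  have h1 := intervalIntegrable_ellipticWeight (sq_nonneg k)
    (show k ^ 2 < 1 by nlinarith [hk.1, hk.2])
  have h2 := intervalIntegrable_mul_weight hk (f := fun s => s ^ 2) (by fun_prop)
  rw [ellipticK_eq, ellipticS, ← intervalIntegral.integral_const_mul,
    ← intervalIntegral.integral_const_mul,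
    ← intervalIntegral.integral_add (h1.const_mul a) (h2.const_mul b)]
  congr 1
  funext s
  ring

lemma ellipticE_eq {k : ℝ} (hk : k ∈ Ioo (0 : ℝ) 1) :
    ellipticE (k ^ 2) = ellipticK (k ^ 2) - k ^ 2 * ellipticS (k ^ 2) := by
  have h := integral_quadratic_mul_weight hk 1 (-k ^ 2)
  rw [one_mul, neg_mul, ← sub_eq_add_neg] at h
  rw [← h, ellipticE]
  apply intervalIntegral.integral_congr_ae
  filter_upwards [ae_mem_Ioo] with s hs hs'
  have hs := hs hs'
  have h1 := radicand_pos hk (Ioo_subset_Icc_self hs)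
  have h2 : 0 < 1 - s ^ 2 := by nlinarith [hs.1, hs.2]
  rw [ellipticWeight, Real.sqrt_mul h2.le, Real.sqrt_div h1.le]
  have h3 := Real.sqrt_pos.2 h1
  have h4 := Real.sqrt_pos.2 h2
  field_simp
  rw [Real.sq_sqrt h1.le]
  ring

lemma ellipticK_pos {k : ℝ} (hk : k ∈ Ioo (0 : ℝ) 1) : 0 < ellipticK (k ^ 2) := by
  rw [ellipticK_eq]
  exact intervalIntegral.intervalIntegral_pos_of_pos_on
    (intervalIntegrable_ellipticWeight (sq_nonneg k) (by nlinarith [hk.1, hk.2]))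
    (fun s hs => ellipticWeight_pos hk hs) zero_lt_one

lemma ellipticS_lt_ellipticK {k : ℝ} (hk : k ∈ Ioo (0 : ℝ) 1) :
    ellipticS (k ^ 2) < ellipticK (k ^ 2) := by
  have h := integral_quadratic_mul_weight hk 1 (-1)
  have hpos : 0 < ∫ s in (0 : ℝ)..1, (1 + -1 * s ^ 2) * ellipticWeight (k ^ 2) s :=
    intervalIntegral.intervalIntegral_pos_of_pos_on
      (intervalIntegrable_mul_weight hk (by fun_prop))
      (fun s hs => mul_pos (by nlinarith [hs.1, hs.2]) (ellipticWeight_pos hk hs)) zero_lt_one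
  rw [h] at hpos
  linarith

/-- Substituting `E = K - k²S` and `1 - k² = k'²` collapses the difference defining `ρ` to one term
proportional to `K - S`. Positivity becomes visible, and this is the form produced by the loop
integrals. -/
lemma rho_eq {k k' : ℝ} (hk : k ∈ Ioo (0 : ℝ) 1) (hk' : 0 < k') (h : k ^ 2 + k' ^ 2 = 1) :
    rho (k ^ 2) = k * (ellipticK (k ^ 2) - ellipticS (k ^ 2)) / (k' * ellipticK (k ^ 2)) := by
  have h1 : 1 - k ^ 2 = k' ^ 2 := by linarith
  have hk0 := hk.1
  have hK := ellipticK_pos hk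
  rw [rho, ellipticE_eq hk, h1, Real.sqrt_div' _ (sq_nonneg k), Real.sqrt_sq hk'.le,
    Real.sqrt_sq hk0.le, ← mul_pow, Real.sqrt_sq (by positivity)]
  field_simp
  linear_combination (-ellipticK (k ^ 2)) * h

lemma integral_ofReal_weight {k : ℝ} {f : ℝ → ℂ} {h : ℝ → ℝ} 
    (hfh : ∀ s ∈ Ioo (0 : ℝ) 1, f s = (h s : ℝ)) :
    ∫ s in (0 : ℝ)..1, f s * (ellipticWeight (k ^ 2) s : ℂ)
      = ((∫ s in (0 : ℝ)..1, h s * ellipticWeight (k ^ 2) s : ℝ) : ℂ) := by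
  rw [← intervalIntegral.integral_ofReal]
  refine integral_congr_Ioo fun s hs => ?_
  rw [hfh s hs]; push_cast; ring

lemma sqrtNegUpper_circle {k s : ℝ} (hk : k ∈ Ioo (0 : ℝ) 1) (hs : s ∈ Icc (0 : ℝ) 1) :
    sqrtNegUpper (circleRoot k s ^ 2) = -I * circleRoot k s :=
  sqrtNegUpper_mul_self (by
    rw [circleRoot_re]; exact Real.sqrt_pos.2 (radicand_pos hk hs))

lemma differentiableOn_sqrtNegUpper : DifferentiableOn ℂ sqrtNegUpper {w | 0 < w.im} := fun _ hw =>
  (differentiableAt_sqrtNegUpper (slitPlane_of_im_pos hw)).differentiableWithinAt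

lemma continuousOn_sqrtNegUpper : ContinuousOn sqrtNegUpper upperOne := fun _ hw =>
  (differentiableAt_sqrtNegUpper (upperOne_slitPlane hw)).continuousAt.continuousWithinAt

lemma sqrtNegUpper_ne_zero_of_mem {w : ℂ} (hw : w ∈ upperOne) : sqrtNegUpper w ≠ 0 :=
  sqrtNegUpper_ne_zero (slitPlane_ne_zero (upperOne_slitPlane hw))

section Loop

variable {D : Set ℂ} {μ : ℝ} {ℓ Λ β : ℝ → ℂ} {k : ℝ}

lemma IsContourSystem.cint_congr (hC : IsContourSystem D μ ℓ Λ β) {f g : ℂ → ℂ}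
    (hfg : ∀ w, 0 < w.im → w ∉ trace β → f w = g w) : cint Λ f = cint Λ g :=
  integral_congr_Ioo fun u hu => by
    rw [hfg _ (hC.upper_Λ u hu) (hC.isAvoiding_Λ.off 0 (mem_univ _) u hu)]

/-- On the circle `√(-w) = -iz`, so `iz/√(-w) = -1` and only the elliptic weight remains under the
integral. -/
lemma IsContourSystem.coefB_eq (hC : IsContourSystem D μ ℓ Λ β)
    (hk : k ∈ Ioo (0 : ℝ) 1) (hβ0 : β 0 = circleRoot k 1 ^ 2) :
    coefB Λ β = 2 * ellipticK (k ^ 2) := by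
  have h1 := cint_loop hC hk hβ0 (g := fun w => 1 / sqrtNegUpper w)
    ((differentiableOn_const _).div differentiableOn_sqrtNegUpper
      fun w hw => sqrtNegUpper_ne_zero_of_mem (Or.inr hw))
    (continuousOn_const.div continuousOn_sqrtNegUpper fun w hw => sqrtNegUpper_ne_zero_of_mem hw)
  have h2 : cint Λ (fun w => 1 / (sqrtR β w * sqrtNeg w))
      = cint Λ (fun w => 1 / sqrtNegUpper w / sqrtR β w) :=
    hC.cint_congr fun w hw _ => by rw [sqrtNeg_eq hw, div_div, mul_comm]
  rw [coefB, h2, h1, integral_ofReal_weight (h := fun _ => -1)]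
  · have := integral_quadratic_mul_weight hk (-1) 0
    simp only [zero_mul, add_zero] at this
    rw [this, neg_mul, neg_re, ← ofReal_ofNat, ← ofReal_mul, ofReal_re]
    ring
  · intro s hs
    have hz := circleRoot_ne_zero hk (Ioo_subset_Icc_self hs)
    rw [sqrtNegUpper_circle hk (Ioo_subset_Icc_self hs)]
    push_cast
    field_simp

/-- Writing `R = R²/R` brings the integrand to the form `g/R`; on the circle `R² = 4k²(1-s²)w`,
which produces `K - S`. -/
lemma IsContourSystem.loop_R_eq (hC : IsContourSystem D μ ℓ Λ β)
    (hk : k ∈ Ioo (0 : ℝ) 1) (hβ0 : β 0 = circleRoot k 1 ^ 2) :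
    (cint Λ (fun w => sqrtR β w / (w * sqrtNeg w))).re
      = 8 * k ^ 2 * (ellipticK (k ^ 2) - ellipticS (k ^ 2)) := by
  have hne : ∀ w ∈ upperOne, w * sqrtNegUpper w ≠ 0 := fun w hw =>
    mul_ne_zero (slitPlane_ne_zero (upperOne_slitPlane hw)) (sqrtNegUpper_ne_zero_of_mem hw)
  have h1 := cint_loop hC hk hβ0
    (g := fun w => (w - β 0) * (w - conj (β 0)) / (w * sqrtNegUpper w))
    (DifferentiableOn.div (by fun_prop) (differentiableOn_id.mul differentiableOn_sqrtNegUpper)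
      fun w hw => hne w (Or.inr hw))
    (ContinuousOn.div (by fun_prop) (continuousOn_id.mul continuousOn_sqrtNegUpper) hne)
  have hfam := IsArcFamily.const hC.arc_β hC.start_β
  have h2 : cint Λ (fun w => sqrtR β w / (w * sqrtNeg w))
      = cint Λ (fun w => (w - β 0) * (w - conj (β 0)) / (w * sqrtNegUpper w) / sqrtR β w) :=
    hC.cint_congr fun w hw hwb => by
      have e1 := hfam.sqrtR_sq (mem_univ (0 : ℝ)) hw hwb
      have e2 := hfam.sqrtR_ne_zero (mem_univ (0 : ℝ)) hw hwb
      rw [sqrtNeg_eq hw, ← e1]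
      field_simp
  rw [h2, h1, integral_ofReal_weight (h := fun s => -(4 * k ^ 2) + 4 * k ^ 2 * s ^ 2)]
  · rw [integral_quadratic_mul_weight hk, neg_mul, neg_re, ← ofReal_ofNat, ← ofReal_mul, ofReal_re]
    ring
  · intro s hs
    have hz := circleRoot_ne_zero hk (Ioo_subset_Icc_self hs)
    rw [sqrtNegUpper_circle hk (Ioo_subset_Icc_self hs), hβ0,
      one_sub_circle hk (Ioo_subset_Icc_self hs)]
    push_cast
    field_simp
    ring

/-- Here `√(-w) · iz = z²` is not real. The reflected half of the loop leaves its real part `1 -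
2k²s²`. -/
lemma IsContourSystem.coefA_eq (hC : IsContourSystem D μ ℓ Λ β)
    (hk : k ∈ Ioo (0 : ℝ) 1) (hβ0 : β 0 = circleRoot k 1 ^ 2) :
    coefA Λ β = -2 * ellipticK (k ^ 2) + 4 * k ^ 2 * ellipticS (k ^ 2) := by
  have h1 := cint_loop hC hk hβ0 (g := sqrtNegUpper)
    differentiableOn_sqrtNegUpper continuousOn_sqrtNegUpper
  have h2 : cint Λ (fun w => sqrtNeg w / sqrtR β w) = cint Λ (fun w => sqrtNegUpper w / sqrtR β w) :=
    hC.cint_congr fun w hw _ => by rw [sqrtNeg_eq hw]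
  have h3 : (∫ s in (0 : ℝ)..1, sqrtNegUpper (circleRoot k s ^ 2) * (I * circleRoot k s)
      * (ellipticWeight (k ^ 2) s : ℂ)).re
      = ∫ s in (0 : ℝ)..1, (1 + -2 * k ^ 2 * s ^ 2) * ellipticWeight (k ^ 2) s := by
    have hint : IntervalIntegrable (fun s => circleRoot k s ^ 2 * (ellipticWeight (k ^ 2) s : ℂ))
        volume 0 1 := by
      have h1 : IntervalIntegrable (fun s => (ellipticWeight (k ^ 2) s : ℂ)) volume 0 1 :=
        have := intervalIntegrable_ellipticWeight (sq_nonneg k) (show k ^ 2 < 1 by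
          nlinarith [hk.1, hk.2])
        ⟨this.1.ofReal, this.2.ofReal⟩
      exact h1.continuousOn_mul ((continuous_circleRoot k).pow 2).continuousOn
    have e : ∫ s in (0 : ℝ)..1, sqrtNegUpper (circleRoot k s ^ 2) * (I * circleRoot k s)
        * (ellipticWeight (k ^ 2) s : ℂ)
        = ∫ s in (0 : ℝ)..1, circleRoot k s ^ 2 * (ellipticWeight (k ^ 2) s : ℂ) :=
      integral_congr_Ioo fun s hs => by
        rw [sqrtNegUpper_circle hk (Ioo_subset_Icc_self hs)]
        ring_nf
        simp only [I_sq]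
        ring
    rw [e]
    have := (reCLM.intervalIntegral_comp_comm hint)
    simp only [reCLM_apply] at this
    rw [← this]
    apply intervalIntegral.integral_congr_ae
    filter_upwards [ae_mem_Ioo] with s hs hs'
    rw [re_mul_ofReal, circleRoot_sq_re hk (Ioo_subset_Icc_self (hs hs'))]
    ring
  rw [coefA, h2, h1, neg_mul, neg_re, ← ofReal_ofNat, re_ofReal_mul, h3,
    integral_quadratic_mul_weight hk]
  ring

end Loop

end SineGordon
end

noncomputable section
namespace SineGordon

/-! ### The weight `θ₀'(ξ) √(-ξ)` on the contour `L` -/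

lemma hasDerivAt_sqrtNegUpper {w : ℂ} (hw : w ∈ slitPlane) :
    HasDerivAt sqrtNegUpper (-1 / (2 * sqrtNegUpper w)) w := by
  have hd := (differentiableAt_sqrtNegUpper hw).hasDerivAt
  have h1 := hd.fun_pow 2
  have h2 : HasDerivAt (fun w => sqrtNegUpper w ^ 2) (-1) w := by
    simp only [sqrtNegUpper_sq]; exact hasDerivAt_neg w
  have h3 := h1.unique h2
  have hne := sqrtNegUpper_ne_zero (slitPlane_ne_zero hw)
  have : deriv sqrtNegUpper w = -1 / (2 * sqrtNegUpper w) := by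
    rw [← h3]; field_simp; norm_num
  rwa [this] at hd

/-- The continuation of `E` across the positive axis. -/
def specEUpper (w : ℂ) : ℂ := I / 4 * (sqrtNegUpper w + 1 / sqrtNegUpper w)

lemma specE_eq {w : ℂ} (hw : 0 < w.im) : specE w = specEUpper w := by
  rw [specE, specEUpper, sqrtNeg_eq hw]

lemma specEUpper_one : specEUpper 1 = 0 := by
  simp [specEUpper, sqrtNegUpper]

lemma hasDerivAt_specEUpper {w : ℂ} (hw : w ∈ slitPlane) :
    HasDerivAt specEUpper (-(I / 8) * (1 + 1 / w) / sqrtNegUpper w) w := by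
  have h0 := slitPlane_ne_zero hw
  have hne := sqrtNegUpper_ne_zero h0
  have h1 := hasDerivAt_sqrtNegUpper hw
  have h2 := (h1.add ((hasDerivAt_const w (1 : ℂ)).fun_div h1 hne)).const_mul (I / 4)
  refine h2.congr_deriv ?_
  have hsq := sqrtNegUpper_sq (w := w)
  have hw' : w = -sqrtNegUpper w ^ 2 := by rw [hsq, neg_neg]
  generalize sqrtNegUpper w = v at *
  subst hw'
  field_simp
  ring

/-- The factor `√(-w)` cancels the inverse square root in `E'`. What remains extends continuously to
`w = 1`, where `E = 0` lies in `D`; this bounds the weight on `P_∞` and `ℓ` up to their end. -/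
lemma deriv_theta0_mul {Ψ : ℂ → ℂ} {D : Set ℂ} (hΨ : AnalyticOnNhd ℂ Ψ D) {w : ℂ}
    (hw : 0 < w.im) (hwD : specE w ∈ D) :
    deriv (theta0 Ψ) w * sqrtNeg w = -(I / 8) * (1 + 1 / w) * deriv Ψ (specEUpper w) := by
  have hs := slitPlane_of_im_pos hw
  have hne := sqrtNegUpper_ne_zero (slitPlane_ne_zero hs)
  rw [specE_eq hw] at hwD
  have hopen : IsOpen {w : ℂ | 0 < w.im} := isOpen_lt continuous_const Complex.continuous_im
  have hev : theta0 Ψ =ᶠ[𝓝 w] fun w => Ψ (specEUpper w) := by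
    filter_upwards [hopen.mem_nhds hw] with y hy
    rw [theta0, specE_eq hy]
  have hd := (hΨ _ hwD).differentiableAt.hasDerivAt.comp w (hasDerivAt_specEUpper hs)
  rw [hev.deriv_eq, show deriv (fun w => Ψ (specEUpper w)) w = _ from hd.deriv, sqrtNeg_eq hw]
  field_simp

/-- The weight `θ₀'(ξ) √(-ξ) dξ` along a curve. -/
def phaseWeight (Ψ : ℂ → ℂ) (γ : ℝ → ℂ) (u : ℝ) : ℂ :=
  deriv (theta0 Ψ) (γ u) * sqrtNeg (γ u) * deriv γ u

lemma phaseWeight_bounded {Ψ : ℂ → ℂ} {D : Set ℂ} (h0 : (0 : ℂ) ∈ D)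
    (hΨ : AnalyticOnNhd ℂ Ψ D) {γ : ℝ → ℂ} (hγ : ContDiff ℝ 1 γ)
    (hup : ∀ u ∈ Ico (0 : ℝ) 1, 0 < (γ u).im) (h1 : γ 1 = 1)
    (hγD : ∀ u ∈ Ico (0 : ℝ) 1, specE (γ u) ∈ D) :
    AEStronglyMeasurable (phaseWeight Ψ γ) (volume.restrict (uIoc (0 : ℝ) 1)) ∧
    ∃ C, ∀ u ∈ Ioo (0 : ℝ) 1, ‖phaseWeight Ψ γ u‖ ≤ C := by
  set f : ℝ → ℂ := fun u =>
    -(I / 8) * (1 + 1 / γ u) * deriv Ψ (specEUpper (γ u)) * deriv γ u with hf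
  have hslit : ∀ u ∈ Icc (0 : ℝ) 1, γ u ∈ slitPlane ∧ specEUpper (γ u) ∈ D := by
    intro u hu
    rcases eq_or_lt_of_le hu.2 with h | h
    · rw [h, h1, specEUpper_one]; exact ⟨one_mem_slitPlane, h0⟩
    · rw [← specE_eq (hup u ⟨hu.1, h⟩)]
      exact ⟨slitPlane_of_im_pos (hup u ⟨hu.1, h⟩), hγD u ⟨hu.1, h⟩⟩
  have hfc : ContinuousOn f (Icc 0 1) := by
    intro u hu
    obtain ⟨hs, hE⟩ := hslit u hu
    have c1 : ContinuousAt γ u := hγ.continuous.continuousAt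
    have c2 : ContinuousAt (fun u => deriv Ψ (specEUpper (γ u))) u :=
      ContinuousAt.comp (f := fun u => specEUpper (γ u)) (hΨ.deriv _ hE).continuousAt
        (ContinuousAt.comp (f := γ) (hasDerivAt_specEUpper hs).continuousAt c1)
    have c3 : ContinuousAt (deriv γ) u := (hγ.continuous_deriv le_rfl).continuousAt
    exact (((continuousAt_const.mul (continuousAt_const.add (continuousAt_const.div c1
      (slitPlane_ne_zero hs)))).mul c2).mul c3).continuousWithinAt
  have heq : ∀ u ∈ Ioo (0 : ℝ) 1, phaseWeight Ψ γ u = f u := fun u hu => by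
    rw [phaseWeight, deriv_theta0_mul hΨ (hup u ⟨hu.1.le, hu.2⟩) (hγD u ⟨hu.1.le, hu.2⟩)]
  obtain ⟨C, hC⟩ := isCompact_Icc.exists_bound_of_continuousOn hfc
  exact ⟨aestronglyMeasurable_of_continuousOn_Ioo ((hfc.mono Ioo_subset_Icc_self).congr heq),
    C, fun u hu => by rw [heq u hu]; exact hC u (Ioo_subset_Icc_self hu)⟩

/-! ### Families of contour systems depending on one parameter -/

/-- A family of contour systems with fixed `ℓ`, `Λ`, whose arcs depend continuously (with their
tangents) and whose branch point depends smoothly on a real parameter. -/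
structure IsContourFamily (D : Set ℂ) (μ : ℝ) (ℓ Λ : ℝ → ℂ) (b : ℝ → ℝ → ℂ) (α' : ℝ → ℂ)
    (U : Set ℝ) : Prop where
  isOpen : IsOpen U
  contours : ∀ h ∈ U, IsContourSystem D μ ℓ Λ (b h)
  cont : ContinuousOn (fun y : ℝ × ℝ => deriv (b y.1) y.2) (U ×ˢ Icc 0 1)
  hasDerivAt : ∀ h ∈ U, HasDerivAt (fun h => b h 0) (α' h) h
  cont_deriv : ContinuousOn α' U

/-- Analyticity of the phase integral near the values of `E` on the contours. -/
structure IsPhaseData (Ψ : ℂ → ℂ) (D : Set ℂ) (μ : ℝ) : Prop where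
  zero_mem : (0 : ℂ) ∈ D
  analytic : AnalyticOnNhd ℂ Ψ D
  angle : μ ∈ Ioo 0 Real.pi

lemma contDiff_Pinf (μ : ℝ) : ContDiff ℝ 1 (Pinf μ) := by
  unfold Pinf
  have h1 : ContDiff ℝ 1 (fun u : ℝ => ((μ * (1 - u) : ℝ) : ℂ)) :=
    ofRealCLM.contDiff.comp (contDiff_const.mul (contDiff_const.sub contDiff_id))
  exact (contDiff_const.mul h1).cexp

lemma Pinf_one (μ : ℝ) : Pinf μ 1 = 1 := by simp [Pinf]

lemma Pinf_im_pos {μ : ℝ} (hμ : μ ∈ Ioo 0 Real.pi) {u : ℝ} (hu : u ∈ Ico (0 : ℝ) 1) :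
    0 < (Pinf μ u).im := by
  rw [Pinf, mul_comm, exp_ofReal_mul_I_im]
  have h1 : 0 < 1 - u := by linarith [hu.2]
  refine Real.sin_pos_of_pos_of_lt_pi (mul_pos hμ.1 h1) ?_
  nlinarith [hμ.1, hμ.2, hu.1]

variable {Ψ : ℂ → ℂ} {D : Set ℂ} {μ : ℝ} {ℓ Λ : ℝ → ℂ} {b : ℝ → ℝ → ℂ} {α' : ℝ → ℂ} {U : Set ℝ}

lemma IsContourFamily.toArcFamily (hF : IsContourFamily D μ ℓ Λ b α' U) : IsArcFamily b U where
  isOpen := hF.isOpen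
  arc h hU := (hF.contours h hU).arc_β
  start h hU := (hF.contours h hU).start_β
  cont := hF.cont

lemma IsContourSystem.ℓ_im_pos {β : ℝ → ℂ} (hC : IsContourSystem D μ ℓ Λ β)
    (hμ : μ ∈ Ioo 0 Real.pi) {u : ℝ} (hu : u ∈ Ico (0 : ℝ) 1) : 0 < (ℓ u).im := by
  rcases eq_or_lt_of_le hu.1 with h | h
  · rw [← h, hC.arc_ℓ.start, mul_comm, exp_ofReal_mul_I_im]
    exact Real.sin_pos_of_pos_of_lt_pi hμ.1 hμ.2
  · exact hC.arc_ℓ.upper u ⟨h, hu.2⟩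

lemma IsContourFamily.avoiding_ℓ (hF : IsContourFamily D μ ℓ Λ b α' U) (hne : U.Nonempty) :
    IsAvoiding b U ℓ := by
  obtain ⟨h₀, h₀U⟩ := hne
  exact isAvoiding_of_inter (fun h hU => (hF.contours h hU).start_β)
    (hF.contours h₀ h₀U).arc_ℓ.contDiff.continuous (hF.contours h₀ h₀U).arc_ℓ.upper
    (fun h hU => (hF.contours h hU).inter_β_ℓ)

lemma IsContourFamily.avoiding_P (hF : IsContourFamily D μ ℓ Λ b α' U) (hμ : μ ∈ Ioo 0 Real.pi) :
    IsAvoiding b U (Pinf μ) :=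
  isAvoiding_of_inter (fun h hU => (hF.contours h hU).start_β)
    (contDiff_Pinf μ).continuous (fun _ hu => Pinf_im_pos hμ ⟨hu.1.le, hu.2⟩)
    (fun h hU => (hF.contours h hU).inter_β_P)

lemma IsContourFamily.avoiding_Λ (hF : IsContourFamily D μ ℓ Λ b α' U) (hne : U.Nonempty) :
    IsAvoiding b U Λ := by
  obtain ⟨h₀, h₀U⟩ := hne
  exact isAvoiding_of_inter (fun h hU => (hF.contours h hU).start_β)
    (hF.contours h₀ h₀U).contDiff_Λ.continuous (hF.contours h₀ h₀U).upper_Λ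
    (fun h hU => (hF.contours h hU).inter_β_Λ)

lemma IsContourSystem.weight_ℓ {β : ℝ → ℂ} (hC : IsContourSystem D μ ℓ Λ β)
    (hΨ : IsPhaseData Ψ D μ) :
    AEStronglyMeasurable (phaseWeight Ψ ℓ) (volume.restrict (uIoc (0 : ℝ) 1)) ∧
    ∃ C, ∀ u ∈ Ioo (0 : ℝ) 1, ‖phaseWeight Ψ ℓ u‖ ≤ C :=
  phaseWeight_bounded hΨ.zero_mem hΨ.analytic hC.arc_ℓ.contDiff
    (fun _ hu => hC.ℓ_im_pos hΨ.angle hu) hC.arc_ℓ.finish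
    (fun u hu => hC.domain _ (hC.ℓ_im_pos hΨ.angle hu)
      (Or.inl ⟨u, Ico_subset_Icc_self hu, rfl⟩))

lemma IsContourSystem.weight_P {β : ℝ → ℂ} (hC : IsContourSystem D μ ℓ Λ β)
    (hΨ : IsPhaseData Ψ D μ) :
    AEStronglyMeasurable (phaseWeight Ψ (Pinf μ)) (volume.restrict (uIoc (0 : ℝ) 1)) ∧
    ∃ C, ∀ u ∈ Ioo (0 : ℝ) 1, ‖phaseWeight Ψ (Pinf μ) u‖ ≤ C :=
  phaseWeight_bounded hΨ.zero_mem hΨ.analytic (contDiff_Pinf μ)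
    (fun _ hu => Pinf_im_pos hΨ.angle hu) (Pinf_one μ)
    (fun u hu => hC.domain _ (Pinf_im_pos hΨ.angle hu)
      (Or.inr (Or.inl ⟨u, Ico_subset_Icc_self hu, rfl⟩)))

lemma cauchyL_eq (β : ℝ → ℂ) (w : ℂ) : cauchyL Ψ μ ℓ β w
    = arcCauchy (Pinf μ) (phaseWeight Ψ (Pinf μ)) β w + arcCauchy ℓ (phaseWeight Ψ ℓ) β w := by
  simp only [cauchyL, cintL, cint, arcCauchy, phaseWeight, div_mul_eq_mul_div]

/-- The Cauchy integral over the whole of `L`. -/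
def cauchyTotal (Ψ : ℂ → ℂ) (μ : ℝ) (ℓ β : ℝ → ℂ) (w : ℂ) : ℂ :=
  cauchyL Ψ μ ℓ β w + conj (cauchyL Ψ μ ℓ β (conj w))

/-- The value `-4 √(-α) H(α)`. -/
def startValue (Ψ : ℂ → ℂ) (μ : ℝ) (ℓ β : ℝ → ℂ) (x t : ℝ) : ℂ :=
  ((x - t : ℝ) : ℂ) / (β 0 * (‖β 0‖ : ℂ)) - 2 / Real.pi * cauchyTotal Ψ μ ℓ β (β 0)

lemma funH_eq (β : ℝ → ℂ) (x t : ℝ) (w : ℂ) : funH Ψ μ ℓ β x t w = -(1 / (4 * sqrtNeg w)) *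
    (((x - t : ℝ) : ℂ) / (w * (‖β 0‖ : ℂ)) - 2 / Real.pi * cauchyTotal Ψ μ ℓ β w) := rfl

lemma IsContourFamily.hasDerivAt_cauchyL (hF : IsContourFamily D μ ℓ Λ b α' U)
    (hΨ : IsPhaseData Ψ D μ) {h : ℝ} (hU : h ∈ U) {w : ℂ} (hwℓ : w ∉ trace ℓ)
    (hwP : w ∉ trace (Pinf μ)) (hw1 : w ≠ b h 0) (hw2 : w ≠ conj (b h 0)) :
    HasDerivAt (fun h => cauchyL Ψ μ ℓ (b h) w)
      (1 / 2 * (α' h / (w - b h 0) *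
          (cauchyL Ψ μ ℓ (b h) w - cauchyL Ψ μ ℓ (b h) (b h 0))
        + conj (α' h) / (w - conj (b h 0)) *
          (cauchyL Ψ μ ℓ (b h) w - cauchyL Ψ μ ℓ (b h) (conj (b h 0))))) h := by
  obtain ⟨m1, C1, hC1⟩ := (hF.contours h hU).weight_P hΨ
  obtain ⟨m2, C2, hC2⟩ := (hF.contours h hU).weight_ℓ hΨ
  have d1 := (hF.avoiding_P hΨ.angle).hasDerivAt_arcCauchy hF.toArcFamily hF.hasDerivAt
    hF.cont_deriv m1 hC1 hU hwP hw1 hw2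
  have d2 := (hF.avoiding_ℓ ⟨h, hU⟩).hasDerivAt_arcCauchy hF.toArcFamily hF.hasDerivAt
    hF.cont_deriv m2 hC2 hU hwℓ hw1 hw2
  simp only [cauchyL_eq]
  refine (d1.add d2).congr_deriv ?_
  ring

lemma IsContourFamily.hasDerivAt_cintL (hF : IsContourFamily D μ ℓ Λ b α' U)
    (hΨ : IsPhaseData Ψ D μ) {h : ℝ} (hU : h ∈ U) :
    HasDerivAt (fun h => cintL μ ℓ (fun ξ => deriv (theta0 Ψ) ξ * sqrtNeg ξ / sqrtR (b h) ξ))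
      (1 / 2 * (α' h * cauchyL Ψ μ ℓ (b h) (b h 0)
        + conj (α' h) * cauchyL Ψ μ ℓ (b h) (conj (b h 0)))) h := by
  obtain ⟨m1, C1, hC1⟩ := (hF.contours h hU).weight_P hΨ
  obtain ⟨m2, C2, hC2⟩ := (hF.contours h hU).weight_ℓ hΨ
  have d1 := (hF.avoiding_P hΨ.angle).hasDerivAt_integral_div hF.toArcFamily hF.hasDerivAt
    hF.cont_deriv m1 hC1 hU
  have d2 := (hF.avoiding_ℓ ⟨h, hU⟩).hasDerivAt_integral_div hF.toArcFamily hF.hasDerivAt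
    hF.cont_deriv m2 hC2 hU
  have e : (fun h => cintL μ ℓ (fun ξ => deriv (theta0 Ψ) ξ * sqrtNeg ξ / sqrtR (b h) ξ))
      = fun h => (∫ u in (0 : ℝ)..1, phaseWeight Ψ (Pinf μ) u / sqrtR (b h) (Pinf μ u))
        + ∫ u in (0 : ℝ)..1, phaseWeight Ψ ℓ u / sqrtR (b h) (ℓ u) := by
    funext h
    simp only [cintL, cint, phaseWeight, div_mul_eq_mul_div]
  rw [e]
  refine (d1.add d2).congr_deriv ?_
  simp only [cauchyL_eq]
  ring

lemma conj_notMem_of_im_pos {γ : ℝ → ℂ} (hγ : IsAvoiding b U γ) {w : ℂ} (hw : 0 < w.im) :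
    conj w ∉ trace γ := hγ.notMem_trace_of_im_neg (by simpa using hw)

lemma IsContourFamily.hasDerivAt_cauchyTotal (hF : IsContourFamily D μ ℓ Λ b α' U)
    (hΨ : IsPhaseData Ψ D μ) {h : ℝ} (hU : h ∈ U) {w : ℂ} (hw : 0 < w.im) (hwℓ : w ∉ trace ℓ)
    (hwP : w ∉ trace (Pinf μ)) (hw1 : w ≠ b h 0) :
    HasDerivAt (fun h => cauchyTotal Ψ μ ℓ (b h) w)
      (1 / 2 * (α' h / (w - b h 0) *
          (cauchyTotal Ψ μ ℓ (b h) w - cauchyTotal Ψ μ ℓ (b h) (b h 0))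
        + conj (α' h) / (w - conj (b h 0)) *
          (cauchyTotal Ψ μ ℓ (b h) w - conj (cauchyTotal Ψ μ ℓ (b h) (b h 0))))) h := by
  have hs := (hF.contours h hU).start_β
  have hw2 : w ≠ conj (b h 0) := sub_ne_zero.1 (sub_conj_start_ne_zero hs hw)
  have hw3 : conj w ≠ b h 0 := fun h => hw2 (by rw [← h, conj_conj])
  have hw4 : conj w ≠ conj (b h 0) := fun h => hw1 (by simpa using congrArg conj h)
  have d1 := hF.hasDerivAt_cauchyL hΨ hU hwℓ hwP hw1 hw2
  have d2 := hF.hasDerivAt_cauchyL hΨ hU (conj_notMem_of_im_pos (hF.avoiding_ℓ ⟨h, hU⟩) hw)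
    (conj_notMem_of_im_pos (hF.avoiding_P hΨ.angle) hw) hw3 hw4
  refine (d1.add d2.star).congr_deriv ?_
  simp only [cauchyTotal, star_def, map_mul, map_add, map_sub, map_div₀, conj_conj, map_one,
    map_ofNat]
  ring

/-- From `|a|² = a a*`, the logarithmic derivative of `|a|` is half of `a'/a` plus its conjugate.
This splitting matches the two poles `α` and `α*` of the other terms. -/
lemma hasDerivAt_inv_norm {a : ℝ → ℂ} {a' : ℂ} {h : ℝ} (ha : HasDerivAt a a' h) (h0 : a h ≠ 0) :
    HasDerivAt (fun h => 1 / (‖a h‖ : ℂ))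
      (-(1 / 2) * (a' / (a h * ‖a h‖) + conj a' / (conj (a h) * ‖a h‖))) h := by
  have hc : ContinuousAt (fun h => (‖a h‖ : ℂ)) h :=
    continuous_ofReal.continuousAt.comp ha.continuousAt.norm
  have hn : (‖a h‖ : ℂ) ≠ 0 := ofReal_ne_zero.2 (norm_ne_zero_iff.2 h0)
  have hp := ha.mul ha.star
  have hd := hasDerivAt_of_sq hc hn
    (Eventually.of_forall fun y => (Complex.mul_conj' (a y)).symm) hp
  refine ((hasDerivAt_const h (1 : ℂ)).fun_div hd hn).congr_deriv ?_
  have h0' : conj (a h) ≠ 0 := (map_ne_zero _).2 h0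
  have hsq : (‖a h‖ : ℂ) ^ 2 = a h * conj (a h) := (Complex.mul_conj' (a h)).symm
  simp only [star_def]
  rw [hsq]
  field_simp
  rw [hsq]
  ring

lemma IsContourSystem.start_ne_zero {β : ℝ → ℂ} (hC : IsContourSystem D μ ℓ Λ β) : β 0 ≠ 0 :=
  fun h => by have := hC.start_β; simp [h] at this

/-- The terms containing the Cauchy integral at `w` cancel between the derivatives of `R` and of
`H₀`. For the explicit term, `(1/w)(1/(w-α) + 1/α) = 1/(α(w-α))`. Both leftovers assemble into the
value of `-4√(-α) H₀(α)` over `w - α`, and conjugately at `α*`. -/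
lemma IsContourFamily.hasDerivAt_RH (hF : IsContourFamily D μ ℓ Λ b α' U)
    (hΨ : IsPhaseData Ψ D μ) {x t : ℝ → ℝ} {X' : ℝ} {h : ℝ} (hU : h ∈ U)
    (hX : HasDerivAt (fun h => x h - t h) X' h) {w : ℂ} (hw : 0 < w.im) (hwℓ : w ∉ trace ℓ)
    (hwP : w ∉ trace (Pinf μ)) (hwb : ∀ h ∈ U, w ∉ trace (b h)) :
    HasDerivAt (fun h => sqrtR (b h) w * funH Ψ μ ℓ (b h) (x h) (t h) w)
      (sqrtR (b h) w / sqrtNeg w * (-(1 / 4) * (X' / (w * ‖b h 0‖))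
        + 1 / 8 * (α' h * startValue Ψ μ ℓ (b h) (x h) (t h) / (w - b h 0)
          + conj (α' h * startValue Ψ μ ℓ (b h) (x h) (t h)) / (w - conj (b h 0))))) h := by
  have hs := (hF.contours h hU).start_β
  have h0 := (hF.contours h hU).start_ne_zero
  have h1 := sub_start_ne_zero (hwb h hU)
  have h2 := sub_conj_start_ne_zero hs hw
  have dR := hF.toArcFamily.hasDerivAt_sqrtR hF.hasDerivAt hU hw hwb
  have dT := hF.hasDerivAt_cauchyTotal hΨ hU hw hwℓ hwP (sub_ne_zero.1 h1)
  have dn := hasDerivAt_inv_norm (hF.hasDerivAt h hU) h0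
  have dX := hX.ofReal_comp
  have dH := (((dX.mul dn).mul_const (1 / w)).sub (dT.const_mul (2 / Real.pi : ℂ))).const_mul
    (-(1 / (4 * sqrtNeg w)))
  have e : (fun h => sqrtR (b h) w * funH Ψ μ ℓ (b h) (x h) (t h) w) = fun h =>
      sqrtR (b h) w * (-(1 / (4 * sqrtNeg w)) * (((x h - t h : ℝ) : ℂ) * (1 / (‖b h 0‖ : ℂ)) * (1 / w)
        - 2 / Real.pi * cauchyTotal Ψ μ ℓ (b h) w)) := by
    funext h
    rw [funH_eq]
    ring
  rw [e]
  refine (dR.mul dH).congr_deriv ?_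
  have hv : sqrtNeg w ≠ 0 := by
    rw [sqrtNeg_eq hw]
    exact sqrtNegUpper_ne_zero (slitPlane_ne_zero (slitPlane_of_im_pos hw))
  have hw0 : w ≠ 0 := slitPlane_ne_zero (slitPlane_of_im_pos hw)
  have hn : (‖b h 0‖ : ℂ) ≠ 0 := ofReal_ne_zero.2 (norm_ne_zero_iff.2 h0)
  have h0' : conj (b h 0) ≠ 0 := (map_ne_zero _).2 h0
  have hpi : (Real.pi : ℂ) ≠ 0 := ofReal_ne_zero.2 Real.pi_ne_zero
  simp only [startValue, map_mul, map_sub, map_div₀, conj_ofReal, map_ofNat, Pi.sub_apply,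
    Pi.mul_apply]
  generalize cauchyTotal Ψ μ ℓ (b h) (b h 0) = Ta
  generalize cauchyTotal Ψ μ ℓ (b h) w = T
  generalize conj Ta = Ta'
  generalize conj (b h 0) = a' at *
  generalize b h 0 = a at *
  generalize conj (α' h) = c' at *
  generalize (‖a‖ : ℂ) = n at *
  field_simp
  ring

end SineGordon
end

noncomputable section
namespace SineGordon

/-! ### Separation of arcs with distinct tangents at a common end -/

/-- By homogeneity it suffices to treat `x + y = 1`, a compact segment on which the expression
vanishes only if the directions lie on a common ray. -/
lemma exists_norm_sub_ge_of_not_sameRay {p q : ℂ} (hpq : ¬ SameRay ℝ p q) :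
    ∃ c > 0, ∀ x y : ℝ, 0 ≤ x → 0 ≤ y → c * (x + y) ≤ ‖(x : ℂ) * p - y * q‖ := by
  have hpos : ∀ x ∈ Icc (0 : ℝ) 1, 0 < ‖(x : ℂ) * p - ((1 - x : ℝ) : ℂ) * q‖ := by
    intro x hx
    refine norm_pos_iff.2 fun h => hpq ?_
    have h' := sub_eq_zero.1 h
    rcases eq_or_lt_of_le hx.1 with h0 | h0
    · rw [← h0] at h'
      right; left
      simpa using h'.symm
    rcases eq_or_lt_of_le hx.2 with h1 | h1
    · rw [h1] at h'
      left
      simpa using h'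
    · exact Or.inr (Or.inr ⟨x, 1 - x, h0, by linarith, by simpa [Complex.real_smul] using h'⟩)
  obtain ⟨x₀, hx₀, hmin⟩ := (isCompact_Icc (a := (0 : ℝ)) (b := 1)).exists_isMinOn
    ⟨0, by simp⟩ (f := fun x : ℝ => ‖(x : ℂ) * p - ((1 - x : ℝ) : ℂ) * q‖) (by fun_prop)
  refine ⟨_, hpos x₀ hx₀, fun x y hx hy => ?_⟩
  rcases eq_or_lt_of_le (add_nonneg hx hy) with h | h
  · rw [← h, mul_zero]; exact norm_nonneg _
  have hx' : x / (x + y) ∈ Icc (0 : ℝ) 1 :=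
    ⟨by positivity, (div_le_one h).2 (by linarith)⟩
  have := hmin hx'
  simp only [mem_ofPred_eq] at this
  have e : (x : ℂ) * p - y * q = ((x + y : ℝ) : ℂ) *
      (((x / (x + y) : ℝ) : ℂ) * p - ((1 - x / (x + y) : ℝ) : ℂ) * q) := by
    have : ((x + y : ℝ) : ℂ) ≠ 0 := ofReal_ne_zero.2 h.ne'
    push_cast at this ⊢
    field_simp
    ring
  rw [e, norm_mul, norm_real, Real.norm_eq_abs, abs_of_pos h, mul_comm]
  exact mul_le_mul_of_nonneg_left this h.le

lemma eventually_separated {P Q : ℝ → ℂ} {u₀ v₀ : ℝ} (hP : ContinuousAt P u₀)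
    (hQ : ContinuousAt Q v₀) (hPQ : ¬ SameRay ℝ (P u₀) (Q v₀)) :
    ∃ c > 0, ∀ᶠ z : ℝ × ℝ in 𝓝 (u₀, v₀), ∀ x y : ℝ, 0 ≤ x → 0 ≤ y →
      c * (x + y) ≤ ‖(x : ℂ) * P z.1 - y * Q z.2‖ := by
  obtain ⟨c, hc, hle⟩ := exists_norm_sub_ge_of_not_sameRay hPQ
  refine ⟨c / 2, by positivity, ?_⟩
  have h1 : ∀ᶠ z : ℝ × ℝ in 𝓝 (u₀, v₀), ‖P z.1 - P u₀‖ < c / 2 := by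
    have := (continuous_fst.continuousAt (x := (u₀, v₀))).eventually
      (hP.eventually (Metric.ball_mem_nhds _ (half_pos hc)))
    filter_upwards [this] with z hz
    rw [← dist_eq_norm]; exact hz
  have h2 : ∀ᶠ z : ℝ × ℝ in 𝓝 (u₀, v₀), ‖Q z.2 - Q v₀‖ < c / 2 := by
    have := (continuous_snd.continuousAt (x := (u₀, v₀))).eventually
      (hQ.eventually (Metric.ball_mem_nhds _ (half_pos hc)))
    filter_upwards [this] with z hz
    rw [← dist_eq_norm]; exact hz
  filter_upwards [h1, h2] with z hz1 hz2 x y hx hy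
  have e : (x : ℂ) * P u₀ - y * Q v₀
      = ((x : ℂ) * P z.1 - y * Q z.2) - x * (P z.1 - P u₀) + y * (Q z.2 - Q v₀) := by ring
  have h3 := hle x y hx hy
  rw [e] at h3
  have h4 := norm_add_le (((x : ℂ) * P z.1 - y * Q z.2) - x * (P z.1 - P u₀)) (y * (Q z.2 - Q v₀))
  have h5 := norm_sub_le ((x : ℂ) * P z.1 - y * Q z.2) (x * (P z.1 - P u₀))
  rw [norm_mul, norm_real, Real.norm_eq_abs, abs_of_nonneg hy] at h4
  rw [norm_mul (x : ℂ) (P z.1 - P u₀), norm_real, Real.norm_eq_abs, abs_of_nonneg hx] at h5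
  nlinarith [mul_le_mul_of_nonneg_left hz1.le hx, mul_le_mul_of_nonneg_left hz2.le hy]

/-- The estimate is local and compactness globalizes it. At a common point the divided differences
are continuous and have limits in distinct directions; elsewhere the distance is bounded below. The
factor `v(1-v)` covers both ends of the loop at once. -/
lemma exists_separation {γ Λ : ℝ → ℂ} (hγ : ContDiff ℝ 1 γ) (hγ1 : γ 1 = 1)
    (hΛ : ContDiff ℝ 1 Λ) (hΛ0 : Λ 0 = 1) (hΛ1 : Λ 1 = 1)
    (hne : ∀ u ∈ Icc (0 : ℝ) 1, ∀ v ∈ Icc (0 : ℝ) 1, γ u = Λ v → u = 1 ∧ (v = 0 ∨ v = 1))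
    (h0 : ¬ SameRay ℝ (-deriv γ 1) (deriv Λ 0)) (h1 : ¬ SameRay ℝ (-deriv γ 1) (-deriv Λ 1)) :
    ∃ c > 0, ∀ u ∈ Icc (0 : ℝ) 1, ∀ v ∈ Icc (0 : ℝ) 1,
      c * ((1 - u) + v * (1 - v)) ≤ ‖γ u - Λ v‖ := by
  have hcpt : IsCompact (Icc (0 : ℝ) 1 ×ˢ Icc (0 : ℝ) 1) := isCompact_Icc.prod isCompact_Icc
  have cP : ContinuousAt (fun u => -dslope γ 1 u) 1 :=
    (continuousAt_dslope_same.2 (hγ.differentiable one_ne_zero 1)).neg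
  have eγ : ∀ u, γ u = 1 + ((1 - u : ℝ) : ℂ) * -dslope γ 1 u := fun u => by
    have := sub_smul_dslope γ 1 u
    rw [hγ1, Complex.real_smul] at this
    push_cast at this ⊢
    linear_combination -this
  have key := hcpt.induction_on (p := fun S => ∃ c > 0, ∀ z ∈ S, z ∈ Icc (0 : ℝ) 1 ×ˢ Icc (0 : ℝ) 1 →
      c * ((1 - z.1) + z.2 * (1 - z.2)) ≤ ‖γ z.1 - Λ z.2‖) ⟨1, one_pos, by simp⟩
    (fun s t hst ⟨c, hc, h⟩ => ⟨c, hc, fun z hz => h z (hst hz)⟩) ?_ ?_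
  · obtain ⟨c, hc, h⟩ := key
    exact ⟨c, hc, fun u hu v hv => h (u, v) ⟨hu, hv⟩ ⟨hu, hv⟩⟩
  · rintro s t ⟨c, hc, h⟩ ⟨c', hc', h'⟩
    refine ⟨min c c', lt_min hc hc', fun z hz hzI => ?_⟩
    have hn : 0 ≤ (1 - z.1) + z.2 * (1 - z.2) :=
      add_nonneg (by linarith [hzI.1.2]) (mul_nonneg hzI.2.1 (by linarith [hzI.2.2]))
    rcases hz with hz | hz
    · exact (mul_le_mul_of_nonneg_right (min_le_left _ _) hn).trans (h z hz hzI)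
    · exact (mul_le_mul_of_nonneg_right (min_le_right _ _) hn).trans (h' z hz hzI)
  · rintro ⟨u₀, v₀⟩ ⟨hu₀, hv₀⟩
    by_cases heq : γ u₀ = Λ v₀
    · obtain ⟨rfl, rfl | rfl⟩ := hne u₀ hu₀ v₀ hv₀ heq
      · have cQ : ContinuousAt (dslope Λ 0) 0 :=
          continuousAt_dslope_same.2 (hΛ.differentiable one_ne_zero 0)
        obtain ⟨c, hc, hev⟩ := eventually_separated cP cQ (by simpa [dslope_same] using h0)
        refine ⟨_, mem_nhdsWithin_of_mem_nhds hev, c, hc, fun z hz hzI => ?_⟩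
        have h3 := hz (1 - z.1) z.2 (by linarith [hzI.1.2]) hzI.2.1
        have e : γ z.1 - Λ z.2
            = ((1 - z.1 : ℝ) : ℂ) * -dslope γ 1 z.1 - (z.2 : ℂ) * dslope Λ 0 z.2 := by
          have := sub_smul_dslope Λ 0 z.2
          rw [hΛ0, Complex.real_smul, sub_zero] at this
          rw [eγ z.1, this]; ring
        rw [e]
        refine le_trans (mul_le_mul_of_nonneg_left ?_ hc.le) h3
        nlinarith [hzI.2.1, hzI.2.2]
      · have cQ : ContinuousAt (fun v => -dslope Λ 1 v) 1 :=
          (continuousAt_dslope_same.2 (hΛ.differentiable one_ne_zero 1)).neg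
        obtain ⟨c, hc, hev⟩ := eventually_separated cP cQ (by simpa [dslope_same] using h1)
        refine ⟨_, mem_nhdsWithin_of_mem_nhds hev, c, hc, fun z hz hzI => ?_⟩
        have h3 := hz (1 - z.1) (1 - z.2) (by linarith [hzI.1.2]) (by linarith [hzI.2.2])
        have e : γ z.1 - Λ z.2
            = ((1 - z.1 : ℝ) : ℂ) * -dslope γ 1 z.1 - ((1 - z.2 : ℝ) : ℂ) * -dslope Λ 1 z.2 := by
          have := sub_smul_dslope Λ 1 z.2
          rw [hΛ1, Complex.real_smul] at this
          rw [eγ z.1]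
          push_cast at this ⊢
          linear_combination this
        rw [e]
        refine le_trans (mul_le_mul_of_nonneg_left ?_ hc.le) h3
        nlinarith [hzI.2.1, hzI.2.2]
    · have hpos : 0 < ‖γ u₀ - Λ v₀‖ := norm_pos_iff.2 (sub_ne_zero.2 heq)
      have hcont : Continuous fun z : ℝ × ℝ => ‖γ z.1 - Λ z.2‖ := by
        have := hγ.continuous
        have := hΛ.continuous
        fun_prop
      have hev := (hcont.tendsto (u₀, v₀)).eventually (lt_mem_nhds (half_lt_self hpos))
      refine ⟨_, mem_nhdsWithin_of_mem_nhds hev, ‖γ u₀ - Λ v₀‖ / 4, by positivity,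
        fun z hz hzI => ?_⟩
      have hz' : ‖γ u₀ - Λ v₀‖ / 2 < ‖γ z.1 - Λ z.2‖ := hz
      have : (1 - z.1) + z.2 * (1 - z.2) ≤ 2 := by
        nlinarith [hzI.1.1, hzI.2.1, hzI.2.2]
      nlinarith

/-- The bound `√x √y ≤ x + y` decouples the two variables, and `1 ≤ √v + √(1-v)` splits the
singularity in `v` between the ends. Every power that remains is `-1/2`, hence integrable. -/
lemma inv_le_of_separation {c x v d : ℝ} (hc : 0 < c) (hx : 0 < x) (hv : v ∈ Ioo (0 : ℝ) 1)
    (h : c * (x + v * (1 - v)) ≤ d) :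
    1 / d ≤ x ^ (-(1 / 2) : ℝ) * (1 / c * (v ^ (-(1 / 2) : ℝ) + (1 - v) ^ (-(1 / 2) : ℝ))) := by
  have hv1 : 0 < 1 - v := by linarith [hv.2]
  have hy : 0 < v * (1 - v) := mul_pos hv.1 hv1
  have sx := Real.sqrt_pos.2 hx
  have s1 := Real.sqrt_pos.2 hv.1
  have s2 := Real.sqrt_pos.2 hv1
  rw [Real.rpow_neg hx.le, Real.rpow_neg hv.1.le, Real.rpow_neg hv1.le, ← Real.sqrt_eq_rpow,
    ← Real.sqrt_eq_rpow, ← Real.sqrt_eq_rpow]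
  have e1 : Real.sqrt x * (Real.sqrt v * Real.sqrt (1 - v)) ≤ x + v * (1 - v) := by
    have := Real.sq_sqrt hx.le
    have := Real.sq_sqrt hv.1.le
    have := Real.sq_sqrt hv1.le
    have e : v * (1 - v) = (Real.sqrt v * Real.sqrt (1 - v)) ^ 2 := by
      rw [mul_pow]; simp [*]
    rw [e]
    nlinarith [sq_nonneg (Real.sqrt x - Real.sqrt v * Real.sqrt (1 - v)),
      mul_pos sx (mul_pos s1 s2)]
  have e2 : 1 ≤ Real.sqrt v + Real.sqrt (1 - v) := by
    have h1 := Real.sq_sqrt hv.1.le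
    have h2 := Real.sq_sqrt hv1.le
    have h3 : Real.sqrt v ≤ 1 := Real.sqrt_le_one.2 hv.2.le
    have h4 : Real.sqrt (1 - v) ≤ 1 := Real.sqrt_le_one.2 (by linarith [hv.1])
    nlinarith
  have e3 : (Real.sqrt x)⁻¹ * (1 / c * ((Real.sqrt v)⁻¹ + (Real.sqrt (1 - v))⁻¹))
      = (Real.sqrt v + Real.sqrt (1 - v)) /
        (c * (Real.sqrt x * (Real.sqrt v * Real.sqrt (1 - v)))) := by
    field_simp
    ring
  rw [e3]
  exact div_le_div₀ (by positivity) e2 (by positivity)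
    ((mul_le_mul_of_nonneg_left e1 hc.le).trans h)

/-- Integrability of a Cauchy integral over `γ` along a curve separated from `γ`. -/
lemma intervalIntegrable_cauchy {γ Λ f : ℝ → ℂ} (hγ : Continuous γ) (hΛ : Continuous Λ) {c K : ℝ}
    (hc : 0 < c) (hsep : ∀ u ∈ Icc (0 : ℝ) 1, ∀ v ∈ Icc (0 : ℝ) 1,
      c * ((1 - u) + v * (1 - v)) ≤ ‖γ u - Λ v‖)
    (hf : AEStronglyMeasurable f (volume.restrict (uIoc (0 : ℝ) 1)))
    (hK : ∀ u ∈ Ioo (0 : ℝ) 1, ‖f u‖ ≤ K) :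
    IntervalIntegrable (fun v => ∫ u in (0 : ℝ)..1, f u / (γ u - Λ v)) volume 0 1 := by
  set ν := (volume : Measure ℝ).restrict (uIoc (0 : ℝ) 1) with hν
  have hK0 : 0 ≤ K := (norm_nonneg _).trans (hK (1 / 2) (by norm_num))
  have i1 : Integrable (fun u : ℝ => K * (1 - u) ^ (-(1 / 2) : ℝ)) ν := by
    have := (intervalIntegrable_inv_sqrt_one_sub.const_mul K)
    rwa [intervalIntegrable_iff] at this
  have i2 : Integrable (fun v : ℝ => 1 / c * (v ^ (-(1 / 2) : ℝ) + (1 - v) ^ (-(1 / 2) : ℝ))) ν := by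
    have := ((intervalIntegrable_inv_sqrt.add intervalIntegrable_inv_sqrt_one_sub).const_mul (1 / c))
    rwa [intervalIntegrable_iff] at this
  -- A product majorant gives integrability on the square; Fubini then gives integrability of the
  -- inner integral in `v`, even where it may be unbounded at the ends.
  have hprod : Integrable (fun z : ℝ × ℝ => f z.2 / (γ z.2 - Λ z.1)) (ν.prod ν) := by
    refine (i2.mul_prod i1).mono' ?_ ?_
    · refine AEStronglyMeasurable.div₀ ?_ ?_
      · exact hf.comp_snd
      · exact (by fun_prop : Continuous fun z : ℝ × ℝ => γ z.2 - Λ z.1).aestronglyMeasurable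
    · have hI : ∀ᵐ u ∂ν, u ∈ Ioo (0 : ℝ) 1 := by
        rw [hν, ae_restrict_iff' measurableSet_uIoc]; exact ae_mem_Ioo
      have h1 : ∀ᵐ z ∂(ν.prod ν), z.1 ∈ Ioo (0 : ℝ) 1 :=
        Measure.quasiMeasurePreserving_fst.ae hI
      have h2 : ∀ᵐ z ∂(ν.prod ν), z.2 ∈ Ioo (0 : ℝ) 1 :=
        Measure.quasiMeasurePreserving_snd.ae hI
      filter_upwards [h1, h2] with z hz1 hz2
      have h3 := inv_le_of_separation hc (x := 1 - z.2) (by linarith [hz2.2]) hz1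
        (hsep z.2 (Ioo_subset_Icc_self hz2) z.1 (Ioo_subset_Icc_self hz1))
      rw [norm_div, div_eq_mul_one_div]
      calc _ ≤ K * ((1 - z.2) ^ (-(1 / 2) : ℝ) *
            (1 / c * (z.1 ^ (-(1 / 2) : ℝ) + (1 - z.1) ^ (-(1 / 2) : ℝ)))) :=
            mul_le_mul (hK _ hz2) h3 (by positivity) hK0
        _ = _ := by ring
  have := hprod.integral_prod_left
  rw [intervalIntegrable_iff]
  refine this.congr (Eventually.of_forall fun v => ?_)
  simp only [hν]
  rw [intervalIntegral.integral_of_le zero_le_one, uIoc_of_le zero_le_one]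

end SineGordon
end

noncomputable section
namespace SineGordon

variable {Ψ : ℂ → ℂ} {D : Set ℂ} {μ : ℝ} {ℓ Λ : ℝ → ℂ} {b : ℝ → ℝ → ℂ} {α' : ℝ → ℂ} {U : Set ℝ}

/-! ### Integrability of `R H` along `Λ` -/

lemma not_sameRay_of_arg {p q : ℂ} (hp : 0 < arg p) (hq : arg q ≠ 0) (h : arg p ≠ arg q) :
    ¬ SameRay ℝ p q := by
  rw [sameRay_iff]
  rintro (rfl | rfl | h')
  · simp at hp
  · simp at hq
  · exact h h'

lemma arg_conj_neg {z : ℂ} (hz : arg z ∈ Ioo 0 (Real.pi / 2)) : arg (conj z) < 0 := by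
  rw [arg_conj, if_neg (by linarith [hz.2, Real.pi_pos])]
  linarith [hz.1]

lemma IsContourSystem.arg_Λ_zero {β : ℝ → ℂ} (hC : IsContourSystem D μ ℓ Λ β) :
    arg (deriv Λ 0) ∈ Ioo 0 (Real.pi / 2) :=
  ⟨hC.arg_β.1.trans hC.tangent_β_Λ, hC.tangent_Λ⟩

lemma IsContourSystem.arg_Λ_one {β : ℝ → ℂ} (hC : IsContourSystem D μ ℓ Λ β) :
    arg (-deriv Λ 1) ∈ Ioo 0 (Real.pi / 2) :=
  ⟨hC.tangent_ℓ.trans hC.tangent_ℓ_Λ, hC.tangent_Λ_β.trans hC.arg_β.2⟩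

/-- The loop itself has tangents at `1` distinct from that of `γ`. The reflected loop has tangents
pointing below the real axis, so these differ automatically from the direction of `γ`. -/
lemma IsContourSystem.exists_separation {β : ℝ → ℂ} (hC : IsContourSystem D μ ℓ Λ β) {γ : ℝ → ℂ}
    (hγ : ContDiff ℝ 1 γ) (hγ1 : γ 1 = 1) (hup : ∀ u ∈ Ico (0 : ℝ) 1, 0 < (γ u).im)
    (hinter : trace Λ ∩ trace γ = {1}) (harg : 0 < arg (-deriv γ 1))
    (h0 : arg (-deriv γ 1) ≠ arg (deriv Λ 0)) (h1 : arg (-deriv γ 1) ≠ arg (-deriv Λ 1)) :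
    (∃ c > 0, ∀ u ∈ Icc (0 : ℝ) 1, ∀ v ∈ Icc (0 : ℝ) 1,
      c * ((1 - u) + v * (1 - v)) ≤ ‖γ u - Λ v‖) ∧
    (∃ c > 0, ∀ u ∈ Icc (0 : ℝ) 1, ∀ v ∈ Icc (0 : ℝ) 1,
      c * ((1 - u) + v * (1 - v)) ≤ ‖γ u - conj (Λ v)‖) := by
  have a0 := hC.arg_Λ_zero
  have a1 := hC.arg_Λ_one
  have hΛd : ∀ v, HasDerivAt (fun v => conj (Λ v)) (conj (deriv Λ v)) v := fun v =>
    (hC.contDiff_Λ.differentiable one_ne_zero v).hasDerivAt.star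
  have hu1 : ∀ u ∈ Icc (0 : ℝ) 1, (γ u).im ≤ 0 → u = 1 := fun u hu h => by
    by_contra hne
    exact absurd (hup u ⟨hu.1, lt_of_le_of_ne hu.2 hne⟩) (not_lt.2 h)
  have hv1 : ∀ v ∈ Icc (0 : ℝ) 1, (Λ v).im ≤ 0 → v = 0 ∨ v = 1 := fun v hv h => by
    by_contra! hne
    exact absurd (hC.upper_Λ v ⟨lt_of_le_of_ne hv.1 (Ne.symm hne.1), lt_of_le_of_ne hv.2 hne.2⟩)
      (not_lt.2 h)
  constructor
  · refine SineGordon.exists_separation hγ hγ1 hC.contDiff_Λ hC.start_Λ hC.finish_Λ ?_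
      (not_sameRay_of_arg harg a0.1.ne' h0) (not_sameRay_of_arg harg a1.1.ne' h1)
    intro u hu v hv h
    have hm : γ u ∈ trace Λ ∩ trace γ := ⟨⟨v, hv, h.symm⟩, u, hu, rfl⟩
    rw [hinter, mem_singleton_iff] at hm
    exact ⟨hu1 u hu (by rw [hm]; simp), hv1 v hv (by rw [← h, hm]; simp)⟩
  · refine SineGordon.exists_separation (Λ := fun v => conj (Λ v)) hγ hγ1 ?_ (by simp [hC.start_Λ])
      (by simp [hC.finish_Λ]) ?_ ?_ ?_
    · exact conjCLE.contDiff.comp hC.contDiff_Λ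
    · intro u hu v hv h
      have h2 := im_nonneg_of_Ioo hC.contDiff_Λ.continuous hC.upper_Λ hv
      have h3 := im_nonneg_of_Ioo hγ.continuous (fun u hu => hup u ⟨hu.1.le, hu.2⟩) hu
      have h4 := congrArg Complex.im h
      rw [conj_im] at h4
      exact ⟨hu1 u hu (by linarith), hv1 v hv (by linarith)⟩
    · have := arg_conj_neg a0
      rw [(hΛd 0).deriv]
      exact not_sameRay_of_arg harg this.ne (by linarith)
    · have := arg_conj_neg a1
      rw [map_neg] at this
      rw [(hΛd 1).deriv]
      exact not_sameRay_of_arg harg this.ne (by linarith)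

lemma arg_neg_deriv_Pinf {μ : ℝ} (hμ : 0 < μ) : arg (-deriv (Pinf μ) 1) = Real.pi / 2 := by
  have h1 : HasDerivAt (fun u : ℝ => I * ((μ * (1 - u) : ℝ) : ℂ)) (I * ((μ * -1 : ℝ) : ℂ)) 1 :=
    ((((hasDerivAt_id (1 : ℝ)).const_sub 1).const_mul μ).ofReal_comp).const_mul I
  have h2 : deriv (Pinf μ) 1 = -(μ * I) := by
    have := h1.cexp.deriv
    rw [show deriv (Pinf μ) 1 = _ from this]
    simp
    ring
  rw [h2, neg_neg, arg_real_mul _ hμ, arg_I]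

lemma IsContourSystem.intervalIntegrable_cauchyTotal {β : ℝ → ℂ} (hC : IsContourSystem D μ ℓ Λ β)
    (hΨ : IsPhaseData Ψ D μ) :
    IntervalIntegrable (fun v => cauchyTotal Ψ μ ℓ β (Λ v)) volume 0 1 := by
  have hfam := IsArcFamily.const hC.arc_β hC.start_β
  have hα : ∀ h ∈ (univ : Set ℝ), HasDerivAt (fun _ : ℝ => β 0) ((fun _ => (0 : ℂ)) h) h :=
    fun h _ => hasDerivAt_const h _
  have hμ := hΨ.angle
  have avP : IsAvoiding (fun _ : ℝ => β) univ (Pinf μ) := isAvoiding_of_inter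
    (fun _ _ => hC.start_β) (contDiff_Pinf μ).continuous
    (fun u hu => Pinf_im_pos hμ ⟨hu.1.le, hu.2⟩) (fun _ _ => hC.inter_β_P)
  have avℓ : IsAvoiding (fun _ : ℝ => β) univ ℓ := isAvoiding_of_inter
    (fun _ _ => hC.start_β) hC.arc_ℓ.contDiff.continuous hC.arc_ℓ.upper
    (fun _ _ => hC.inter_β_ℓ)
  have hcΛ := hC.contDiff_Λ.continuous
  have main : ∀ {γ g : ℝ → ℂ}, IsAvoiding (fun _ : ℝ => β) univ γ →
      AEStronglyMeasurable g (volume.restrict (uIoc (0 : ℝ) 1)) →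
      (∃ C, ∀ u ∈ Ioo (0 : ℝ) 1, ‖g u‖ ≤ C) →
      ((∃ c > 0, ∀ u ∈ Icc (0 : ℝ) 1, ∀ v ∈ Icc (0 : ℝ) 1,
        c * ((1 - u) + v * (1 - v)) ≤ ‖γ u - Λ v‖) ∧
      (∃ c > 0, ∀ u ∈ Icc (0 : ℝ) 1, ∀ v ∈ Icc (0 : ℝ) 1,
        c * ((1 - u) + v * (1 - v)) ≤ ‖γ u - conj (Λ v)‖)) →
      IntervalIntegrable (fun v => arcCauchy γ g β (Λ v)) volume 0 1 ∧
      IntervalIntegrable (fun v => arcCauchy γ g β (conj (Λ v))) volume 0 1 := by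
    rintro γ g hav hg ⟨C, hgC⟩ ⟨⟨c, hc, hs⟩, c', hc', hs'⟩
    obtain ⟨K, -, hK⟩ := hav.exists_bound_div hfam hα hgC (mem_univ (0 : ℝ))
    have hm := hg.div₀ (aestronglyMeasurable_of_continuousOn_Ioo
      (hav.continuousOn_sqrtR hfam (mem_univ (0 : ℝ))))
    have i1 := intervalIntegrable_cauchy hav.cont hcΛ hc hs hm hK
    have i2 := intervalIntegrable_cauchy (Λ := fun v => conj (Λ v)) hav.cont
      (Complex.continuous_conj.comp hcΛ) hc' hs' hm hK
    simp only [arcCauchy, ← div_div]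
    exact ⟨i1, i2⟩
  obtain ⟨p1, p2⟩ := main avP (hC.weight_P hΨ).1 (hC.weight_P hΨ).2
    (hC.exists_separation (contDiff_Pinf μ) (Pinf_one μ) (fun _ hu => Pinf_im_pos hμ hu)
      hC.inter_Λ_P (by rw [arg_neg_deriv_Pinf hμ.1]; positivity)
      (by rw [arg_neg_deriv_Pinf hμ.1]; exact hC.arg_Λ_zero.2.ne')
      (by rw [arg_neg_deriv_Pinf hμ.1]; exact hC.arg_Λ_one.2.ne'))
  obtain ⟨l1, l2⟩ := main avℓ (hC.weight_ℓ hΨ).1 (hC.weight_ℓ hΨ).2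
    (hC.exists_separation hC.arc_ℓ.contDiff hC.arc_ℓ.finish (fun _ hu => hC.ℓ_im_pos hμ hu)
      hC.inter_Λ_ℓ hC.tangent_ℓ
      (hC.tangent_ℓ_Λ.trans (hC.tangent_Λ_β.trans hC.tangent_β_Λ)).ne hC.tangent_ℓ_Λ.ne)
  have i1 := p1.add l1
  have i2 := p2.add l2
  have i3 : IntervalIntegrable (fun v => conj (arcCauchy (Pinf μ) (phaseWeight Ψ (Pinf μ)) β
      (conj (Λ v)) + arcCauchy ℓ (phaseWeight Ψ ℓ) β (conj (Λ v)))) volume 0 1 :=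
    ⟨conjCLE.toContinuousLinearMap.integrable_comp i2.1,
      conjCLE.toContinuousLinearMap.integrable_comp i2.2⟩
  simp only [cauchyTotal, cauchyL_eq]
  exact i1.add i3

lemma IsContourSystem.Λ_mem {β : ℝ → ℂ} (hC : IsContourSystem D μ ℓ Λ β) {u : ℝ}
    (hu : u ∈ Icc (0 : ℝ) 1) : Λ u ∈ upperOne := by
  rcases eq_or_lt_of_le hu.1 with h | h
  · left; rw [← h, hC.start_Λ]
  rcases eq_or_lt_of_le hu.2 with h' | h'
  · left; rw [h', hC.finish_Λ]
  · right; exact hC.upper_Λ u ⟨h, h'⟩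

lemma norm_sqrtR_le {β : ℝ → ℂ} (hβ : IsArc β (β 0) 1) (hs : 0 < (β 0).im) {w : ℂ}
    (hw : 0 < w.im) (hwb : w ∉ trace β) : ‖sqrtR β w‖ ≤ 2 * (‖w‖ + ‖β 0‖) := by
  have hsq := congrArg norm ((IsArcFamily.const hβ hs).sqrtR_sq (mem_univ (0 : ℝ)) hw hwb)
  rw [norm_pow, norm_mul] at hsq
  have h1 := norm_sub_le w (β 0)
  have h2 := norm_sub_le w (conj (β 0))
  rw [Complex.norm_conj] at h2
  have h3 : ‖sqrtR β w‖ ^ 2 ≤ (‖w‖ + ‖β 0‖) ^ 2 := by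
    rw [hsq, sq]
    exact mul_le_mul h1 h2 (norm_nonneg _) (by positivity)
  have h4 := le_of_sq_le_sq h3 (by positivity)
  have : 0 ≤ ‖w‖ + ‖β 0‖ := by positivity
  linarith

/-- Bounds, uniform along `Λ`, for the elementary factors of the integrands. -/
lemma IsContourSystem.exists_bounds_Λ {β : ℝ → ℂ} (hC : IsContourSystem D μ ℓ Λ β) :
    ∃ K > 0, ∀ u ∈ Ioo (0 : ℝ) 1, ‖Λ u‖ ≤ K ∧ ‖1 / Λ u‖ ≤ K ∧ ‖1 / sqrtNeg (Λ u)‖ ≤ K ∧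
      ‖sqrtNeg (Λ u)‖ ≤ K ∧ ‖deriv Λ u‖ ≤ K := by
  have hcΛ := hC.contDiff_Λ.continuous
  have hcΛ' : Continuous (deriv Λ) := hC.contDiff_Λ.continuous_deriv le_rfl
  have hv : ContinuousOn (fun u => sqrtNegUpper (Λ u)) (Icc 0 1) :=
    continuousOn_sqrtNegUpper.comp hcΛ.continuousOn fun u hu => hC.Λ_mem hu
  have b (f : ℝ → ℂ) (hf : ContinuousOn f (Icc 0 1)) : ∃ C, ∀ u ∈ Icc (0 : ℝ) 1, ‖f u‖ ≤ C :=
    isCompact_Icc.exists_bound_of_continuousOn hf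
  obtain ⟨C1, h1⟩ := b Λ hcΛ.continuousOn
  obtain ⟨C2, h2⟩ := b (fun u => 1 / Λ u) (continuousOn_const.div hcΛ.continuousOn
    fun u hu => slitPlane_ne_zero (upperOne_slitPlane (hC.Λ_mem hu)))
  obtain ⟨C3, h3⟩ := b (fun u => 1 / sqrtNegUpper (Λ u)) (continuousOn_const.div hv
    fun u hu => sqrtNegUpper_ne_zero_of_mem (hC.Λ_mem hu))
  obtain ⟨C4, h4⟩ := b _ hv
  obtain ⟨C5, h5⟩ := b _ hcΛ'.continuousOn
  refine ⟨max 1 (max C1 (max C2 (max C3 (max C4 C5)))), lt_max_of_lt_left one_pos, fun u hu => ?_⟩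
  have hu' := Ioo_subset_Icc_self hu
  rw [sqrtNeg_eq (hC.upper_Λ u hu)]
  refine ⟨(h1 u hu').trans ?_, (h2 u hu').trans ?_, (h3 u hu').trans ?_, (h4 u hu').trans ?_,
    (h5 u hu').trans ?_⟩ <;> simp

lemma IsContourSystem.continuousOn_sqrtNeg_Λ {β : ℝ → ℂ} (hC : IsContourSystem D μ ℓ Λ β) :
    ContinuousOn (fun u => sqrtNeg (Λ u)) (Ioo 0 1) := by
  have : ContinuousOn (fun u => sqrtNegUpper (Λ u)) (Ioo 0 1) :=
    continuousOn_sqrtNegUpper.comp hC.contDiff_Λ.continuous.continuousOn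
      fun u hu => hC.Λ_mem (Ioo_subset_Icc_self hu)
  exact this.congr fun u hu => sqrtNeg_eq (hC.upper_Λ u hu)

lemma IsContourSystem.sqrtNeg_Λ_ne_zero {β : ℝ → ℂ} (hC : IsContourSystem D μ ℓ Λ β) {u : ℝ}
    (hu : u ∈ Ioo (0 : ℝ) 1) : sqrtNeg (Λ u) ≠ 0 := by
  rw [sqrtNeg_eq (hC.upper_Λ u hu)]
  exact sqrtNegUpper_ne_zero_of_mem (Or.inr (hC.upper_Λ u hu))

lemma IsContourSystem.intervalIntegrable_RH {β : ℝ → ℂ} (hC : IsContourSystem D μ ℓ Λ β)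
    (hΨ : IsPhaseData Ψ D μ) (x t : ℝ) : IntervalIntegrable
      (fun v => sqrtR β (Λ v) * funH Ψ μ ℓ β x t (Λ v) * deriv Λ v) volume 0 1 := by
  obtain ⟨K, hK, hb⟩ := hC.exists_bounds_Λ
  have hav := hC.isAvoiding_Λ
  have hfam := IsArcFamily.const hC.arc_β hC.start_β
  have hcΛ := hC.contDiff_Λ.continuous
  have hcΛ' : Continuous (deriv Λ) := hC.contDiff_Λ.continuous_deriv le_rfl
  have hΛ0 : ∀ v ∈ Ioo (0 : ℝ) 1, Λ v ≠ 0 := fun v hv h => by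
    have := hC.upper_Λ v hv
    simp [h] at this
  have i1 : IntervalIntegrable (fun v => ((x - t : ℝ) : ℂ) / (Λ v * (‖β 0‖ : ℂ))) volume 0 1 := by
    refine intervalIntegrable_of_bounded (C := ‖((x - t : ℝ) : ℂ) / (‖β 0‖ : ℂ)‖ * K)
      (aestronglyMeasurable_of_continuousOn_Ioo ?_) fun v hv => ?_
    · refine continuousOn_const.div (by fun_prop) fun v hv => mul_ne_zero (hΛ0 v hv) ?_
      exact ofReal_ne_zero.2 (norm_ne_zero_iff.2 hC.start_ne_zero)
    · have e : ((x - t : ℝ) : ℂ) / (Λ v * (‖β 0‖ : ℂ))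
          = ((x - t : ℝ) : ℂ) / (‖β 0‖ : ℂ) * (1 / Λ v) := by ring
      rw [e, norm_mul]
      exact mul_le_mul_of_nonneg_left (hb v hv).2.1 (norm_nonneg _)
  have i2 := i1.sub ((hC.intervalIntegrable_cauchyTotal hΨ).const_mul (2 / Real.pi : ℂ))
  have hRc := hav.continuousOn_sqrtR hfam (mem_univ (0 : ℝ))
  have hfac : ContinuousOn (fun v => sqrtR β (Λ v) * -(1 / (4 * sqrtNeg (Λ v))) * deriv Λ v)
      (Ioo 0 1) :=
    (hRc.mul ((continuousOn_const.div (continuousOn_const.mul hC.continuousOn_sqrtNeg_Λ)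
      fun v hv => mul_ne_zero (by norm_num : (4 : ℂ) ≠ 0) (hC.sqrtNeg_Λ_ne_zero hv)).neg)).mul hcΛ'.continuousOn
  have hbd : ∀ v ∈ Ioo (0 : ℝ) 1, ‖sqrtR β (Λ v) * -(1 / (4 * sqrtNeg (Λ v))) * deriv Λ v‖
      ≤ 2 * (K + ‖β 0‖) * (1 / 4 * K) * K := by
    intro v hv
    obtain ⟨b1, -, b3, -, b5⟩ := hb v hv
    have hR := norm_sqrtR_le hC.arc_β hC.start_β (hC.upper_Λ v hv) (hav.off 0 (mem_univ _) v hv)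
    rw [norm_mul, norm_mul, norm_neg]
    have e : ‖1 / (4 * sqrtNeg (Λ v))‖ ≤ 1 / 4 * K := by
      have : 1 / (4 * sqrtNeg (Λ v)) = 1 / 4 * (1 / sqrtNeg (Λ v)) := by ring
      rw [this, norm_mul]
      refine mul_le_mul (by norm_num) b3 (norm_nonneg _) (by norm_num)
    refine mul_le_mul (mul_le_mul (hR.trans ?_) e (norm_nonneg _) (by positivity)) b5
      (norm_nonneg _) (by positivity)
    linarith
  rw [intervalIntegrable_iff] at i2 ⊢
  have i3 := Integrable.bdd_mul (c := 2 * (K + ‖β 0‖) * (1 / 4 * K) * K) i2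
    (aestronglyMeasurable_of_continuousOn_Ioo hfac) ?_
  · refine i3.congr (Eventually.of_forall fun v => ?_)
    simp only [funH_eq]
    ring
  · rw [ae_restrict_iff' measurableSet_uIoc]
    filter_upwards [ae_mem_Ioo] with v hv hv' using hbd v (hv hv')

/-! ### Continuity of `H` and differentiation of `M` and `I` -/

lemma IsContourSystem.continuousAt_funH {β : ℝ → ℂ} (hC : IsContourSystem D μ ℓ Λ β)
    (hΨ : IsPhaseData Ψ D μ) (x t : ℝ) {w : ℂ} (hw : 0 < w.im) (hwℓ : w ∉ trace ℓ)
    (hwP : w ∉ trace (Pinf μ)) : ContinuousAt (funH Ψ μ ℓ β x t) w := by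
  have hfam := IsArcFamily.const hC.arc_β hC.start_β
  have hα : ∀ h ∈ (univ : Set ℝ), HasDerivAt (fun _ : ℝ => β 0) ((fun _ => (0 : ℂ)) h) h :=
    fun h _ => hasDerivAt_const h _
  have avP : IsAvoiding (fun _ : ℝ => β) univ (Pinf μ) := isAvoiding_of_inter
    (fun _ _ => hC.start_β) (contDiff_Pinf μ).continuous
    (fun u hu => Pinf_im_pos hΨ.angle ⟨hu.1.le, hu.2⟩) (fun _ _ => hC.inter_β_P)
  have avℓ : IsAvoiding (fun _ : ℝ => β) univ ℓ := isAvoiding_of_inter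
    (fun _ _ => hC.start_β) hC.arc_ℓ.contDiff.continuous hC.arc_ℓ.upper
    (fun _ _ => hC.inter_β_ℓ)
  obtain ⟨m1, C1, hC1⟩ := hC.weight_P hΨ
  obtain ⟨m2, C2, hC2⟩ := hC.weight_ℓ hΨ
  have hL : ∀ y, y ∉ trace ℓ → y ∉ trace (Pinf μ) → ContinuousAt (cauchyL Ψ μ ℓ β) y := by
    intro y h1 h2
    have e : cauchyL Ψ μ ℓ β = fun w => arcCauchy (Pinf μ) (phaseWeight Ψ (Pinf μ)) β w
        + arcCauchy ℓ (phaseWeight Ψ ℓ) β w := funext fun w => cauchyL_eq β w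
    rw [e]
    exact (avP.continuousAt_arcCauchy hfam hα m1 hC1 (mem_univ (0 : ℝ)) h2).add
      (avℓ.continuousAt_arcCauchy hfam hα m2 hC2 (mem_univ (0 : ℝ)) h1)
  have c1 := hL w hwℓ hwP
  have c2 : ContinuousAt (fun w => conj (cauchyL Ψ μ ℓ β (conj w))) w :=
    Complex.continuous_conj.continuousAt.comp (ContinuousAt.comp (f := conj) (x := w)
      (hL _ (conj_notMem_of_im_pos avℓ hw) (conj_notMem_of_im_pos avP hw))
      Complex.continuous_conj.continuousAt)
  have hopen : IsOpen {w : ℂ | 0 < w.im} := isOpen_lt continuous_const Complex.continuous_im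
  have c3 : ContinuousAt sqrtNeg w := by
    refine (differentiableAt_sqrtNegUpper (slitPlane_of_im_pos hw)).continuousAt.congr ?_
    filter_upwards [hopen.mem_nhds hw] with y hy using (sqrtNeg_eq hy).symm
  have hv : sqrtNeg w ≠ 0 := by
    rw [sqrtNeg_eq hw]; exact sqrtNegUpper_ne_zero_of_mem (Or.inr hw)
  have hw0 : w ≠ 0 := slitPlane_ne_zero (slitPlane_of_im_pos hw)
  have hn : (‖β 0‖ : ℂ) ≠ 0 := ofReal_ne_zero.2 (norm_ne_zero_iff.2 hC.start_ne_zero)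
  unfold funH
  exact ((continuousAt_const.div (continuousAt_const.mul c3) (mul_ne_zero (by norm_num : (4 : ℂ) ≠ 0) hv)).neg).mul
    ((continuousAt_const.div (continuousAt_id.mul continuousAt_const) (mul_ne_zero hw0 hn)).sub
      (continuousAt_const.mul (c1.add c2)))

/-- The motion of `α` acts through `1/R` and through `1/|α|`. The first gives the Cauchy integral at
`α`, the second the explicit term, and together they form `startValue`. -/
lemma IsContourFamily.hasDerivAt_funM (hF : IsContourFamily D μ ℓ Λ b α' U)
    (hΨ : IsPhaseData Ψ D μ) {x t : ℝ → ℝ} {x' t' : ℝ} {h : ℝ} (hU : h ∈ U)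
    (hx : HasDerivAt x x' h) (ht : HasDerivAt t t' h) :
    HasDerivAt (fun h => funM Ψ μ ℓ (b h) (x h) (t h))
      (x' + t' + (x' - t') / ‖b h 0‖ - (α' h * startValue Ψ μ ℓ (b h) (x h) (t h)).re) h := by
  have h0 := (hF.contours h hU).start_ne_zero
  have hn : ‖b h 0‖ ≠ 0 := norm_ne_zero_iff.2 h0
  have d1 := (reCLM.hasFDerivAt.comp_hasDerivAt h (hF.hasDerivAt_cintL hΨ hU)).const_mul 2
    |>.const_mul (2 / Real.pi)
  have d2 : HasDerivAt (fun h => 1 / ‖b h 0‖) (-(1 / 2) * (α' h / (b h 0 * ‖b h 0‖)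
      + conj (α' h) / (conj (b h 0) * ‖b h 0‖)) : ℂ).re h := by
    have := reCLM.hasFDerivAt.comp_hasDerivAt h (hasDerivAt_inv_norm (hF.hasDerivAt h hU) h0)
    refine this.congr_of_eventuallyEq (Eventually.of_forall fun y => ?_)
    simp only [Function.comp_apply, reCLM_apply]
    rw [← ofReal_one, ← ofReal_div, ofReal_re]
  have d3 := ((d1.add hx).add ht).add ((hx.sub ht).mul d2)
  have e : (fun h => funM Ψ μ ℓ (b h) (x h) (t h)) = _ := funext fun h => by
    rw [funM, div_eq_mul_one_div (x h - t h)]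
  rw [e]
  refine d3.congr_deriv ?_
  simp only [reCLM_apply, Pi.sub_apply]
  have e1 : (α' h * startValue Ψ μ ℓ (b h) (x h) (t h)).re
      = (x h - t h) * (α' h / (b h 0 * ‖b h 0‖)).re
        - 2 / Real.pi * (α' h * cauchyTotal Ψ μ ℓ (b h) (b h 0)).re := by
    have e' : α' h * startValue Ψ μ ℓ (b h) (x h) (t h)
        = ((x h - t h : ℝ) : ℂ) * (α' h / (b h 0 * ‖b h 0‖))
          - ((2 / Real.pi : ℝ) : ℂ) * (α' h * cauchyTotal Ψ μ ℓ (b h) (b h 0)) := by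
      rw [startValue]; push_cast; ring
    rw [e', sub_re, re_ofReal_mul, re_ofReal_mul]
  have e2 : (-(1 / 2) * (α' h / (b h 0 * ‖b h 0‖)
      + conj (α' h) / (conj (b h 0) * ‖b h 0‖)) : ℂ).re = -(α' h / (b h 0 * ‖b h 0‖)).re := by
    have : conj (α' h) / (conj (b h 0) * (‖b h 0‖ : ℂ)) = conj (α' h / (b h 0 * ‖b h 0‖)) := by
      simp [map_div₀]
    rw [this, Complex.add_conj]
    have e' : (-(1 / 2) * ((2 * (α' h / (b h 0 * (‖b h 0‖ : ℂ))).re : ℝ) : ℂ))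
        = ((-(α' h / (b h 0 * (‖b h 0‖ : ℂ))).re : ℝ) : ℂ) := by push_cast; ring
    rw [e', ofReal_re]
  -- Taking real parts, the term with `conj α'` and the value at `α*` is the contribution of the
  -- reflected half of `L` at `α`.
  have e3 : (1 / 2 * (α' h * cauchyL Ψ μ ℓ (b h) (b h 0)
        + conj (α' h) * cauchyL Ψ μ ℓ (b h) (conj (b h 0))) : ℂ).re
      = 1 / 2 * (α' h * cauchyTotal Ψ μ ℓ (b h) (b h 0)).re := by
    rw [cauchyTotal]
    simp only [mul_re, mul_im, add_re, add_im, conj_re, conj_im]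
    norm_num
    ring
  rw [e1, e2, e3]
  field_simp
  ring

end SineGordon
end

/-! ### Differentiation of `I` and continuity of `A` and `B` -/

noncomputable section
namespace SineGordon

variable {Ψ : ℂ → ℂ} {D : Set ℂ} {μ : ℝ} {ℓ Λ : ℝ → ℂ} {b : ℝ → ℝ → ℂ} {α' : ℝ → ℂ} {U : Set ℝ}

lemma eventually_norm_le {f : ℝ → ℂ} {h₀ : ℝ} (hf : ContinuousAt f h₀) :
    ∀ᶠ h in 𝓝 h₀, ‖f h‖ ≤ ‖f h₀‖ + 1 := by
  filter_upwards [hf.norm.eventually (gt_mem_nhds (lt_add_one ‖f h₀‖))] with h hh using hh.le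

lemma IsContourFamily.exists_bound_startValue (hF : IsContourFamily D μ ℓ Λ b α' U)
    (hΨ : IsPhaseData Ψ D μ) {x t : ℝ → ℝ} {h₀ : ℝ} (hU : h₀ ∈ U)
    (hX : ContinuousAt (fun h => x h - t h) h₀) :
    ∃ M, 0 ≤ M ∧ ∀ᶠ h in 𝓝 h₀, ‖startValue Ψ μ ℓ (b h) (x h) (t h)‖ ≤ M := by
  obtain ⟨m1, C1, hC1⟩ := (hF.contours h₀ hU).weight_P hΨ
  obtain ⟨m2, C2, hC2⟩ := (hF.contours h₀ hU).weight_ℓ hΨ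
  obtain ⟨M1, hM1⟩ := (hF.avoiding_P hΨ.angle).norm_arcCauchy_start hF.toArcFamily hF.hasDerivAt
    hC1 hU
  obtain ⟨M2, hM2⟩ := (hF.avoiding_ℓ ⟨h₀, hU⟩).norm_arcCauchy_start hF.toArcFamily hF.hasDerivAt
    hC2 hU
  have h0 := (hF.contours h₀ hU).start_ne_zero
  have hc := (hF.hasDerivAt h₀ hU).continuousAt
  have c1 : ContinuousAt (fun h => ((x h - t h : ℝ) : ℂ) / (b h 0 * (‖b h 0‖ : ℂ))) h₀ :=
    (continuous_ofReal.continuousAt.comp hX).div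
      (hc.mul (continuous_ofReal.continuousAt.comp hc.norm))
      (mul_ne_zero h0 (ofReal_ne_zero.2 (norm_ne_zero_iff.2 h0)))
  set c := ‖((x h₀ - t h₀ : ℝ) : ℂ) / (b h₀ 0 * (‖b h₀ 0‖ : ℂ))‖ + 1 with hcdef
  have hp0 : 0 ≤ M1 := (norm_nonneg _).trans hM1.self_of_nhds.1
  have hp1 : 0 ≤ M2 := (norm_nonneg _).trans hM2.self_of_nhds.1
  refine ⟨c + ‖(2 / Real.pi : ℂ)‖ * ((M1 + M2) + (M1 + M2)), by positivity, ?_⟩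
  filter_upwards [eventually_norm_le c1, hM1, hM2] with h e1 e2 e3
  rw [startValue]
  refine (norm_sub_le _ _).trans (add_le_add e1 ?_)
  rw [norm_mul, cauchyTotal, cauchyL_eq, cauchyL_eq]
  refine mul_le_mul_of_nonneg_left ?_ (norm_nonneg _)
  refine (norm_add_le _ _).trans (add_le_add ((norm_add_le _ _).trans (add_le_add e2.1 e3.1)) ?_)
  rw [Complex.norm_conj]
  exact (norm_add_le _ _).trans (add_le_add e2.2 e3.2)

lemma IsContourSystem.Λ_notMem_ℓ {β : ℝ → ℂ} (hC : IsContourSystem D μ ℓ Λ β) {v : ℝ}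
    (hv : v ∈ Ioo (0 : ℝ) 1) : Λ v ∉ trace ℓ := fun h => by
  have h1 : Λ v ∈ trace Λ ∩ trace ℓ := ⟨⟨v, Ioo_subset_Icc_self hv, rfl⟩, h⟩
  rw [hC.inter_Λ_ℓ, mem_singleton_iff] at h1
  have := hC.upper_Λ v hv
  simp [h1] at this

lemma IsContourSystem.Λ_notMem_P {β : ℝ → ℂ} (hC : IsContourSystem D μ ℓ Λ β) {v : ℝ}
    (hv : v ∈ Ioo (0 : ℝ) 1) : Λ v ∉ trace (Pinf μ) := fun h => by
  have h1 : Λ v ∈ trace Λ ∩ trace (Pinf μ) := ⟨⟨v, Ioo_subset_Icc_self hv, rfl⟩, h⟩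
  rw [hC.inter_Λ_P, mem_singleton_iff] at h1
  have := hC.upper_Λ v hv
  simp [h1] at this

/-- Domination is possible because the Cauchy integral at `w` has cancelled from the derivative:
what remains involves it only at `α` and `α*`, and is uniformly bounded along `Λ`. Integrability of
`R H₀` itself comes from the separation estimates. -/
lemma IsContourFamily.hasDerivAt_cint_RH (hF : IsContourFamily D μ ℓ Λ b α' U)
    (hΨ : IsPhaseData Ψ D μ) {x t : ℝ → ℝ} {X' : ℝ} {h₀ : ℝ} (hU₀ : h₀ ∈ U)
    (hX : ∀ h ∈ U, HasDerivAt (fun h => x h - t h) X' h) :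
    HasDerivAt (fun h => cint Λ (fun w => sqrtR (b h) w * funH Ψ μ ℓ (b h) (x h) (t h) w))
      (cint Λ (fun w => sqrtR (b h₀) w / sqrtNeg w * (-(1 / 4) * (X' / (w * ‖b h₀ 0‖))
        + 1 / 8 * (α' h₀ * startValue Ψ μ ℓ (b h₀) (x h₀) (t h₀) / (w - b h₀ 0)
          + conj (α' h₀ * startValue Ψ μ ℓ (b h₀) (x h₀) (t h₀)) / (w - conj (b h₀ 0)))))) h₀ := by
  have hC := hF.contours h₀ hU₀
  have hb := hF.toArcFamily
  have hav := hF.avoiding_Λ ⟨h₀, hU₀⟩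
  obtain ⟨K, hK, hKb⟩ := hC.exists_bounds_Λ
  obtain ⟨c, hc, hev⟩ := hb.exists_dist_bound hF.hasDerivAt hav hU₀
  obtain ⟨M, hM, hMb⟩ := hF.exists_bound_startValue hΨ hU₀ (hX h₀ hU₀).continuousAt
  have h0 := hC.start_ne_zero
  have hn0 : (‖b h₀ 0‖ : ℂ) ≠ 0 := ofReal_ne_zero.2 (norm_ne_zero_iff.2 h0)
  have hca := (hF.hasDerivAt h₀ hU₀).continuousAt
  have hUn := hF.isOpen.mem_nhds hU₀
  have e1 := eventually_norm_le (hF.cont_deriv.continuousAt hUn)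
  have e2 := eventually_norm_le hca
  have e3 := eventually_norm_le (f := fun h => 1 / (‖b h 0‖ : ℂ)) (h₀ := h₀)
    (continuousAt_const.div (continuous_ofReal.continuousAt.comp hca.norm) hn0)
  have hcΛ := hC.contDiff_Λ.continuous
  have hcΛ' : Continuous (deriv Λ) := hC.contDiff_Λ.continuous_deriv le_rfl
  set A := ‖α' h₀‖ + 1
  set N := ‖b h₀ 0‖ + 1
  set N' := ‖1 / (‖b h₀ 0‖ : ℂ)‖ + 1
  have hA : 0 ≤ A := by positivity
  have hN : 0 ≤ N := by positivity
  have hN' : 0 ≤ N' := by positivity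
  have hmeas : ∀ h ∈ U, AEStronglyMeasurable
      (fun v => sqrtR (b h) (Λ v) * funH Ψ μ ℓ (b h) (x h) (t h) (Λ v) * deriv Λ v)
      (volume.restrict (uIoc (0 : ℝ) 1)) := fun h hU => by
    refine aestronglyMeasurable_of_continuousOn_Ioo
      (((hav.continuousOn_sqrtR hb hU).mul ?_).mul hcΛ'.continuousOn)
    intro v hv
    exact (ContinuousAt.comp (f := Λ) (x := v)
      ((hF.contours h hU).continuousAt_funH hΨ _ _ (hC.upper_Λ v hv) (hC.Λ_notMem_ℓ hv)
        (hC.Λ_notMem_P hv)) hcΛ.continuousAt).continuousWithinAt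
  have key := intervalIntegral.hasDerivAt_integral_of_dominated_loc_of_deriv_le (𝕜 := ℝ)
    (μ := volume) (a := 0) (b := 1)
    (s := {h | (∀ u ∈ Icc (0 : ℝ) 1, c ≤ ‖Λ u - b h 0‖ ∧ c ≤ ‖Λ u - conj (b h 0)‖) ∧
      ‖startValue Ψ μ ℓ (b h) (x h) (t h)‖ ≤ M ∧ ‖α' h‖ ≤ A ∧ ‖b h 0‖ ≤ N ∧
      ‖1 / (‖b h 0‖ : ℂ)‖ ≤ N' ∧ h ∈ U})
    (F := fun h v => sqrtR (b h) (Λ v) * funH Ψ μ ℓ (b h) (x h) (t h) (Λ v) * deriv Λ v)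
    (F' := fun h v => sqrtR (b h) (Λ v) / sqrtNeg (Λ v) *
        (-(1 / 4) * (X' / (Λ v * ‖b h 0‖))
        + 1 / 8 * (α' h * startValue Ψ μ ℓ (b h) (x h) (t h) / (Λ v - b h 0)
          + conj (α' h * startValue Ψ μ ℓ (b h) (x h) (t h)) / (Λ v - conj (b h 0))))
        * deriv Λ v)
    (x₀ := h₀) (bound := fun _ => 2 * (K + N) * K *
      (1 / 4 * (‖(X' : ℂ)‖ * (K * N')) + 1 / 8 * (A * M / c + A * M / c)) * K)
    (by filter_upwards [hev, hMb, e1, e2, e3, hUn] with h h1 h2 h3 h4 h5 h6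
          using ⟨h1, h2, h3, h4, h5, h6⟩)
    (by filter_upwards [hUn] with h hU using hmeas h hU)
    (hC.intervalIntegrable_RH hΨ _ _)
    ?_ ?_ intervalIntegrable_const ?_
  · exact key.2
  · have hd := hev.self_of_nhds
    have n1 : ∀ u ∈ Ioo (0 : ℝ) 1, Λ u - b h₀ 0 ≠ 0 := fun u hu h => by
      have := (hd u (Ioo_subset_Icc_self hu)).1
      rw [h, norm_zero] at this; linarith
    have n2 : ∀ u ∈ Ioo (0 : ℝ) 1, Λ u - conj (b h₀ 0) ≠ 0 := fun u hu h => by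
      have := (hd u (Ioo_subset_Icc_self hu)).2
      rw [h, norm_zero] at this; linarith
    have n3 : ∀ u ∈ Ioo (0 : ℝ) 1, Λ u * (‖b h₀ 0‖ : ℂ) ≠ 0 := fun u hu =>
      mul_ne_zero (fun h => by have := hC.upper_Λ u hu; simp [h] at this) hn0
    refine aestronglyMeasurable_of_continuousOn_Ioo
      ((((hav.continuousOn_sqrtR hb hU₀).div hC.continuousOn_sqrtNeg_Λ
        fun u hu => hC.sqrtNeg_Λ_ne_zero hu).mul
        ((continuousOn_const.mul (continuousOn_const.div ?_ n3)).add
        (continuousOn_const.mul ((continuousOn_const.div ?_ n1).add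
        (continuousOn_const.div ?_ n2))))).mul hcΛ'.continuousOn) <;> fun_prop
  · filter_upwards [ae_mem_Ioo] with v hv hv' h ⟨hd, hM', hAh, hNh, hNh', hU⟩
    have hv := hv hv'
    obtain ⟨d1, d2⟩ := hd v (Ioo_subset_Icc_self hv)
    obtain ⟨k1, k2, k3, -, k5⟩ := hKb v hv
    have hR := norm_sqrtR_le (hb.arc h hU) (hb.start h hU) (hC.upper_Λ v hv)
      (hav.off h hU v hv)
    have q1 : ‖sqrtR (b h) (Λ v) / sqrtNeg (Λ v)‖ ≤ 2 * (K + N) * K := by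
      rw [div_eq_mul_one_div, norm_mul]
      exact mul_le_mul (hR.trans (by linarith)) k3 (norm_nonneg _) (by positivity)
    have q2 : ‖-(1 / 4 : ℂ) * (X' / (Λ v * ‖b h 0‖))‖ ≤ 1 / 4 * (‖(X' : ℂ)‖ * (K * N')) := by
      have e : -(1 / 4 : ℂ) * (X' / (Λ v * ‖b h 0‖))
          = -(1 / 4 : ℂ) * (X' * (1 / Λ v * (1 / (‖b h 0‖ : ℂ)))) := by ring
      rw [e, norm_mul, norm_mul, norm_mul]
      refine mul_le_mul (by norm_num) (mul_le_mul_of_nonneg_left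
        (mul_le_mul k2 hNh' (norm_nonneg _) hK.le) (norm_nonneg _)) (by positivity) (by norm_num)
    have q0 : ‖α' h * startValue Ψ μ ℓ (b h) (x h) (t h)‖ ≤ A * M := by
      rw [norm_mul]; exact mul_le_mul hAh hM' (norm_nonneg _) hA
    have hAM : 0 ≤ A * M := mul_nonneg hA hM
    rw [norm_mul, norm_mul]
    refine mul_le_mul (mul_le_mul q1 ((norm_add_le _ _).trans (add_le_add q2 ?_))
      (norm_nonneg _) (by positivity)) k5 (norm_nonneg _) (by positivity)
    rw [norm_mul]
    refine mul_le_mul (by norm_num) ((norm_add_le _ _).trans (add_le_add ?_ ?_))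
      (norm_nonneg _) (by norm_num)
    · rw [norm_div]; exact div_le_div₀ hAM q0 hc d1
    · rw [norm_div, Complex.norm_conj]; exact div_le_div₀ hAM q0 hc d2
  · filter_upwards [ae_mem_Ioo] with v hv hv' h ⟨hd, hM', hAh, hNh, hNh', hU⟩
    have hv := hv hv'
    exact (hF.hasDerivAt_RH hΨ hU (hX h hU) (hC.upper_Λ v hv) (hC.Λ_notMem_ℓ hv)
      (hC.Λ_notMem_P hv) (fun h hU => hav.off h hU v hv)).mul_const _

/-- At a point of the unit circle where `H(α) = 0`, the derivative of `I` comes only from the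
explicit dependence on `x - t`. -/
lemma IsContourFamily.hasDerivAt_funI (hF : IsContourFamily D μ ℓ Λ b α' U)
    (hΨ : IsPhaseData Ψ D μ) {x t : ℝ → ℝ} {X' : ℝ} {h₀ : ℝ} (hU₀ : h₀ ∈ U)
    (hX : ∀ h ∈ U, HasDerivAt (fun h => x h - t h) X' h)
    (hs : startValue Ψ μ ℓ (b h₀) (x h₀) (t h₀) = 0) (hn : ‖b h₀ 0‖ = 1) :
    HasDerivAt (fun h => funI Ψ μ ℓ Λ (b h) (x h) (t h))
      (-(X' / 8) * (cint Λ (fun w => sqrtR (b h₀) w / (w * sqrtNeg w))).re) h₀ := by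
  have d := ((reCLM.hasFDerivAt.comp_hasDerivAt h₀
    (hF.hasDerivAt_cint_RH hΨ hU₀ hX)).const_mul 2).const_mul (1 / 4)
  refine d.congr_deriv ?_
  have e : cint Λ (fun w => sqrtR (b h₀) w / sqrtNeg w * (-(1 / 4) * (X' / (w * ‖b h₀ 0‖))
        + 1 / 8 * (α' h₀ * startValue Ψ μ ℓ (b h₀) (x h₀) (t h₀) / (w - b h₀ 0)
          + conj (α' h₀ * startValue Ψ μ ℓ (b h₀) (x h₀) (t h₀)) / (w - conj (b h₀ 0)))))
      = ((-(X' / 4) : ℝ) : ℂ) * cint Λ (fun w => sqrtR (b h₀) w / (w * sqrtNeg w)) := by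
    rw [cint, cint, ← intervalIntegral.integral_const_mul]
    refine intervalIntegral.integral_congr fun v _ => ?_
    simp only [hs, hn]
    push_cast
    simp only [mul_zero, zero_div, map_zero, add_zero, mul_one]
    ring
  rw [e, reCLM_apply, re_ofReal_mul]
  ring

/-- Continuity is enough here: in the formula for `n`, `A` and `B` multiply or divide quantities
that vanish at the catastrophe. -/
lemma IsContourFamily.continuousAt_coefA (hF : IsContourFamily D μ ℓ Λ b α' U) {h₀ : ℝ}
    (hU : h₀ ∈ U) : ContinuousAt (fun h => coefA Λ (b h)) h₀ := by
  have hC := hF.contours h₀ hU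
  obtain ⟨K, hK, hb⟩ := hC.exists_bounds_Λ
  have hcΛ' : Continuous (deriv Λ) := hC.contDiff_Λ.continuous_deriv le_rfl
  have d := hF.toArcFamily.hasDerivAt_integral hF.hasDerivAt hF.cont_deriv
    (hF.avoiding_Λ ⟨h₀, hU⟩) (f := fun u => sqrtNeg (Λ u) * deriv Λ u) (C := K * K)
    (aestronglyMeasurable_of_continuousOn_Ioo
      (hC.continuousOn_sqrtNeg_Λ.mul hcΛ'.continuousOn))
    (fun u hu => by
      obtain ⟨-, -, -, h4, h5⟩ := hb u hu
      rw [norm_mul]; exact mul_le_mul h4 h5 (norm_nonneg _) hK.le) hU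
  have e : (fun h => coefA Λ (b h)) = fun h => 1 / 2 * (2 * (∫ u in (0 : ℝ)..1,
      sqrtNeg (Λ u) * deriv Λ u / sqrtR (b h) (Λ u)).re) := by
    funext h
    simp only [coefA, cint, div_mul_eq_mul_div]
  rw [e]
  exact continuousAt_const.mul (continuousAt_const.mul
    (Complex.continuous_re.continuousAt.comp d.continuousAt))

lemma IsContourFamily.continuousAt_coefB (hF : IsContourFamily D μ ℓ Λ b α' U) {h₀ : ℝ}
    (hU : h₀ ∈ U) : ContinuousAt (fun h => coefB Λ (b h)) h₀ := by
  have hC := hF.contours h₀ hU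
  obtain ⟨K, hK, hb⟩ := hC.exists_bounds_Λ
  have hcΛ' : Continuous (deriv Λ) := hC.contDiff_Λ.continuous_deriv le_rfl
  have d := hF.toArcFamily.hasDerivAt_integral hF.hasDerivAt hF.cont_deriv
    (hF.avoiding_Λ ⟨h₀, hU⟩) (f := fun u => 1 / sqrtNeg (Λ u) * deriv Λ u) (C := K * K)
    (aestronglyMeasurable_of_continuousOn_Ioo
      ((continuousOn_const.div hC.continuousOn_sqrtNeg_Λ
        fun u hu => hC.sqrtNeg_Λ_ne_zero hu).mul hcΛ'.continuousOn))
    (fun u hu => by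
      obtain ⟨-, -, h3, -, h5⟩ := hb u hu
      rw [norm_mul]; exact mul_le_mul h3 h5 (norm_nonneg _) hK.le) hU
  have e : (fun h => coefB Λ (b h)) = fun h => 1 / 2 * (2 * (∫ u in (0 : ℝ)..1,
      1 / sqrtNeg (Λ u) * deriv Λ u / sqrtR (b h) (Λ u)).re) := by
    funext h
    simp only [coefB, cint]
    congr 3
    refine intervalIntegral.integral_congr fun u _ => ?_
    ring
  rw [e]
  exact continuousAt_const.mul (continuousAt_const.mul
    (Complex.continuous_re.continuousAt.comp d.continuousAt))

end SineGordon
end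

noncomputable section
namespace SineGordon

/-! ### Injective analytic functions and Cauchy estimates -/

/-- If the derivative vanished, then `f - f(z) = hⁿ` with `n ≥ 2` and `h` a local coordinate. The
points where `h` equals `y` and `ζy`, `ζ` a primitive `n`-th root of unity, would be distinct with
the same image. -/
lemma deriv_ne_zero_of_injOn {f : ℂ → ℂ} {z : ℂ} {V : Set ℂ} (hf : AnalyticAt ℂ f z)
    (hV : V ∈ 𝓝 z) (hinj : InjOn f V) : deriv f z ≠ 0 := by
  have hF : AnalyticAt ℂ (fun y => f y - f z) z := hf.sub analyticAt_const
  have hnc : ¬ ∀ᶠ y in 𝓝 z, f y - f z = 0 := by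
    intro h
    have h1 : ∀ᶠ y in 𝓝[≠] z, f y - f z = 0 ∧ y ∈ V ∧ y ≠ z :=
      (h.filter_mono nhdsWithin_le_nhds).and
        (Filter.Eventually.and (mem_nhdsWithin_of_mem_nhds hV) self_mem_nhdsWithin)
    obtain ⟨y, hy, hyV, hyz⟩ := h1.exists
    exact hyz (hinj hyV (mem_of_mem_nhds hV) (sub_eq_zero.1 hy))
  obtain ⟨n, g, hg, hg0, hev⟩ := hF.exists_eventuallyEq_pow_smul_nonzero_iff.2 hnc
  have hz := hev.self_of_nhds
  intro hd
  have hn0 : n ≠ 0 := by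
    rintro rfl
    simp at hz
    exact hg0 hz.symm
  have hn1 : n ≠ 1 := by
    rintro rfl
    have h1 : HasDerivAt (fun y => (y - z) ^ 1 • g y) (g z) z := by
      have := ((hasDerivAt_id z).sub_const z).mul hg.differentiableAt.hasDerivAt
      refine (this.congr_deriv ?_).congr_of_eventuallyEq ?_
      · simp
      · exact Eventually.of_forall fun y => by simp
    have h2 := (h1.congr_of_eventuallyEq hev).deriv
    rw [deriv_sub_const, hd] at h2
    exact hg0 h2.symm
  -- Extracting the constant root `c` first leaves `g/g(z)`, equal to `1` at `z`, whose principal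
  -- `n`-th root is analytic there.
  obtain ⟨c, hc⟩ := IsAlgClosed.exists_pow_nat_eq (g z) (Nat.pos_of_ne_zero hn0)
  have hc0 : c ≠ 0 := by
    rintro rfl
    rw [zero_pow hn0] at hc
    exact hg0 hc.symm
  set h : ℂ → ℂ := fun y => (y - z) * (c * (g y / g z) ^ (1 / n : ℂ)) with hh
  have hp : AnalyticAt ℂ (fun y => c * (g y / g z) ^ (1 / n : ℂ)) z := by
    refine analyticAt_const.mul ((hg.div analyticAt_const hg0).cpow analyticAt_const ?_)
    rw [Pi.div_apply, div_self hg0]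
    exact one_mem_slitPlane
  have hha : AnalyticAt ℂ h z := (analyticAt_id.sub analyticAt_const).mul hp
  have hhd : HasStrictDerivAt h c z := by
    have h1 := hha.hasStrictDerivAt
    have h2 : HasDerivAt h c z := by
      refine (((hasDerivAt_id z).sub_const z).mul
        hp.differentiableAt.hasDerivAt).congr_deriv ?_
      simp [div_self hg0]
    rwa [h2.deriv] at h1
  have hpow : ∀ᶠ y in 𝓝 z, f y - f z = h y ^ n := by
    filter_upwards [hev] with y hy
    rw [hy, hh, mul_pow, mul_pow, hc, one_div, cpow_nat_inv_pow _ hn0, smul_eq_mul]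
    field_simp
  have hmap := hhd.map_nhds_eq hc0
  have hhz : h z = 0 := by simp [hh]
  rw [hhz] at hmap
  have himg : h '' (V ∩ {y | f y - f z = h y ^ n}) ∈ 𝓝 (0 : ℂ) := by
    rw [← hmap]
    exact image_mem_map (inter_mem hV hpow)
  obtain ⟨ζ, hζ⟩ : ∃ ζ : ℂ, IsPrimitiveRoot ζ n :=
    ⟨_, Complex.isPrimitiveRoot_exp n hn0⟩
  have hm : Tendsto (fun y : ℂ => ζ * y) (𝓝 0) (𝓝 0) := by
    have : Continuous (fun y : ℂ => ζ * y) := by fun_prop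
    simpa using this.tendsto 0
  have h1 : ∀ᶠ y in 𝓝[≠] (0 : ℂ), y ∈ h '' (V ∩ {y | f y - f z = h y ^ n}) ∧
      ζ * y ∈ h '' (V ∩ {y | f y - f z = h y ^ n}) ∧ y ≠ 0 :=
    Filter.Eventually.and (mem_nhdsWithin_of_mem_nhds himg)
      (((hm.eventually himg).filter_mono nhdsWithin_le_nhds).and self_mem_nhdsWithin)
  obtain ⟨y, ⟨q1, ⟨hq1, e1⟩, hy1⟩, ⟨q2, ⟨hq2, e2⟩, hy2⟩, hy0⟩ := h1.exists
  have hq : q1 = q2 := by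
    refine hinj hq1 hq2 (sub_left_injective (b := f z) ?_)
    simp only [mem_ofPred_eq] at e1 e2
    simp only [e1, e2, hy1, hy2, mul_pow, hζ.pow_eq_one, one_mul]
  rw [hq, hy2] at hy1
  have : ζ = 1 := mul_right_cancel₀ hy0 (hy1.trans (one_mul y).symm)
  exact hn1 (hζ.unique (this ▸ IsPrimitiveRoot.one))

/-- The derivative at the center of a disc depends continuously on a parameter. -/
lemma continuousAt_deriv_of_continuousOn {P : Type*} [TopologicalSpace P] {N : Set P} {p₀ : P}
    (hN : N ∈ 𝓝 p₀) {r : ℝ} (hr : 0 < r) {q : P → ℂ → ℂ}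
    (hc : ContinuousOn (fun y : P × ℂ => q y.1 y.2) (N ×ˢ Metric.ball 0 r))
    (ha : ∀ p ∈ N, AnalyticOnNhd ℂ (q p) (Metric.ball 0 r)) :
    ContinuousAt (fun p => deriv (q p) 0) p₀ := by
  have hsub : Metric.closedBall (0 : ℂ) (r / 2) ⊆ Metric.ball 0 r :=
    Metric.closedBall_subset_ball (by linarith)
  have h0 := mem_of_mem_nhds hN
  rw [ContinuousAt, Metric.tendsto_nhds]
  intro ε hε
  -- Uniform closeness within `ε(r/2)/2` on the disc of radius `r/2` gives, by the Cauchy estimate,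
  -- derivatives within `ε/2`.
  obtain ⟨v, hv, hvp⟩ := (isCompact_closedBall (0 : ℂ) (r / 2)).mem_uniformity_of_prod
    (f := q) (hc.mono (prod_mono_right hsub)) h0
    (Metric.dist_mem_uniformity (show 0 < ε * (r / 2) / 2 by positivity))
  rw [nhdsWithin_eq_nhds.2 hN] at hv
  filter_upwards [hv, hN] with p hp hpN
  have hd : DiffContOnCl ℂ (fun z => q p z - q p₀ z) (Metric.ball 0 (r / 2)) :=
    ((((ha p hpN).differentiableOn).mono hsub).sub
      (((ha p₀ h0).differentiableOn).mono hsub)).diffContOnCl_ball subset_rfl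
  have hle := Complex.norm_deriv_le_of_forall_mem_sphere_norm_le (half_pos hr) hd
    (C := ε * (r / 2) / 2) fun z hz => by
      rw [← dist_eq_norm]
      exact (hvp p hp z (Metric.sphere_subset_closedBall hz)).le
  have hz0 : (0 : ℂ) ∈ Metric.ball (0 : ℂ) r := Metric.mem_ball_self hr
  rw [deriv_fun_sub (ha p hpN 0 hz0).differentiableAt (ha p₀ h0 0 hz0).differentiableAt] at hle
  rw [dist_eq_norm]
  refine hle.trans_lt ?_
  rw [div_lt_iff₀ (half_pos hr)]
  have : 0 < ε * (r / 2) := by positivity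
  linarith

/-- At a zero of `f` the slope of `fg` is the slope of `f` times `g`, so `g` need only be
continuous. This avoids differentiating `A`, `B` and `Q'(0)` with respect to the parameters. -/
lemma hasDerivAt_mul_of_eq_zero {𝕜 : Type*} [NontriviallyNormedField 𝕜] [NormedAlgebra 𝕜 ℂ]
    {f g : 𝕜 → ℂ} {f' : ℂ} {h : 𝕜} (hf : HasDerivAt f f' h) (h0 : f h = 0)
    (hg : ContinuousAt g h) : HasDerivAt (fun y => f y * g y) (f' * g h) h := by
  rw [hasDerivAt_iff_tendsto_slope] at hf ⊢
  refine (hf.mul (hg.tendsto.mono_left nhdsWithin_le_nhds)).congr fun y => ?_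
  simp only [slope_def_module, h0, zero_mul, sub_zero, smul_mul_assoc]

/-- A function that is a square after the substitution `w = a + q²`. -/
lemma hasDerivAt_of_comp_sq {W Q : ℂ → ℂ} {a Q' : ℂ} {r : ℝ} (hr : 0 < r)
    (hW : ∀ q ∈ Metric.ball (0 : ℂ) r, W (a + q ^ 2) = Q q ^ 2) (hQ : HasDerivAt Q Q' 0)
    (hQ0 : Q 0 = 0) : HasDerivAt W (Q' ^ 2) a := by
  have hQs : Tendsto (fun q => (Q q / q) ^ 2) (𝓝[≠] 0) (𝓝 (Q' ^ 2)) := by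
    rw [hasDerivAt_iff_tendsto_slope] at hQ
    refine (hQ.pow 2).congr fun q => ?_
    simp [slope_def_field, hQ0]
  have hroot : Tendsto (fun w : ℂ => (w - a) ^ (1 / 2 : ℂ)) (𝓝 a) (𝓝 0) := by
    have h1 : ContinuousAt (fun z : ℂ => z ^ (1 / 2 : ℂ)) (a - a) :=
      continuousAt_cpow_const_of_re_pos (by simp) (by norm_num)
    have h2 := ContinuousAt.comp (f := fun w : ℂ => w - a) (x := a) h1 (by fun_prop)
    have h3 := h2.tendsto
    simpa only [Function.comp_def, sub_self, ne_eq, one_div, inv_eq_zero, OfNat.ofNat_ne_zero,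
      not_false_eq_true, zero_cpow] using h3
  have hsq : ∀ w : ℂ, ((w - a) ^ (1 / 2 : ℂ)) ^ 2 = w - a := fun w => by
    simp [← cpow_nat_mul]
  have hroot' : Tendsto (fun w : ℂ => (w - a) ^ (1 / 2 : ℂ)) (𝓝[≠] a) (𝓝[≠] 0) := by
    refine tendsto_nhdsWithin_iff.2 ⟨hroot.mono_left nhdsWithin_le_nhds, ?_⟩
    filter_upwards [self_mem_nhdsWithin] with w hw h
    have := hsq w
    rw [h, zero_pow two_ne_zero] at this
    exact hw (sub_eq_zero.1 this.symm)
  -- With `q = (w-a)^{1/2}` the slope of `W` at `a` is `(Q(q)/q)²`; either root would do, since only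
  -- the square enters.
  rw [hasDerivAt_iff_tendsto_slope]
  refine (hQs.comp hroot').congr' ?_
  filter_upwards [nhdsWithin_le_nhds (hroot.eventually (Metric.ball_mem_nhds 0 hr)),
    self_mem_nhdsWithin] with w hw hwa
  have h1 := hW _ hw
  have h0 := hW 0 (Metric.mem_ball_self hr)
  rw [hsq, add_sub_cancel] at h1
  rw [hQ0, zero_pow two_ne_zero, add_zero] at h0
  rw [slope_def_field, h1, h0, sub_zero, Function.comp_apply, div_pow, hsq]

/-! ### The residues of the modified function -/

variable {Ψ : ℂ → ℂ} {D : Set ℂ} {μ : ℝ} {ℓ Λ : ℝ → ℂ} {b : ℝ → ℝ → ℂ} {α' : ℝ → ℂ} {U : Set ℝ}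

/-- This is Cramer's rule with determinant `8B(α-α*)`. No invertibility is needed: when the
determinant is zero, both sides are zero by the convention for inverses. -/
lemma residues_zero (β : ℝ → ℂ) (x t : ℝ) : residues Ψ μ ℓ Λ β x t 0 =
    (-(funM Ψ μ ℓ β x t : ℂ) * (coefA Λ β + β 0 * coefB Λ β) + 8 * funI Ψ μ ℓ Λ β x t)
      * (8 * coefB Λ β * (β 0 - conj (β 0)))⁻¹ := by
  rw [residues, Matrix.inv_def, Matrix.det_fin_two_of, Matrix.adjugate_fin_two_of,
    Ring.inverse_eq_inv']
  have e : 8 * ((coefA Λ β : ℂ) + β 0 * coefB Λ β) - 8 * (coefA Λ β + conj (β 0) * coefB Λ β)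
      = 8 * coefB Λ β * (β 0 - conj (β 0)) := by ring
  rw [e]
  simp [Matrix.mulVec, dotProduct, Fin.sum_univ_two]
  ring

lemma IsContourFamily.hasDerivAt_residues (hF : IsContourFamily D μ ℓ Λ b α' U)
    {x t : ℝ → ℝ} {h₀ : ℝ} (hU : h₀ ∈ U) {M' I' : ℝ}
    (hM : HasDerivAt (fun h => funM Ψ μ ℓ (b h) (x h) (t h)) M' h₀)
    (hI : HasDerivAt (fun h => funI Ψ μ ℓ Λ (b h) (x h) (t h)) I' h₀)
    (hM0 : funM Ψ μ ℓ (b h₀) (x h₀) (t h₀) = 0) (hI0 : funI Ψ μ ℓ Λ (b h₀) (x h₀) (t h₀) = 0)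
    (hB : coefB Λ (b h₀) ≠ 0) :
    HasDerivAt (fun h => residues Ψ μ ℓ Λ (b h) (x h) (t h) 0)
      ((-(M' : ℂ) * (coefA Λ (b h₀) + b h₀ 0 * coefB Λ (b h₀)) + 8 * I')
        * (8 * coefB Λ (b h₀) * (b h₀ 0 - conj (b h₀ 0)))⁻¹) h₀ := by
  have hca := (hF.hasDerivAt h₀ hU).continuousAt
  have cA := continuous_ofReal.continuousAt.comp (hF.continuousAt_coefA hU)
  have cB := continuous_ofReal.continuousAt.comp (hF.continuousAt_coefB hU)
  have d1 := hasDerivAt_mul_of_eq_zero (hM.ofReal_comp.neg) (by simp [hM0])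
    (g := fun h => (coefA Λ (b h) + b h 0 * coefB Λ (b h) : ℂ)) (cA.add (hca.mul cB))
  have d2 := d1.add (hI.ofReal_comp.const_mul 8)
  have hdet : 8 * (coefB Λ (b h₀) : ℂ) * (b h₀ 0 - conj (b h₀ 0)) ≠ 0 := by
    refine mul_ne_zero (mul_ne_zero (by norm_num) (ofReal_ne_zero.2 hB)) fun h => ?_
    have := congrArg Complex.im h
    simp at this
    linarith [(hF.contours h₀ hU).start_β]
  have d3 := hasDerivAt_mul_of_eq_zero d2 (by simp [hM0, hI0])
    (g := fun h => (8 * (coefB Λ (b h) : ℂ) * (b h 0 - conj (b h 0)))⁻¹)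
    (((continuousAt_const.mul cB).mul
      (hca.sub (Complex.continuous_conj.continuousAt.comp hca))).inv₀ hdet)
  simp only [residues_zero]
  exact d3

end SineGordon
end

noncomputable section
namespace SineGordon

/-! ### The conformal map near the branch point -/

/-- This is used to differentiate `q ∫ g(vq) dv` at `q = 0`, where the derivative is the value of
the average, without any differentiability of `g`. -/
lemma continuousAt_integral_dilation {g : ℂ → ℂ} {r : ℝ} (hr : 0 < r)
    (hg : ContinuousOn g (Metric.ball 0 r)) :
    ContinuousAt (fun q : ℂ => ∫ v in (0 : ℝ)..1, g (v * q)) 0 := by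
  have hmem : ∀ ε, ∀ q ∈ Metric.ball (0 : ℂ) ε, ∀ v ∈ Icc (0 : ℝ) 1,
      (v : ℂ) * q ∈ Metric.ball (0 : ℂ) ε := by
    intro ε q hq v hv
    rw [mem_ball_zero_iff] at hq ⊢
    rw [norm_mul, norm_real, Real.norm_of_nonneg hv.1]
    exact (mul_le_of_le_one_left (norm_nonneg _) hv.2).trans_lt hq
  have h0 : ContinuousAt g 0 := hg.continuousAt (Metric.ball_mem_nhds 0 hr)
  obtain ⟨ε, hε, hb⟩ := Metric.eventually_nhds_iff_ball.1
    (h0.norm.eventually (gt_mem_nhds (lt_add_one ‖g 0‖)))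
  refine intervalIntegral.continuousAt_of_dominated_interval (bound := fun _ => ‖g 0‖ + 1) ?_ ?_
    intervalIntegrable_const ?_
  · filter_upwards [Metric.ball_mem_nhds 0 hr] with q hq
    refine aestronglyMeasurable_of_continuousOn_Ioo ?_
    exact hg.comp (f := fun v : ℝ => (v : ℂ) * q) (by fun_prop)
      fun v hv => hmem r q hq v (Ioo_subset_Icc_self hv)
  · filter_upwards [Metric.ball_mem_nhds 0 hε] with q hq
    filter_upwards [ae_mem_Ioo] with v hv hv'
    exact (hb _ (hmem ε q hq v (Ioo_subset_Icc_self (hv hv')))).le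
  · refine Eventually.of_forall fun v _ => ?_
    exact ContinuousAt.comp (f := fun q : ℂ => (v : ℂ) * q) (x := 0)
      (by simpa using h0) (by fun_prop)

variable {Ψ : ℂ → ℂ} {D : Set ℂ} {μ : ℝ} {ℓ Λ : ℝ → ℂ} {θ tgc : ℝ} {N : Set (ℝ × ℝ)} {r : ℝ}
  {β : ℝ → ℝ → ℝ → ℂ} {s : ℝ → ℝ → ℂ} {Q W : ℝ → ℝ → ℂ → ℂ}

/-- Minus the integrand at `q = 0` is the derivative. There `(w-α)H` reduces to its polar part, so
only the residue `n` survives; `n*` and `H₀` carry a factor `w - α`. -/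
lemma IsContourSystem.hasDerivAt_halfPhase {β : ℝ → ℂ} (hC : IsContourSystem D μ ℓ Λ β)
    (hΨ : IsPhaseData Ψ D μ) (hr : 0 < r) (hin : ∀ q ∈ Metric.ball (0 : ℂ) r,
      0 < (β 0 + q ^ 2).im ∧ β 0 + q ^ 2 ∉ trace ℓ ∪ trace (Pinf μ)) (x t : ℝ) :
    HasDerivAt (halfPhase Ψ μ ℓ Λ β x t) (2 * residues Ψ μ ℓ Λ β x t 0 *
      ((β 0 - conj (β 0)) ^ (1 / 2 : ℂ) / sqrtNeg (β 0))) 0 := by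
  set g : ℂ → ℂ := fun z => (β 0 + z ^ 2 - conj (β 0)) ^ (1 / 2 : ℂ)
      * regularH Ψ μ ℓ Λ β x t (β 0 + z ^ 2) with hg
  have hs := hC.start_β
  have hsq : Continuous fun z : ℂ => β 0 + z ^ 2 := by fun_prop
  have hgc : ContinuousOn g (Metric.ball 0 r) := by
    intro z hz
    obtain ⟨hi, hn⟩ := hin z hz
    rw [mem_union, not_or] at hn
    have hopen : IsOpen {w : ℂ | 0 < w.im} := isOpen_lt continuous_const Complex.continuous_im
    have c1 : ContinuousAt (fun z : ℂ => (β 0 + z ^ 2 - conj (β 0)) ^ (1 / 2 : ℂ)) z := by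
      refine ContinuousAt.cpow (hsq.continuousAt.sub continuousAt_const) continuousAt_const
        (slitPlane_of_im_pos ?_)
      simp only [sub_im, conj_im]
      linarith
    have c2 : ContinuousAt sqrtNeg (β 0 + z ^ 2) := by
      refine (differentiableAt_sqrtNegUpper (slitPlane_of_im_pos hi)).continuousAt.congr ?_
      filter_upwards [hopen.mem_nhds hi] with y hy using (sqrtNeg_eq hy).symm
    have hv : sqrtNeg (β 0 + z ^ 2) ≠ 0 := by
      rw [sqrtNeg_eq hi]; exact sqrtNegUpper_ne_zero_of_mem (Or.inr hi)
    have c3 : ContinuousAt (regularH Ψ μ ℓ Λ β x t) (β 0 + z ^ 2) := by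
      unfold regularH
      refine ((continuousAt_const.div c2 hv).neg.mul (continuousAt_const.add
        ((continuousAt_const.mul (continuousAt_id.sub continuousAt_const)).div
        (continuousAt_id.sub continuousAt_const) (sub_conj_start_ne_zero hs hi)))).add
        ((continuousAt_id.sub continuousAt_const).mul
          (hC.continuousAt_funH hΨ x t hi hn.1 hn.2))
    exact (c1.mul (ContinuousAt.comp (f := fun z : ℂ => β 0 + z ^ 2) c3
      hsq.continuousAt)).continuousWithinAt
  have hd := (hasDerivAt_mul_of_eq_zero (𝕜 := ℂ) (hasDerivAt_id (0 : ℂ)) rfl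
    (continuousAt_integral_dilation hr hgc)).neg
  have e : halfPhase Ψ μ ℓ Λ β x t = -fun q => id q * ∫ v in (0 : ℝ)..1, g (v * q) := by
    funext q
    rw [halfPhase, Pi.neg_apply, id, mul_comm, ← intervalIntegral.integral_mul_const]
  rw [e]
  refine hd.congr_deriv ?_
  simp only [hg, mul_zero, intervalIntegral.integral_const, sub_zero, one_smul, one_mul, regularH,
    ne_eq, OfNat.ofNat_ne_zero, not_false_eq_true, zero_pow, add_zero, sub_self, zero_mul,
    zero_div]
  ring

lemma IsConformalMap.hasDerivAt_Q (hW : IsConformalMap Ψ D μ ℓ Λ θ tgc N r β s Q W)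
    {p : ℝ × ℝ} (hp : p ∈ N) : HasDerivAt (Q p.1 p.2) (deriv (Q p.1 p.2) 0) 0 :=
  (hW.Q_analytic p hp 0 (Metric.mem_ball_self hW.r_pos)).differentiableAt.hasDerivAt

lemma IsConformalMap.Q_zero (hW : IsConformalMap Ψ D μ ℓ Λ θ tgc N r β s Q W)
    {p : ℝ × ℝ} (hp : p ∈ N) : Q p.1 p.2 0 = 0 := by
  have h := hW.Q_odd p hp 0 (Metric.mem_ball_self hW.r_pos)
  rw [neg_zero] at h
  exact self_eq_neg.1 h

lemma IsConformalMap.deriv_Q_ne_zero (hW : IsConformalMap Ψ D μ ℓ Λ θ tgc N r β s Q W)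
    {p : ℝ × ℝ} (hp : p ∈ N) : deriv (Q p.1 p.2) 0 ≠ 0 :=
  deriv_ne_zero_of_injOn (hW.Q_analytic p hp 0 (Metric.mem_ball_self hW.r_pos))
    (Metric.ball_mem_nhds 0 hW.r_pos) (hW.Q_inj p hp)

/-- The linear coefficient of the identity defining the conformal map. -/
lemma IsConformalMap.s_mul_deriv (hW : IsConformalMap Ψ D μ ℓ Λ θ tgc N r β s Q W)
    (hΨ : IsPhaseData Ψ D μ) {p : ℝ × ℝ} (hp : p ∈ N) :
    s p.1 p.2 * deriv (Q p.1 p.2) 0 = 2 * residues Ψ μ ℓ Λ (β p.1 p.2) p.1 p.2 0 *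
      ((β p.1 p.2 0 - conj (β p.1 p.2 0)) ^ (1 / 2 : ℂ) / sqrtNeg (β p.1 p.2 0)) := by
  have d1 := (hW.contours p hp).hasDerivAt_halfPhase hΨ hW.r_pos
    (fun q hq => ⟨(hW.mem_inside p hp q hq).1, (hW.mem_inside p hp q hq).2.1⟩) p.1 p.2
  have dQ := hW.hasDerivAt_Q hp
  have d2 := ((dQ.fun_pow 5).const_mul (4 / 5 : ℂ)).add (dQ.const_mul (s p.1 p.2))
  have d3 := d2.congr_of_eventuallyEq (f₁ := halfPhase Ψ μ ℓ Λ (β p.1 p.2) p.1 p.2) (by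
    filter_upwards [Metric.ball_mem_nhds 0 hW.r_pos] with q hq using hW.identity p hp q hq)
  rw [d1.unique d3, hW.Q_zero hp]
  simp

/-- Differentiation of `s` along a line through the catastrophe point. -/
lemma IsConformalMap.hasDerivAt_s (hW : IsConformalMap Ψ D μ ℓ Λ θ tgc N r β s Q W)
    (hΨ : IsPhaseData Ψ D μ) {L : ℝ → ℝ × ℝ} {h₀ : ℝ} (hL : Continuous L)
    (hL0 : L h₀ = (0, tgc)) {n' : ℂ}
    (hn : HasDerivAt (fun h => residues Ψ μ ℓ Λ (β (L h).1 (L h).2) (L h).1 (L h).2 0) n' h₀)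
    (hn0 : residues Ψ μ ℓ Λ (β 0 tgc) 0 tgc 0 = 0) :
    HasDerivAt (fun h => s (L h).1 (L h).2) (n' * (2 * ((β 0 tgc 0 - conj (β 0 tgc 0)) ^
      (1 / 2 : ℂ) / sqrtNeg (β 0 tgc 0)) / deriv (Q 0 tgc) 0)) h₀ := by
  have hp₀ := mem_of_mem_nhds hW.nhds
  have hs := (hW.contours _ hp₀).start_β
  simp only at hs
  have hcL : Tendsto L (𝓝 h₀) (𝓝 (0, tgc)) := hL0 ▸ hL.tendsto h₀
  have cQ : ContinuousAt (fun h => deriv (Q (L h).1 (L h).2) 0) h₀ :=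
    ContinuousAt.comp (f := L) (g := fun p : ℝ × ℝ => deriv (Q p.1 p.2) 0) (by
      rw [hL0]
      exact continuousAt_deriv_of_continuousOn hW.nhds hW.r_pos
        (q := fun p : ℝ × ℝ => Q p.1 p.2) hW.Q_cont hW.Q_analytic) hL.continuousAt
  have cα : ContinuousAt (fun h => β (L h).1 (L h).2 0) h₀ :=
    ContinuousAt.comp (f := L) (g := fun p : ℝ × ℝ => β p.1 p.2 0) (by
      rw [hL0]; exact hW.α_analytic.continuousAt) hL.continuousAt
  have hopen : IsOpen {w : ℂ | 0 < w.im} := isOpen_lt continuous_const Complex.continuous_im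
  have cv : ContinuousAt (fun h => sqrtNeg (β (L h).1 (L h).2 0)) h₀ :=
    ContinuousAt.comp (f := fun h => β (L h).1 (L h).2 0) (g := sqrtNeg) (by
      simp only [hL0]
      refine (differentiableAt_sqrtNegUpper (slitPlane_of_im_pos hs)).continuousAt.congr ?_
      filter_upwards [hopen.mem_nhds hs] with y hy using (sqrtNeg_eq hy).symm) cα
  have hv : sqrtNeg (β (L h₀).1 (L h₀).2 0) ≠ 0 := by
    rw [hL0, sqrtNeg_eq hs]; exact sqrtNegUpper_ne_zero_of_mem (Or.inr hs)
  have cr : ContinuousAt (fun h => (β (L h).1 (L h).2 0 - conj (β (L h).1 (L h).2 0)) ^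
      (1 / 2 : ℂ)) h₀ := by
    refine ContinuousAt.cpow
      (cα.sub (Complex.continuous_conj.continuousAt.comp cα)) continuousAt_const
      (slitPlane_of_im_pos ?_)
    simp only [hL0, sub_im, conj_im]
    linarith
  have hQ0 : deriv (Q (L h₀).1 (L h₀).2) 0 ≠ 0 := by
    rw [hL0]; exact hW.deriv_Q_ne_zero hp₀
  -- Near the point, `s` is `n` times a continuous factor, and `n` vanishes at the point itself.
  have d := hasDerivAt_mul_of_eq_zero hn (by rw [hL0]; exact hn0)
    (g := fun h => 2 * ((β (L h).1 (L h).2 0 - conj (β (L h).1 (L h).2 0)) ^ (1 / 2 : ℂ)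
        / sqrtNeg (β (L h).1 (L h).2 0)) / deriv (Q (L h).1 (L h).2) 0)
    ((continuousAt_const.mul (cr.div cv hv)).div cQ hQ0)
  have d' := d.congr_of_eventuallyEq (f₁ := fun h => s (L h).1 (L h).2) (by
    filter_upwards [hcL.eventually_mem hW.nhds] with h hh
    have h1 := hW.s_mul_deriv hΨ hh
    have h2 := hW.deriv_Q_ne_zero hh
    rw [← mul_right_inj' h2, mul_comm, h1]
    field_simp)
  simpa only [hL0] using d'

end SineGordon
end

noncomputable section
namespace SineGordon

variable {Ψ : ℂ → ℂ} {D : Set ℂ} {μ : ℝ} {ℓ Λ : ℝ → ℂ} {θ tgc : ℝ} {N : Set (ℝ × ℝ)} {r : ℝ}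
  {β : ℝ → ℝ → ℝ → ℂ} {s : ℝ → ℝ → ℂ} {Q W : ℝ → ℝ → ℂ → ℂ}

/-! ### Derivatives along lines through the catastrophe point -/

/-- Along an analytic curve of parameters the branch point is analytic, which supplies a continuous
derivative on a whole neighbourhood, as differentiation under the integral requires. -/
lemma IsConformalMap.exists_family (hW : IsConformalMap Ψ D μ ℓ Λ θ tgc N r β s Q W)
    {L : ℝ → ℝ × ℝ} {h₀ : ℝ} (hL : Continuous L) (hLa : AnalyticAt ℝ L h₀)
    (hL0 : L h₀ = (0, tgc)) : ∃ (U : Set ℝ) (α' : ℝ → ℂ), h₀ ∈ U ∧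
      IsContourFamily D μ ℓ Λ (fun h => β (L h).1 (L h).2) α' U := by
  have ha : AnalyticAt ℝ (fun h => β (L h).1 (L h).2 0) h₀ :=
    AnalyticAt.comp (f := L) (g := fun p : ℝ × ℝ => β p.1 p.2 0)
      (by rw [hL0]; exact hW.α_analytic) hLa
  have hev : ∀ᶠ h in 𝓝 h₀, L h ∈ N ∧ AnalyticAt ℝ (fun h => β (L h).1 (L h).2 0) h :=
    Filter.Eventually.and (hL.continuousAt (by rw [hL0]; exact hW.nhds)) ha.eventually_analyticAt
  obtain ⟨U, hU, hUo, h₀U⟩ := mem_nhds_iff.1 hev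
  refine ⟨U, deriv (fun h => β (L h).1 (L h).2 0), h₀U, hUo, fun h hh => hW.contours _ (hU hh).1,
    ?_, fun h hh => (hU hh).2.differentiableAt.hasDerivAt,
    fun h hh => (hU hh).2.deriv.continuousAt.continuousWithinAt⟩
  exact hW.β_cont.comp (f := fun y : ℝ × ℝ => (L y.1, y.2)) (by fun_prop)
    fun y hy => ⟨(hU hy.1).1, hy.2⟩

lemma IsContourSystem.startValue_eq_zero {β : ℝ → ℂ} (hC : IsContourSystem D μ ℓ Λ β) {x t : ℝ}
    (h : funH Ψ μ ℓ β x t (β 0) = 0) : startValue Ψ μ ℓ β x t = 0 := by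
  rw [funH_eq] at h
  have hv : sqrtNeg (β 0) ≠ 0 := by
    rw [sqrtNeg_eq hC.start_β]; exact sqrtNegUpper_ne_zero_of_mem (Or.inr hC.start_β)
  exact (mul_eq_zero.1 h).resolve_left
    (neg_ne_zero.2 (one_div_ne_zero (mul_ne_zero (by norm_num) hv)))

lemma circleRoot_one_eq {k k' : ℝ} (hk' : 0 < k') (h : k ^ 2 + k' ^ 2 = 1) :
    circleRoot k 1 = k' + I * k := by
  have : 1 - k ^ 2 * 1 ^ 2 = k' ^ 2 := by linarith
  rw [circleRoot, this, Real.sqrt_sq hk'.le, mul_one]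

/-- The derivative of the residue `n` along a line, at a point of the unit circle where
`H(α) = 0`. -/
lemma IsContourFamily.hasDerivAt_residues_of_startValue {b : ℝ → ℝ → ℂ} {α' : ℝ → ℂ} {U : Set ℝ}
    (hF : IsContourFamily D μ ℓ Λ b α' U) (hΨ : IsPhaseData Ψ D μ) {x t : ℝ → ℝ} {x' t' h₀ : ℝ}
    (hU : h₀ ∈ U) (hx : ∀ h, HasDerivAt x x' h) (ht : ∀ h, HasDerivAt t t' h)
    (hM0 : funM Ψ μ ℓ (b h₀) (x h₀) (t h₀) = 0) (hI0 : funI Ψ μ ℓ Λ (b h₀) (x h₀) (t h₀) = 0)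
    (hs : startValue Ψ μ ℓ (b h₀) (x h₀) (t h₀) = 0) {k k' : ℝ} (hk : k ∈ Ioo (0 : ℝ) 1)
    (hk' : 0 < k') (hkk : k ^ 2 + k' ^ 2 = 1) (hα : b h₀ 0 = circleRoot k 1 ^ 2) :
    HasDerivAt (fun h => residues Ψ μ ℓ Λ (b h) (x h) (t h) 0)
      (-(x' + I * t' * rho (k ^ 2)) / 8) h₀ := by
  have hC := hF.contours h₀ hU
  have h1 : ‖b h₀ 0‖ = 1 := by
    have h2 := circleRoot_mul_conj hk (show (1 : ℝ) ∈ Icc (0 : ℝ) 1 by simp)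
    rw [Complex.mul_conj'] at h2
    have h3 : ‖circleRoot k 1‖ ^ 2 = 1 := by exact_mod_cast h2
    rw [hα, norm_pow, h3]
  have hK := ellipticK_pos hk
  have hB := hC.coefB_eq hk hα
  have hA := hC.coefA_eq hk hα
  have dM := hF.hasDerivAt_funM hΨ hU (hx h₀) (ht h₀)
  have dI := hF.hasDerivAt_funI hΨ hU (fun h _ => (hx h).sub (ht h)) hs h1
  -- With `startValue = 0` and `|α| = 1` the derivative of `M` is `x' + t' + (x' - t') = 2x'`: a
  -- change of `t` alone has no effect on `M` to first order.
  rw [hs, mul_zero, zero_re, h1, div_one] at dM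
  rw [hC.loop_R_eq hk hα] at dI
  have d := hF.hasDerivAt_residues hU dM dI hM0 hI0 (by rw [hB]; positivity)
  refine d.congr_deriv ?_
  -- With `α = (k' + ik)²`, `A + αB = -4k²(K-S) + 4ikk'K`. The `x'` part of `8I'` cancels the first
  -- term of `-M'(A + αB)`, leaving a real coefficient for `x'` and an imaginary one for `t'`.
  rw [hA, hB, hα, circleRoot_one_eq hk' hkk, rho_eq hk hk' hkk]
  have hkc : (k : ℂ) ≠ 0 := ofReal_ne_zero.2 hk.1.ne'
  have hkc' : (k' : ℂ) ≠ 0 := ofReal_ne_zero.2 hk'.ne'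
  have hKc : (ellipticK (k ^ 2) : ℂ) ≠ 0 := ofReal_ne_zero.2 hK.ne'
  have hkk' : (k : ℂ) ^ 2 + k' ^ 2 = 1 := by exact_mod_cast hkk
  generalize ellipticK (k ^ 2) = K at *
  generalize ellipticS (k ^ 2) = S at *
  have e : (k' + I * k : ℂ) ^ 2 = 1 - 2 * k ^ 2 + 2 * k * k' * I := by
    linear_combination hkk' + k ^ 2 * I_sq
  have e' : (k' + I * k : ℂ) ^ 2 - conj ((k' + I * k : ℂ) ^ 2) = 4 * k * k' * I := by
    simp only [map_pow, map_add, map_mul, conj_ofReal, conj_I]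
    ring
  rw [e', e]
  push_cast
  field_simp
  linear_combination (8 * k ^ 2 * (K - S) * t' : ℂ) * I_sq

/-! ### Phases of the square roots at `e^{iθ}` -/

lemma cpow_half_polar {ρ φ : ℝ} (hρ : 0 < ρ) (hφ : φ ∈ Ioc (-Real.pi) Real.pi) :
    (ρ * cexp (I * φ)) ^ (1 / 2 : ℂ) = (Real.sqrt ρ : ℂ) * cexp (I * (φ / 2)) := by
  have him : (I * (φ : ℂ)).im = φ := by simp
  rw [cpow_def_of_ne_zero (mul_ne_zero (ofReal_ne_zero.2 hρ.ne') (Complex.exp_ne_zero _)),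
    log_ofReal_mul hρ (Complex.exp_ne_zero _), log_exp (by rw [him]; exact hφ.1)
      (by rw [him]; exact hφ.2), Real.sqrt_eq_rpow, Real.rpow_def_of_pos hρ, ofReal_exp,
    ← Complex.exp_add]
  congr 1
  push_cast
  ring

lemma sqrtNeg_exp {θ : ℝ} (hθ : θ ∈ Ioo 0 Real.pi) :
    sqrtNeg (cexp (I * θ)) = cexp (I * ((θ - Real.pi) / 2)) := by
  have e : -cexp (I * θ) = ((1 : ℝ) : ℂ) * cexp (I * ((θ - Real.pi : ℝ) : ℂ)) := by
    push_cast
    rw [mul_sub, Complex.exp_sub, mul_comm I (Real.pi : ℂ), Complex.exp_pi_mul_I]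
    ring
  rw [sqrtNeg, e, cpow_half_polar one_pos ⟨by linarith [hθ.1], by linarith [hθ.2, Real.pi_pos]⟩]
  push_cast
  simp

lemma cpow_half_sub_conj_exp {θ : ℝ} (hθ : θ ∈ Ioo 0 Real.pi) :
    (cexp (I * θ) - conj (cexp (I * θ))) ^ (1 / 2 : ℂ)
      = (Real.sqrt (2 * Real.sin θ) : ℂ) * cexp (I * (Real.pi / 4)) := by
  have hs := Real.sin_pos_of_pos_of_lt_pi hθ.1 hθ.2
  have e : cexp (I * θ) - conj (cexp (I * θ))
      = ((2 * Real.sin θ : ℝ) : ℂ) * cexp (I * ((Real.pi / 2 : ℝ) : ℂ)) := by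
    rw [sub_conj, mul_comm I (θ : ℂ), exp_ofReal_mul_I_im, mul_comm I, ofReal_div, ofReal_ofNat,
      exp_pi_div_two_mul_I]
  rw [e, cpow_half_polar (by positivity) ⟨by linarith [Real.pi_pos], by linarith [Real.pi_pos]⟩]
  push_cast
  ring_nf

/-- The phases of the three factors combine to `i`. -/
lemma phase_quotient {θ : ℝ} (hθ : θ ∈ Ioo 0 Real.pi) {q : ℂ}
    (hq : q = ‖q‖ * cexp (I * (Real.pi / 4 - θ / 2 : ℝ))) :
    (cexp (I * θ) - conj (cexp (I * θ))) ^ (1 / 2 : ℂ) / sqrtNeg (cexp (I * θ)) / q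
      = I * ((Real.sqrt (2 * Real.sin θ) / ‖q‖ : ℝ) : ℂ) := by
  -- The arguments satisfy `π/4 = π/2 + (θ-π)/2 + (π/4 - θ/2)`, which leaves the factor `i`.
  have h : cexp (I * (Real.pi / 4))
      = I * (cexp (I * ((θ - Real.pi) / 2)) * cexp (I * (Real.pi / 4 - θ / 2 : ℝ))) := by
    rw [← Complex.exp_add]
    nth_rw 2 [← exp_pi_div_two_mul_I]
    rw [← Complex.exp_add]
    congr 1
    push_cast
    ring
  have h1 := Complex.exp_ne_zero (I * ((θ - Real.pi) / 2))
  have h2 := Complex.exp_ne_zero (I * (Real.pi / 4 - θ / 2 : ℝ))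
  rw [cpow_half_sub_conj_exp hθ, sqrtNeg_exp hθ, h]
  push_cast at hq h2 ⊢
  generalize cexp (I * ((θ - Real.pi) / 2)) = u at *
  generalize cexp (I * (Real.pi / 4 - θ / 2)) = v at *
  generalize ‖q‖ = n at *
  subst hq
  field_simp

/-! ### The derivative of `s` along a line and its constants -/

lemma IsImpulseProfile.endAngle_mem {G : 𝓢(ℝ, ℝ)} (hG : IsImpulseProfile G) :
    endAngle G ∈ Ioo 0 Real.pi := by
  have h1 : 0 < Real.arcsin (-(G 0) / 2) := Real.arcsin_pos.2 (by linarith [hG.neg])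
  have h2 : Real.arcsin (-(G 0) / 2) < Real.pi / 2 :=
    Real.arcsin_lt_pi_div_two.2 (by linarith [hG.lower])
  exact ⟨by rw [endAngle]; linarith, by rw [endAngle]; linarith⟩

lemma IsPhaseIntegral.isPhaseData {G : 𝓢(ℝ, ℝ)} (hG : IsImpulseProfile G)
    (hΨ : IsPhaseIntegral G Ψ D) : IsPhaseData Ψ D (endAngle G) where
  zero_mem := by
    have := hΨ.segment_mem 0 ⟨le_rfl, by linarith [hG.neg]⟩
    simpa using this
  analytic := hΨ.analytic
  angle := hG.endAngle_mem

/-- The derivative of `s` along a line through a simple catastrophe point. -/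
lemma IsConformalMap.hasDerivAt_s_line (hW : IsConformalMap Ψ D μ ℓ Λ θ tgc N r β s Q W)
    (hΨ : IsPhaseData Ψ D μ) (hgc : IsSimpleCatastrophe Ψ D μ ℓ Λ (β 0 tgc) 0 tgc)
    (hθ : θ ∈ Ioo 0 Real.pi) {x t : ℝ → ℝ} {x' t' h₀ : ℝ} (hx : ∀ h, HasDerivAt x x' h)
    (ht : ∀ h, HasDerivAt t t' h) (hxa : AnalyticAt ℝ x h₀) (hta : AnalyticAt ℝ t h₀)
    (hx0 : x h₀ = 0) (ht0 : t h₀ = tgc) :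
    HasDerivAt (fun h => s (x h) (t h)) (-(x' + I * t' * rho (Real.sin (θ / 2) ^ 2)) *
      (I * ((Real.sqrt (2 * Real.sin θ) / (4 * ‖deriv (Q 0 tgc) 0‖) : ℝ) : ℂ))) h₀ := by
  have hk : Real.sin (θ / 2) ∈ Ioo (0 : ℝ) 1 :=
    ⟨Real.sin_pos_of_pos_of_lt_pi (by linarith [hθ.1]) (by linarith [hθ.2, Real.pi_pos]), by
      rw [← Real.sin_pi_div_two]
      exact Real.sin_lt_sin_of_lt_of_le_pi_div_two (by linarith [hθ.1, Real.pi_pos]) le_rfl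
        (by linarith [hθ.2])⟩
  have hk' : 0 < Real.cos (θ / 2) :=
    Real.cos_pos_of_mem_Ioo ⟨by linarith [hθ.1, Real.pi_pos], by linarith [hθ.2]⟩
  have hkk := Real.sin_sq_add_cos_sq (θ / 2)
  have hα : β 0 tgc 0 = circleRoot (Real.sin (θ / 2)) 1 ^ 2 := by
    rw [hW.α_gc, circleRoot_one_eq hk' hkk, mul_comm I (Real.sin _ : ℂ), ofReal_cos, ofReal_sin,
      ← Complex.exp_mul_I, ← Complex.exp_nat_mul]
    congr 1
    push_cast
    ring
  have hc : Continuous fun h => (x h, t h) :=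
    (continuous_iff_continuousAt.2 fun h => (hx h).continuousAt).prodMk
      (continuous_iff_continuousAt.2 fun h => (ht h).continuousAt)
  obtain ⟨U, α', h₀U, hF⟩ := hW.exists_family hc (hxa.prod hta) (by simp only [hx0, ht0])
  have hM0 := hgc.modulated.M_eq
  have hI0 := hgc.modulated.I_eq
  have hs0 := hgc.modulated.contours.startValue_eq_zero hgc.H_eq
  have dn := hF.hasDerivAt_residues_of_startValue hΨ h₀U hx ht (by simpa only [hx0, ht0] using hM0)
    (by simpa only [hx0, ht0] using hI0) (by simpa only [hx0, ht0] using hs0) hk hk' hkk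
    (by simpa only [hx0, ht0] using hα)
  have ds := hW.hasDerivAt_s hΨ hc (by simp only [hx0, ht0]) dn
    (by rw [residues_zero, hM0, hI0]; simp)
  refine ds.congr_deriv ?_
  rw [mul_div_assoc, hW.α_gc, phase_quotient hθ hW.branch]
  push_cast
  ring

lemma rho_sin_pos {θ : ℝ} (hθ : θ ∈ Ioo 0 Real.pi) : 0 < rho (Real.sin (θ / 2) ^ 2) := by
  have hk : Real.sin (θ / 2) ∈ Ioo (0 : ℝ) 1 :=
    ⟨Real.sin_pos_of_pos_of_lt_pi (by linarith [hθ.1]) (by linarith [hθ.2, Real.pi_pos]), by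
      rw [← Real.sin_pi_div_two]
      exact Real.sin_lt_sin_of_lt_of_le_pi_div_two (by linarith [hθ.1, Real.pi_pos]) le_rfl
        (by linarith [hθ.2])⟩
  have hk' : 0 < Real.cos (θ / 2) :=
    Real.cos_pos_of_mem_Ioo ⟨by linarith [hθ.1, Real.pi_pos], by linarith [hθ.2]⟩
  rw [rho_eq hk hk' (Real.sin_sq_add_cos_sq (θ / 2))]
  have h1 := ellipticK_pos hk
  have h2 := sub_pos.2 (ellipticS_lt_ellipticK hk)
  have h3 := hk.1
  positivity

/-- By the double-angle formula `m(1-m) = (sin θ)²/4`, which is the fourth power of `√(2 sin θ)/2`.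
-/
lemma rpow_quarter_eq {θ : ℝ} (hθ : θ ∈ Ioo 0 Real.pi) :
    (Real.sin (θ / 2) ^ 2 * (1 - Real.sin (θ / 2) ^ 2)) ^ (1 / 4 : ℝ)
      = Real.sqrt (2 * Real.sin θ) / 2 := by
  have hs := Real.sin_pos_of_pos_of_lt_pi hθ.1 hθ.2
  have h1 : Real.sin θ = 2 * Real.sin (θ / 2) * Real.cos (θ / 2) := by
    rw [← Real.sin_two_mul]; ring_nf
  have h2 : Real.sin (θ / 2) ^ 2 * (1 - Real.sin (θ / 2) ^ 2)
      = (Real.sqrt (2 * Real.sin θ) / 2) ^ (4 : ℕ) := by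
    have h3 : Real.sqrt (2 * Real.sin θ) ^ 4 = (2 * Real.sin θ) ^ 2 := by
      rw [← Real.sq_sqrt (show 0 ≤ 2 * Real.sin θ by positivity)]
      ring_nf
      rw [Real.sqrt_sq (by positivity)]
    rw [div_pow, h3, h1, ← Real.cos_sq']
    ring
  rw [h2, ← Real.rpow_natCast, ← Real.rpow_mul (by positivity)]
  norm_num

end SineGordon
end

theorem mainTheorem5 (G : SchwartzMap ℝ ℝ) (hG : SineGordon.IsImpulseProfile G)
    (Ψ : ℂ → ℂ) (D : Set ℂ) (hΨ : SineGordon.IsPhaseIntegral G Ψ D)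
    (tgc : ℝ) (htgc : 0 < tgc) (θ : ℝ) (hθ : θ ∈ Set.Ioo (SineGordon.endAngle G) Real.pi)
    (ℓ Λ : ℝ → ℂ) (β : ℝ → ℝ → ℝ → ℂ)
    (hgc : SineGordon.IsSimpleCatastrophe Ψ D (SineGordon.endAngle G) ℓ Λ (β 0 tgc) 0 tgc)
    (N : Set (ℝ × ℝ)) (r : ℝ) (s : ℝ → ℝ → ℂ) (Q W : ℝ → ℝ → ℂ → ℂ)
    (hW : SineGordon.IsConformalMap Ψ D (SineGordon.endAngle G) ℓ Λ θ tgc N r β s Q W) :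
    ∃ m a b : ℝ, m = Real.sin (θ / 2) ^ 2 ∧
      a = -((m * (1 - m)) ^ (1 / 4 : ℝ)
            / (2 * ‖deriv (W 0 tgc) (Complex.exp (Complex.I * θ))‖ ^ (1 / 2 : ℝ))) ∧
      b = (m * (1 - m)) ^ (1 / 4 : ℝ)
            / (2 * ‖deriv (W 0 tgc) (Complex.exp (Complex.I * θ))‖ ^ (1 / 2 : ℝ))
          * SineGordon.rho m ∧
      b = -a * SineGordon.rho m ∧
      a < 0 ∧ 0 < SineGordon.rho m ∧ 0 < b ∧
      HasDerivAt (fun x : ℝ => s x tgc) (Complex.I * a) 0 ∧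
      HasDerivAt (fun t : ℝ => s 0 t) (b : ℂ) tgc := by
  have hθ' : θ ∈ Set.Ioo 0 Real.pi := ⟨hG.endAngle_mem.1.trans hθ.1, hθ.2⟩
  have hΨ' := hΨ.isPhaseData hG
  have hp₀ := mem_of_mem_nhds hW.nhds
  have hρ := SineGordon.rho_sin_pos hθ'
  have hsin := Real.sin_pos_of_pos_of_lt_pi hθ'.1 hθ'.2
  have hQ : 0 < ‖deriv (Q 0 tgc) 0‖ := norm_pos_iff.2 (hW.deriv_Q_ne_zero hp₀)
  -- At the branch point `W' = Q'(0)²`, so the square root of `|W'|` is `|Q'(0)|`.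
  have hWd : ‖deriv (W 0 tgc) (cexp (I * θ))‖ ^ (1 / 2 : ℝ) = ‖deriv (Q 0 tgc) 0‖ := by
    have h := SineGordon.hasDerivAt_of_comp_sq hW.r_pos (hW.W_eq _ hp₀) (hW.hasDerivAt_Q hp₀)
      (hW.Q_zero hp₀)
    rw [← hW.α_gc, h.deriv, norm_pow, ← Real.sqrt_eq_rpow, Real.sqrt_sq hQ.le]
  have ha : (Real.sin (θ / 2) ^ 2 * (1 - Real.sin (θ / 2) ^ 2)) ^ (1 / 4 : ℝ)
      / (2 * ‖deriv (W 0 tgc) (cexp (I * θ))‖ ^ (1 / 2 : ℝ))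
      = Real.sqrt (2 * Real.sin θ) / (4 * ‖deriv (Q 0 tgc) 0‖) := by
    rw [hWd, SineGordon.rpow_quarter_eq hθ']
    field_simp
    norm_num
  have hpos : 0 < Real.sqrt (2 * Real.sin θ) / (4 * ‖deriv (Q 0 tgc) 0‖) := by positivity
  refine ⟨_, _, _, rfl, rfl, rfl, by ring, ?_, hρ, ?_, ?_, ?_⟩
  · rw [ha]; linarith
  · rw [ha]; positivity
  · rw [ha]
    refine (hW.hasDerivAt_s_line hΨ' hgc hθ' (x := fun h => h) (t := fun _ => tgc)
      (fun h => hasDerivAt_id h) (fun h => hasDerivAt_const h tgc) analyticAt_id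
      analyticAt_const rfl rfl).congr_deriv ?_
    push_cast
    ring
  · rw [ha]
    -- In the `t` direction the factor `-iρ` from `n'` meets the phase `i`, so the derivative is
    -- real and positive.
    refine (hW.hasDerivAt_s_line hΨ' hgc hθ' (x := fun _ => 0) (t := fun h => h)
      (fun h => hasDerivAt_const h 0) (fun h => hasDerivAt_id h) analyticAt_const
      analyticAt_id rfl rfl).congr_deriv ?_
    push_cast
    linear_combination (-(SineGordon.rho (Real.sin (θ / 2) ^ 2) : ℂ) *
      (Real.sqrt (2 * Real.sin θ) / (4 * ‖deriv (Q 0 tgc) 0‖) : ℂ)) * I_sq
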